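/- Let $A=(a_{ij})_{i,j\in I}$ be a generalized Cartan matrix ($I$ finite, $a_{ij}\in\mathbb Z$, $a_{ii}=2$, $a_{ij}\le 0$ for $i\ne j$, and $a_{ij}=0$ implies $a_{ji}=0$). Let $\mathfrak h$ be a vector space of dimension $2|I|-\operatorname{rk}A$ over a field of characteristic $0$, with linearly independent families $(\alpha_i)_{i\in I}$ in $\mathfrak h^*$ and $(\alpha_i^\vee)_{i\in I}$ in $\mathfrak h$ such that $\alpha_j(\alpha_i^\vee)=a_{ij}$. Let $W\subset \mathrm{Aut}(\mathfrak h^*)$ be the Weyl group, generated by $s_i(\varphi)=\varphi-\varphi(\alpha_i^\vee)\alpha_i$, and let $\Phi^{re}=\{w(\alpha_i)\mid w\in W,\ i\in I\}$ be the set of real roots of the associated Kac–Moody root system; for $\alpha=w(\alpha_i)$ put $s_\alpha=ws_iw^{-1}$. Let $\Lambda\subset\mathfrak h^*$ be a formal Demazure lattice, that is, a finitely generated free subgroup such that every simple root $\alpha_i$ can be extended to a basis of $\Lambda$ and $\lambda(\alpha_i^\vee)\in\mathbb Z$ for all $\lambda\in\Lambda$, $i\in I$. Let $R$ be a commutative unital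 ring containing $\mathbb Z[t,t^{-1}]$, put $\mu_1=t+t^{-1}$ and $\mu_2=-1$, and let $$F(u,v)=\frac{u+v-(t+t^{-1})uv}{1-uv}$$ be the corresponding hyperbolic formal group law over $R$. Let $R[[\Lambda]]_F$ be the formal group algebra: the quotient of the completion of the polynomial ring $R[x_\lambda]_{\lambda\in\Lambda}$ at the ideal generated by all $x_\lambda$, by the closure of the ideal generated by $x_0$ and all $x_{\lambda+\lambda'}-F(x_\lambda,x_{\lambda'})$. The group $W$ acts on it by $w(x_\lambda)=x_{w(\lambda)}$. Let $\Delta_{\alpha_i}(\gamma)=(\gamma-s_i(\gamma))/x_{\alpha_i}$ be the Demazure operators on $R[[\Lambda]]_F$, let $Q^F$ be the localization of $R[[\Lambda]]_F$ at the multiplicative set generated by the $x_\alpha$, $\alpha\in\Phi^{re}$, and let $Q^F_W=R[W]\otimes_R Q^F$ be the twisted formal group algebra, with product $(\delta_{w'}\psi')(\delta_w\psi)=\delta_{w'w}\,w^{-1}(\psi')\psi$. The formal affine Demazure algebra $\mathbf D_F$ is the $R$-subalgebra of $Q^F_W$ generated by $R[[\Lambda]]_F$ and the elements $X_\alpha=\frac1{x_\alpha}(1-\delta_{s_\alpha})$,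 $\alpha\in\Phi^{re}$. Let $\mathbf H$ be the $R$-algebra generated by the elements of $R[[\Lambda]]_F$ (with the $R$-algebra relations of $R[[\Lambda]]_F$) and by elements $T_i$, $i\in I$, subject to the relations 1. $(T_i+t)(T_i-t^{-1})=0$ for all $i\in I$; 2. $T_iT_jT_i\cdots=T_jT_iT_j\cdots$ ($m_{ij}$ factors on both sides) for all $i\ne j$ such that the order $m_{ij}$ of $s_is_j$ in $W$ is finite; 3. $\gamma T_i-T_i\,s_i(\gamma)=(1-t\,x_{\alpha_i})\,\Delta_{\alpha_i}(\gamma)$ for all $\gamma\in R[[\Lambda]]_F$ and $i\in I$. Then there is an isomorphism of $R$-algebras $\mathbf D_F\cong\mathbf H$ which sends $\gamma$ to $\gamma$ for every $\gamma\in R[[\Lambda]]_F$. -/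

import Mathlib

noncomputable section

/-! ### Formal group algebras -/

namespace FormalGroup

/-- The hyperbolic 2-parameter formal group law
`F(u, v) = (u + v - μ₁ u v) / (1 + μ₂ u v)` in `R⟦u, v⟧`, with `u = X 0` and `v = X 1`. -/
def hyperbolic {R : Type*} [CommRing R] (μ₁ μ₂ : R) : MvPowerSeries (Fin 2) R :=
  (MvPowerSeries.X 0 + MvPowerSeries.X 1
      - MvPowerSeries.C μ₁ * (MvPowerSeries.X 0 * MvPowerSeries.X 1)) *
    MvPowerSeries.invOfUnit
      (1 + MvPowerSeries.C μ₂ * (MvPowerSeries.X 0 * MvPowerSeries.X 1)) 1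

/-- The augmentation ideal: the kernel of `ε : R[x_λ]_{λ ∈ M} → R`, `x_λ ↦ 0`. -/
def augIdeal (R : Type*) [CommRing R] (M : Type*) : Ideal (MvPolynomial M R) :=
  RingHom.ker (MvPolynomial.aeval (fun _ : M => (0 : R)) : MvPolynomial M R →ₐ[R] R)

lemma X_mem_augIdeal {R : Type*} [CommRing R] {M : Type*} (m : M) :
    (MvPolynomial.X m : MvPolynomial M R) ∈ augIdeal R M := by
  simp [augIdeal, RingHom.mem_ker]

/-- `R⟦x_λ⟧_{λ ∈ M}`: the completion of `R[x_λ]_{λ ∈ M}` at the augmentation ideal, that is,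
the inverse limit of the rings `R[x_λ] / ker(ε) ^ n`. -/
abbrev Completed (R : Type*) [CommRing R] (M : Type*) : Type _ :=
  AdicCompletion (augIdeal R M) (MvPolynomial M R)

/-- The variable `x_λ` as an element of `R⟦x_λ⟧_{λ ∈ M}`. -/
def xCompleted (R : Type*) [CommRing R] {M : Type*} (m : M) : Completed R M :=
  AdicCompletion.of (augIdeal R M) (MvPolynomial M R) (MvPolynomial.X m)

/-- The truncation `∑_{i, j < n} c_{ij} x_λ ^ i x_μ ^ j` of `F(x_λ, x_μ)`, where `c_{ij}` is the
coefficient of `u ^ i v ^ j` in `F`. -/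
def truncSum {R : Type*} [CommRing R] (F : MvPowerSeries (Fin 2) R) {M : Type*} (a b : M)
    (n : ℕ) : MvPolynomial M R :=
  ∑ i ∈ Finset.range n, ∑ j ∈ Finset.range n,
    MvPolynomial.C (MvPowerSeries.coeff (Finsupp.single 0 i + Finsupp.single 1 j) F) *
      (MvPolynomial.X a ^ i * MvPolynomial.X b ^ j)

lemma truncSum_succ_sub_mem {R : Type*} [CommRing R] (F : MvPowerSeries (Fin 2) R)
    {M : Type*} (a b : M) (n : ℕ) :
    truncSum F a b n - truncSum F a b (n + 1) ∈ augIdeal R M ^ n := by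
  have key : ∀ i j : ℕ, n ≤ i + j → ∀ c : R,
      MvPolynomial.C c * (MvPolynomial.X a ^ i * MvPolynomial.X b ^ j) ∈ augIdeal R M ^ n := by
    intro i j hij c
    apply Ideal.mul_mem_left
    apply Ideal.pow_le_pow_right hij
    rw [pow_add]
    exact Ideal.mul_mem_mul (Ideal.pow_mem_pow (X_mem_augIdeal a) i)
      (Ideal.pow_mem_pow (X_mem_augIdeal b) j)
  unfold truncSum
  rw [Finset.sum_range_succ]
  simp only [Finset.sum_range_succ _ n]
  rw [Finset.sum_add_distrib, ← neg_mem_iff]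
  have : ∀ p q r : MvPolynomial M R, -(p - (p + q + r)) = q + r := by intros; ring
  rw [this]
  refine add_mem (sum_mem fun i _ => key _ _ (by omega) _)
    (add_mem (sum_mem fun j _ => key _ _ (by omega) _) (key _ _ (by omega) _))

/-- `x_λ +_F x_μ = F(x_λ, x_μ)` in `R⟦x_λ⟧_{λ ∈ M}`, the limit of the truncations. -/
def formalSum {R : Type*} [CommRing R] (F : MvPowerSeries (Fin 2) R) {M : Type*} (a b : M) :
    Completed R M :=
  AdicCompletion.mk (augIdeal R M) (MvPolynomial M R)
    (AdicCompletion.AdicCauchySequence.mk (augIdeal R M) (MvPolynomial M R) (truncSum F a b)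
      (fun n => by
        rw [SModEq.sub_mem]
        simpa using truncSum_succ_sub_mem F a b n))

/-- The ideal generated by `x_0` and all `x_{λ + μ} - (x_λ +_F x_μ)`. -/
def relIdeal {R : Type*} [CommRing R] (F : MvPowerSeries (Fin 2) R) (M : Type*)
    [AddCommGroup M] : Ideal (Completed R M) :=
  Ideal.span ({xCompleted R (0 : M)} ∪
    {f | ∃ a b : M, f = xCompleted R (a + b) - formalSum F a b})

/-- The ideal `𝔍_F`: the closure of `relIdeal F M` for the topology of the completion, in which
the kernels of the projections to `R[x_λ] / ker(ε) ^ n` are a basis of neighbourhoods of `0`. -/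
def closedRelIdeal {R : Type*} [CommRing R] (F : MvPowerSeries (Fin 2) R) (M : Type*)
    [AddCommGroup M] : Ideal (Completed R M) :=
  ⨅ n : ℕ, relIdeal F M ⊔ RingHom.ker (AdicCompletion.evalₐ (augIdeal R M) n)

/-- The formal group algebra `R⟦M⟧_F = R⟦x_λ⟧_{λ ∈ M} / 𝔍_F`. -/
def FormalGroupAlgebra {R : Type*} [CommRing R] (F : MvPowerSeries (Fin 2) R) (M : Type*)
    [AddCommGroup M] : Type _ :=
  Completed R M ⧸ closedRelIdeal F M

instance {R : Type*} [CommRing R] (F : MvPowerSeries (Fin 2) R) (M : Type*) [AddCommGroup M] :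
    CommRing (FormalGroupAlgebra F M) :=
  inferInstanceAs (CommRing (Completed R M ⧸ closedRelIdeal F M))

instance {R : Type*} [CommRing R] (F : MvPowerSeries (Fin 2) R) (M : Type*) [AddCommGroup M] :
    Algebra R (FormalGroupAlgebra F M) :=
  inferInstanceAs (Algebra R (Completed R M ⧸ closedRelIdeal F M))

/-- The element `x_λ` of `R⟦M⟧_F`. -/
def x {R : Type*} [CommRing R] (F : MvPowerSeries (Fin 2) R) {M : Type*} [AddCommGroup M]
    (m : M) : FormalGroupAlgebra F M :=
  Ideal.Quotient.mk (closedRelIdeal F M) (xCompleted R m)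

/-! #### Functoriality in the group -/

variable {R : Type*} [CommRing R]

lemma augIdeal_le_comap {M N : Type*} (φ : M → N) :
    augIdeal R M ≤ (augIdeal R N).comap (MvPolynomial.rename φ : _ →ₐ[R] MvPolynomial N R) := by
  intro p hp
  simp only [augIdeal, Ideal.mem_comap, RingHom.mem_ker, MvPolynomial.aeval_rename] at hp ⊢
  exact hp

lemma augIdeal_pow_le_comap {M N : Type*} (φ : M → N) (n : ℕ) :
    augIdeal R M ^ n ≤
      (augIdeal R N ^ n).comap (MvPolynomial.rename φ : _ →ₐ[R] MvPolynomial N R) :=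
  (Ideal.pow_right_mono (augIdeal_le_comap φ) n).trans (Ideal.le_comap_pow _ n)

/-- The map `R⟦x_λ⟧_{λ ∈ M} → R[x_λ]_{λ ∈ N} / ker(ε) ^ n`, `x_λ ↦ x_{φ λ}`. -/
def completedMapAux {M N : Type*} (φ : M → N) (n : ℕ) :
    Completed R M →ₐ[R] MvPolynomial N R ⧸ augIdeal R N ^ n :=
  (Ideal.quotientMapₐ (augIdeal R N ^ n) (MvPolynomial.rename φ)
    (augIdeal_pow_le_comap φ n)).comp
      ((AdicCompletion.evalₐ (augIdeal R M) n).restrictScalars R)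

lemma factor_completedMapAux {M N : Type*} (φ : M → N) {m n : ℕ} (hle : m ≤ n) :
    (Ideal.Quotient.factorₐ R (Ideal.pow_le_pow_right hle)).comp
      (completedMapAux (R := R) φ n) = completedMapAux φ m := by
  ext f
  induction f using AdicCompletion.induction_on with
  | _ s =>
    have h := AdicCompletion.Ideal.mk_eq_mk (augIdeal R M) hle s
    simp only [completedMapAux, AlgHom.comp_apply, AlgHom.restrictScalars_apply,
      AdicCompletion.evalₐ_mk]
    rw [← h]
    rfl

/-- The map `R⟦x_λ⟧_{λ ∈ M} → R⟦x_λ⟧_{λ ∈ N}`, `x_λ ↦ x_{φ λ}`. -/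
def completedMap {M N : Type*} (φ : M → N) : Completed R M →ₐ[R] Completed R N :=
  AdicCompletion.liftAlgHom (augIdeal R N) (completedMapAux φ) (factor_completedMapAux φ)

lemma evalₐ_completedMap {M N : Type*} (φ : M → N) (n : ℕ) (f : Completed R M) :
    AdicCompletion.evalₐ (augIdeal R N) n (completedMap φ f) =
      Ideal.quotientMapₐ (augIdeal R N ^ n) (MvPolynomial.rename φ)
        (augIdeal_pow_le_comap φ n) (AdicCompletion.evalₐ (augIdeal R M) n f) :=
  AdicCompletion.evalₐ_liftAlgHom (augIdeal R N) (completedMapAux φ)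
    (factor_completedMapAux φ) n f

lemma completedMap_id {M : Type*} (f : Completed R M) : completedMap id f = f := by
  refine AdicCompletion.ext_evalₐ fun n => ?_
  rw [evalₐ_completedMap]
  generalize AdicCompletion.evalₐ (augIdeal R M) n f = g
  obtain ⟨p, rfl⟩ := Ideal.Quotient.mk_surjective g
  simp

lemma completedMap_comp {M N P : Type*} (ψ : N → P) (φ : M → N) (f : Completed R M) :
    completedMap (ψ ∘ φ) f = completedMap ψ (completedMap φ f) := by
  refine AdicCompletion.ext_evalₐ fun n => ?_
  rw [evalₐ_completedMap, evalₐ_completedMap, evalₐ_completedMap]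
  generalize AdicCompletion.evalₐ (augIdeal R M) n f = g
  obtain ⟨p, rfl⟩ := Ideal.Quotient.mk_surjective g
  simp [MvPolynomial.rename_rename]

lemma completedMap_xCompleted {M N : Type*} (φ : M → N) (m : M) :
    completedMap φ (xCompleted R m) = xCompleted R (φ m) := by
  refine AdicCompletion.ext_evalₐ fun n => ?_
  rw [evalₐ_completedMap]
  simp [xCompleted]

lemma completedMap_formalSum (F : MvPowerSeries (Fin 2) R) {M N : Type*} (φ : M → N)
    (a b : M) : completedMap φ (formalSum F a b) = formalSum F (φ a) (φ b) := by
  refine AdicCompletion.ext_evalₐ fun n => ?_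
  rw [evalₐ_completedMap]
  simp only [formalSum, AdicCompletion.evalₐ_mk]
  refine congrArg (Ideal.Quotient.mk (augIdeal R N ^ n)) ?_
  simp [AdicCompletion.AdicCauchySequence.mk, truncSum]

lemma closedRelIdeal_le_comap (F : MvPowerSeries (Fin 2) R) {M N : Type*} [AddCommGroup M]
    [AddCommGroup N] (φ : M →+ N) :
    closedRelIdeal F M ≤ (closedRelIdeal F N).comap (completedMap (R := R) φ) := by
  intro f hf
  rw [Ideal.mem_comap]
  simp only [closedRelIdeal, Submodule.mem_iInf] at hf ⊢
  intro n
  rw [← Ideal.mem_comap]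
  refine (sup_le ?_ ?_ : relIdeal F M ⊔ RingHom.ker (AdicCompletion.evalₐ (augIdeal R M) n)
    ≤ _) (hf n)
  · refine Ideal.span_le.mpr ?_
    rintro _ (rfl | ⟨a, b, rfl⟩)
    · refine Ideal.mem_sup_left ?_
      rw [completedMap_xCompleted, map_zero]
      exact Ideal.subset_span (Or.inl rfl)
    · refine Ideal.mem_sup_left ?_
      rw [map_sub, completedMap_xCompleted, completedMap_formalSum, map_add]
      exact Ideal.subset_span (Or.inr ⟨_, _, rfl⟩)
  · intro g hg
    refine Ideal.mem_sup_right ?_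
    rw [RingHom.mem_ker] at hg ⊢
    rw [evalₐ_completedMap, hg, map_zero]

/-- The map `R⟦M⟧_F → R⟦N⟧_F`, `x_λ ↦ x_{φ λ}`, induced by a group homomorphism `φ`. -/
def algebraMapOfHom (F : MvPowerSeries (Fin 2) R) {M N : Type*} [AddCommGroup M]
    [AddCommGroup N] (φ : M →+ N) : FormalGroupAlgebra F M →ₐ[R] FormalGroupAlgebra F N :=
  Ideal.quotientMapₐ (closedRelIdeal F N) (completedMap φ) (closedRelIdeal_le_comap F φ)

lemma algebraMapOfHom_x (F : MvPowerSeries (Fin 2) R) {M N : Type*} [AddCommGroup M]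
    [AddCommGroup N] (φ : M →+ N) (m : M) : algebraMapOfHom F φ (x F m) = x F (φ m) := by
  exact congrArg (Ideal.Quotient.mk (closedRelIdeal F N)) (completedMap_xCompleted φ m)

/-- The action of the endomorphisms of `M` on `R⟦M⟧_F`. -/
def endHom (F : MvPowerSeries (Fin 2) R) (M : Type*) [AddCommGroup M] :
    AddMonoid.End M →* (FormalGroupAlgebra F M →ₐ[R] FormalGroupAlgebra F M) where
  toFun φ := algebraMapOfHom F φ
  map_one' := by
    ext f
    obtain ⟨f, rfl⟩ := Ideal.Quotient.mk_surjective f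
    exact congrArg _ (completedMap_id f)
  map_mul' φ ψ := by
    ext f
    obtain ⟨f, rfl⟩ := Ideal.Quotient.mk_surjective f
    exact congrArg _ (completedMap_comp φ ψ f)

end FormalGroup

/-! ### Kac-Moody root systems and formal Demazure lattices -/

namespace KacMoody

open FormalGroup Module

/-- `A` is a generalized Cartan matrix. -/
structure IsGeneralizedCartanMatrix {ι : Type*} (A : Matrix ι ι ℤ) : Prop where
  diag : ∀ i, A i i = 2
  nonpos : ∀ i j, i ≠ j → A i j ≤ 0
  zero_symm : ∀ i j, A i j = 0 → A j i = 0

/-- A realization `(𝔥, Π, Π^∨)` of a generalized Cartan matrix `A` over the field `k`: the vector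
space `𝔥` has dimension `2 l - rank A`, where `l` is the size of `A`, and the families
`Π = (α_i)` in `𝔥^*` and `Π^∨ = (α_i^∨)` in `𝔥` are linearly independent and satisfy
`α_j (α_i^∨) = a_{ij}`. -/
structure Realization (k : Type*) [Field k] {ι : Type*} [Fintype ι] (A : Matrix ι ι ℤ)
    (𝔥 : Type*) [AddCommGroup 𝔥] [Module k 𝔥] where
  cartan : IsGeneralizedCartanMatrix A
  finiteDimensional : FiniteDimensional k 𝔥
  finrank_add_rank : finrank k 𝔥 + (A.map (Int.cast : ℤ → k)).rank = 2 * Fintype.card ι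
  simpleRoot : ι → Dual k 𝔥
  simpleCoroot : ι → 𝔥
  linearIndependent_simpleRoot : LinearIndependent k simpleRoot
  linearIndependent_simpleCoroot : LinearIndependent k simpleCoroot
  pairing : ∀ i j, simpleRoot j (simpleCoroot i) = (A i j : k)

variable {k : Type*} [Field k] {ι : Type*} [Fintype ι] {A : Matrix ι ι ℤ}
  {𝔥 : Type*} [AddCommGroup 𝔥] [Module k 𝔥]

/-- The simple reflection `s_i(φ) = φ - φ(α_i^∨) α_i` of `𝔥^*`. -/
def Realization.reflection (D : Realization k A 𝔥) (i : ι) : Dual k 𝔥 ≃ₗ[k] Dual k 𝔥 :=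
  Module.reflection (x := D.simpleRoot i) (f := Dual.eval k 𝔥 (D.simpleCoroot i))
    (by simp [D.pairing, D.cartan.diag])

lemma Realization.reflection_apply (D : Realization k A 𝔥) (i : ι) (φ : Dual k 𝔥) :
    D.reflection i φ = φ - φ (D.simpleCoroot i) • D.simpleRoot i :=
  Module.reflection_apply _ _

/-- The Weyl group `W ⊆ Aut(𝔥^*)`, generated by the simple reflections. -/
def Realization.weylGroup (D : Realization k A 𝔥) : Subgroup (Dual k 𝔥 ≃ₗ[k] Dual k 𝔥) :=
  Subgroup.closure (Set.range D.reflection)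

/-- The simple reflection `s_i` as an element of `W`. -/
def Realization.s (D : Realization k A 𝔥) (i : ι) : D.weylGroup :=
  ⟨D.reflection i, Subgroup.subset_closure ⟨i, rfl⟩⟩

/-- A formal Demazure lattice: a finitely generated free subgroup `Λ` of `𝔥^*` such that every
simple root can be extended to a basis of `Λ`, and `⟨λ, α_i^∨⟩ ∈ ℤ` for all `λ ∈ Λ` and `i`. -/
structure FormalDemazureLattice (D : Realization k A 𝔥) extends AddSubgroup (Dual k 𝔥) where
  finite : Module.Finite ℤ toAddSubgroup
  free : Module.Free ℤ toAddSubgroup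
  exists_basis : ∀ i, ∃ (n : ℕ) (b : Basis (Fin n) ℤ toAddSubgroup) (j : Fin n),
    (b j : Dual k 𝔥) = D.simpleRoot i
  integral : ∀ φ ∈ toAddSubgroup, ∀ i, ∃ z : ℤ, φ (D.simpleCoroot i) = (z : k)

namespace FormalDemazureLattice

variable {D : Realization k A 𝔥} (Λ : FormalDemazureLattice D)

/-- The group underlying a formal Demazure lattice. -/
abbrev Carrier : Type _ := Λ.toAddSubgroup

lemma simpleRoot_mem (i : ι) : D.simpleRoot i ∈ Λ.toAddSubgroup := by
  obtain ⟨n, b, j, h⟩ := Λ.exists_basis i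
  exact h ▸ (b j).2

lemma reflection_mem (i : ι) {φ : Dual k 𝔥} (hφ : φ ∈ Λ.toAddSubgroup) :
    D.reflection i φ ∈ Λ.toAddSubgroup := by
  obtain ⟨z, hz⟩ := Λ.integral φ hφ i
  rw [D.reflection_apply, hz, Int.cast_smul_eq_zsmul k z (D.simpleRoot i)]
  exact sub_mem hφ (zsmul_mem (Λ.simpleRoot_mem i) z)

lemma weyl_mem (w : D.weylGroup) {φ : Dual k 𝔥} (hφ : φ ∈ Λ.toAddSubgroup) :
    (w : Dual k 𝔥 ≃ₗ[k] Dual k 𝔥) φ ∈ Λ.toAddSubgroup := by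
  obtain ⟨w, hw⟩ := w
  have hinv : ∀ g ∈ Set.range D.reflection, g⁻¹ ∈ Set.range D.reflection := by
    rintro _ ⟨i, rfl⟩
    exact ⟨i, rfl⟩
  change w φ ∈ _
  induction hw using Subgroup.closure_induction'' generalizing φ with
  | mem g hg => obtain ⟨i, rfl⟩ := hg; exact Λ.reflection_mem i hφ
  | inv_mem g hg => obtain ⟨i, hi⟩ := hinv g hg; rw [← hi]; exact Λ.reflection_mem i hφ
  | one => exact hφ
  | mul g h _ _ ihg ihh => exact ihg (ihh hφ)

/-- The action of the Weyl group on `Λ`. -/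
def latticeAction : D.weylGroup →* AddMonoid.End Λ.Carrier where
  toFun w :=
    { toFun := fun φ => ⟨(w : Dual k 𝔥 ≃ₗ[k] Dual k 𝔥) φ, Λ.weyl_mem w φ.2⟩
      map_zero' := Subtype.ext (map_zero _)
      map_add' := fun _ _ => Subtype.ext (map_add _ _ _) }
  map_one' := rfl
  map_mul' _ _ := rfl

/-- The real root `w(α_i)` as an element of `Λ`. -/
def realRoot (w : D.weylGroup) (i : ι) : Λ.Carrier :=
  Λ.latticeAction w ⟨D.simpleRoot i, Λ.simpleRoot_mem i⟩

/-- The set `Φ^re` of real roots, the orbits of the simple roots under the Weyl group. -/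
def realRoots : Set Λ.Carrier := {α | ∃ w i, α = Λ.realRoot w i}

/-- The simple root `α_i` as an element of `Λ`. -/
abbrev simpleRoot (i : ι) : Λ.Carrier := Λ.realRoot 1 i

/-! ### Formal affine Demazure algebras -/

variable {R : Type*} [CommRing R] (F : MvPowerSeries (Fin 2) R)

/-- `R⟦Λ⟧_F`. -/
abbrev FGA : Type _ := FormalGroupAlgebra F Λ.Carrier

/-- The action of the Weyl group on `R⟦Λ⟧_F`, given by `w(x_λ) = x_{w(λ)}`. -/
def fgaAction : D.weylGroup →* (Λ.FGA F →ₐ[R] Λ.FGA F) :=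
  (endHom F Λ.Carrier).comp Λ.latticeAction

/-- The Demazure operator `Δ_{α_i}` on `R⟦Λ⟧_F`: the element `Δ_{α_i}(γ)` is the quotient
`(γ - s_i(γ)) / x_{α_i}`, that is, the solution `η` of `x_{α_i} η = γ - s_i(γ)`. (For a formal
group law `F` it exists and is unique.) -/
def demazureOperator (i : ι) (γ : Λ.FGA F) : Λ.FGA F :=
  Classical.epsilon fun η => x F (Λ.simpleRoot i) * η = γ - Λ.fgaAction F (D.s i) γ

/-- The multiplicative subset of `R⟦Λ⟧_F` generated by the `x_α`, for `α` a real root. -/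
def denominators : Submonoid (Λ.FGA F) := Submonoid.closure (x F '' Λ.realRoots)

/-- `Q^F`, the localization of `R⟦Λ⟧_F` at the `x_α`, for `α` a real root. -/
def Q : Type _ := Localization (Λ.denominators F)

instance : CommRing (Λ.Q F) := inferInstanceAs (CommRing (Localization (Λ.denominators F)))

instance : Algebra (Λ.FGA F) (Λ.Q F) :=
  inferInstanceAs (Algebra (Λ.FGA F) (Localization (Λ.denominators F)))

instance : IsLocalization (Λ.denominators F) (Λ.Q F) :=
  inferInstanceAs (IsLocalization (Λ.denominators F) (Localization (Λ.denominators F)))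

instance : Algebra R (Λ.Q F) :=
  ((algebraMap (Λ.FGA F) (Λ.Q F)).comp (algebraMap R (Λ.FGA F))).toAlgebra

instance : IsScalarTower R (Λ.FGA F) (Λ.Q F) := IsScalarTower.of_algebraMap_eq fun _ => rfl

lemma denominators_le_comap (w : D.weylGroup) :
    Λ.denominators F ≤ (Λ.denominators F).comap (Λ.fgaAction F w : Λ.FGA F →+* Λ.FGA F) := by
  refine Submonoid.closure_le.mpr ?_
  rintro _ ⟨_, ⟨v, i, rfl⟩, rfl⟩
  refine Submonoid.subset_closure ⟨Λ.realRoot (w * v) i, ⟨w * v, i, rfl⟩, ?_⟩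
  have h : Λ.realRoot (w * v) i = Λ.latticeAction w (Λ.realRoot v i) := by
    simp [realRoot]
  rw [h]
  exact (algebraMapOfHom_x F (Λ.latticeAction w) (Λ.realRoot v i)).symm

/-- The action of the Weyl group on `Q^F` which extends the action on `R⟦Λ⟧_F`. -/
def qAction : D.weylGroup →* (Λ.Q F →+* Λ.Q F) where
  toFun w := IsLocalization.map (Λ.Q F) (Λ.fgaAction F w : Λ.FGA F →+* Λ.FGA F)
    (Λ.denominators_le_comap F w)
  map_one' := by
    refine IsLocalization.ringHom_ext (Λ.denominators F) ?_
    ext γ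
    simp
  map_mul' v w := by
    refine IsLocalization.ringHom_ext (Λ.denominators F) ?_
    ext γ
    simp

instance : MulSemiringAction D.weylGroup (Λ.Q F) :=
  MulSemiringAction.compHom (Λ.Q F) (Λ.qAction F)

lemma weyl_smul_algebraMap (w : D.weylGroup) (γ : Λ.FGA F) :
    w • algebraMap (Λ.FGA F) (Λ.Q F) γ = algebraMap (Λ.FGA F) (Λ.Q F) (Λ.fgaAction F w γ) :=
  IsLocalization.map_eq (Λ.denominators_le_comap F w) γ

lemma weyl_smul_scalar (w : D.weylGroup) (r : R) :
    w • algebraMap R (Λ.Q F) r = algebraMap R (Λ.Q F) r := by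
  rw [IsScalarTower.algebraMap_apply R (Λ.FGA F) (Λ.Q F), weyl_smul_algebraMap,
    AlgHom.commutes]

/-- The twisted formal group algebra `Q_W^F`, the smash product of `R[W]` and `Q^F`. The element
`single w q` is `q δ_w = δ_w w⁻¹(q)`, and the product is `(q δ_w) (q' δ_w') = q w(q') δ_{w w'}`;
equivalently `(δ_w' ψ') (δ_w ψ) = δ_{w' w} w⁻¹(ψ') ψ`. -/
abbrev TwistedAlgebra : Type _ := SkewMonoidAlgebra (Λ.Q F) D.weylGroup

/-- The embedding of `Q^F` in `Q_W^F` as `Q^F δ_1`. -/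
def qToTwisted : Λ.Q F →+* Λ.TwistedAlgebra F where
  toFun q := SkewMonoidAlgebra.single 1 q
  map_one' := rfl
  map_mul' p q := by simp [SkewMonoidAlgebra.single_mul_single]
  map_zero' := by simp
  map_add' p q := SkewMonoidAlgebra.single_add _ _ _

instance : Algebra R (Λ.TwistedAlgebra F) where
  algebraMap := (Λ.qToTwisted F).comp (algebraMap R (Λ.Q F))
  commutes' r f := by
    induction f using SkewMonoidAlgebra.induction_on with
    | zero => simp
    | single w q =>
      change SkewMonoidAlgebra.single 1 (algebraMap R (Λ.Q F) r) * _ =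
        _ * SkewMonoidAlgebra.single 1 (algebraMap R (Λ.Q F) r)
      simp [SkewMonoidAlgebra.single_mul_single, weyl_smul_scalar, mul_comm]
    | add f g hf hg => rw [mul_add, add_mul, hf, hg]
  smul_def' r f := by
    induction f using SkewMonoidAlgebra.induction_on with
    | zero => simp
    | single w q =>
      change _ = SkewMonoidAlgebra.single 1 (algebraMap R (Λ.Q F) r) * _
      simp [SkewMonoidAlgebra.single_mul_single, SkewMonoidAlgebra.smul_single, Algebra.smul_def]
    | add f g hf hg => rw [smul_add, mul_add, hf, hg]

/-- The map `R⟦Λ⟧_F → Q_W^F`. -/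
def fgaToTwisted (γ : Λ.FGA F) : Λ.TwistedAlgebra F :=
  Λ.qToTwisted F (algebraMap (Λ.FGA F) (Λ.Q F) γ)

/-- The element `1 / x_α` of `Q^F`, where `α = w(α_i)`. -/
def invX (w : D.weylGroup) (i : ι) : Λ.Q F :=
  IsLocalization.mk' (Λ.Q F) (1 : Λ.FGA F)
    (⟨x F (Λ.realRoot w i), Submonoid.subset_closure ⟨_, ⟨w, i, rfl⟩, rfl⟩⟩ : Λ.denominators F)

/-- The formal Demazure element `X_α = (1 / x_α) (1 - δ_{s_α})` of the real root `α = w(α_i)`,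
with reflection `s_α = w s_i w⁻¹`. -/
def demazureElement (w : D.weylGroup) (i : ι) : Λ.TwistedAlgebra F :=
  Λ.qToTwisted F (Λ.invX F w i) *
    (1 - SkewMonoidAlgebra.single (w * D.s i * w⁻¹) (1 : Λ.Q F))

/-- The formal Demazure algebra `D_F`: the `R`-subalgebra of `Q_W^F` generated by the formal
Demazure elements of all real roots. -/
def formalDemazureAlgebra : Subalgebra R (Λ.TwistedAlgebra F) :=
  Algebra.adjoin R {X | ∃ w i, X = Λ.demazureElement F w i}

/-- The formal affine Demazure algebra: the `R`-subalgebra of `Q_W^F` generated by `R⟦Λ⟧_F` and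
by `D_F`. -/
def formalAffineDemazureAlgebra : Subalgebra R (Λ.TwistedAlgebra F) :=
  Algebra.adjoin R (Set.range (Λ.fgaToTwisted F) ∪ Λ.formalDemazureAlgebra F)

/-- An element `γ` of `R⟦Λ⟧_F` as an element of the formal affine Demazure algebra. -/
def ofFGA (γ : Λ.FGA F) : Λ.formalAffineDemazureAlgebra F :=
  ⟨Λ.fgaToTwisted F γ, Algebra.subset_adjoin (Or.inl ⟨γ, rfl⟩)⟩

/-! ### The Hecke-type algebra -/

/-- The alternating product `a b a ⋯` with `n` factors. -/
def altProd {S : Type*} [Monoid S] (a b : S) : ℕ → S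
  | 0 => 1
  | n + 1 => a * altProd b a n

/-- The generator `γ ∈ R⟦Λ⟧_F` of the free algebra. -/
def freeγ (γ : Λ.FGA F) : FreeAlgebra R (Λ.FGA F ⊕ ι) := FreeAlgebra.ι R (Sum.inl γ)

/-- The generator `T_i` of the free algebra. -/
def freeT (i : ι) : FreeAlgebra R (Λ.FGA F ⊕ ι) := FreeAlgebra.ι R (Sum.inr i)

/-- The defining relations of the algebra `𝐇`. The first three make `γ ↦ γ` a homomorphism of
`R`-algebras on `R⟦Λ⟧_F`. In the braid relations `m = orderOf (s_i s_j)` is `0` if `s_i s_j` has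
infinite order, and then there is no relation. -/
inductive HeckeRel (t : Rˣ) :
    FreeAlgebra R (Λ.FGA F ⊕ ι) → FreeAlgebra R (Λ.FGA F ⊕ ι) → Prop
  | algebraMap (r : R) : HeckeRel t (Λ.freeγ F (algebraMap R (Λ.FGA F) r)) (algebraMap R _ r)
  | add (γ γ' : Λ.FGA F) : HeckeRel t (Λ.freeγ F (γ + γ')) (Λ.freeγ F γ + Λ.freeγ F γ')
  | mul (γ γ' : Λ.FGA F) : HeckeRel t (Λ.freeγ F (γ * γ')) (Λ.freeγ F γ * Λ.freeγ F γ')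
  | quadratic (i : ι) : HeckeRel t
      ((Λ.freeT F i + algebraMap R _ (t : R)) * (Λ.freeT F i - algebraMap R _ ((t⁻¹ : Rˣ) : R))) 0
  | braid (i j : ι) (hij : i ≠ j) (hm : orderOf (D.s i * D.s j) ≠ 0) : HeckeRel t
      (altProd (Λ.freeT F i) (Λ.freeT F j) (orderOf (D.s i * D.s j)))
      (altProd (Λ.freeT F j) (Λ.freeT F i) (orderOf (D.s i * D.s j)))
  | commutation (i : ι) (γ : Λ.FGA F) : HeckeRel t
      (Λ.freeγ F γ * Λ.freeT F i - Λ.freeT F i * Λ.freeγ F (Λ.fgaAction F (D.s i) γ))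
      (Λ.freeγ F ((1 - algebraMap R _ (t : R) * x F (Λ.simpleRoot i)) *
        Λ.demazureOperator F i γ))

/-- The `R`-algebra `𝐇` generated by the elements of `R⟦Λ⟧_F` and by the `T_i`, subject to the
relations `HeckeRel`. -/
abbrev HeckeAlgebra (t : Rˣ) : Type _ := RingQuot (Λ.HeckeRel F t)

/-- An element `γ` of `R⟦Λ⟧_F` as an element of `𝐇`. -/
def heckeOfFGA (t : Rˣ) (γ : Λ.FGA F) : Λ.HeckeAlgebra F t :=
  RingQuot.mkAlgHom R (Λ.HeckeRel F t) (Λ.freeγ F γ)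

end FormalDemazureLattice

end KacMoody

end

/-! The isomorphism is the inverse of one map: `heckeToTwisted` sends `γ` to `γ` and `T_i` to `X_i -
t` in the twisted algebra, where `X_i` is the Demazure element of `α_i`. It respects the defining
relations, its image is the formal affine Demazure algebra, and its kernel is zero.

Relations. Put `μ = t + t⁻¹`. From `1/x_{-α} = μ - 1/x_α` follows `X_i² = μ X_i`, which is the
quadratic relation. The commutation relation is a direct computation, once `x_{α_i}` is known to
divide `γ - s_i(γ)` (`x_basis_dvd_sub`). The braid relation is the heart of the matter. The
recursively defined element `chain` differs from the alternating product of the `T`'s by a term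
symmetric in the two letters (`chain_add_eq`), so it suffices that `chain` be symmetric. Finite
order leaves only the types A1×A1, A2, B2 and G2. There the addition law for the `1/x_α` makes all
coefficients of `chain` equal to the product of `1/x_α` over the positive roots, and what remains is
that product times `∑ (-1)^ℓ(w) δ_w` over the dihedral group (`chain_demazureElement_comm`).

Image. Since `δ_{s_i} = 1 - x_{α_i} X_i`, every `δ_w` lies in the image. The Demazure element of
`w(α_i)` is the conjugate of `X_i` by `δ_w`, hence it does too (`range_heckeToTwisted`).

Kernel. The products `T_w` along reduced words span the Hecke-type algebra over the formal group
algebra (`mem_spanHeckeTw`). The image of `T_w` has an invertible coefficient at `δ_w`, and every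
other element of its support is strictly shorter (`coeff_heckeToTwisted_heckeTw`). As the formal
group algebra embeds in its localization, a maximal-length term of a vanishing sum has coefficient
zero.

Two foundations support this. Positivity of roots shows that the Weyl group is a Coxeter group
(`coxeterSystem`), and also gives Matsumoto's theorem (`prod_map_eq_of_isReduced`), which makes
`T_w` well defined. A basis of the lattice identifies each truncation of the formal group algebra
with a truncated polynomial ring (`coordEval_ofCoord`, `exists_sub_ofCoord_mem_level`). Regularity
of the `x_α` and divisibility by `x_{α_i}` are transferred from there. -/

namespace CoxeterSystem

/-! ### Coxeter groups: rank two factorizations, positive roots and Matsumoto's theorem -/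

variable {B W : Type*} [Group W] {M : CoxeterMatrix B} (cs : CoxeterSystem M W)

theorem wordProd_alternatingWord_succ (i j : B) (k : ℕ) :
    cs.wordProd (alternatingWord i j (k + 1)) =
      cs.wordProd (alternatingWord j i k) * cs.simple j := by
  rw [alternatingWord_succ, wordProd_concat]

theorem length_mul_alternatingWord_le (v : W) (i j : B) (k : ℕ) :
    cs.length (v * cs.wordProd (alternatingWord i j k)) ≤ cs.length v + k := by
  refine (cs.length_mul_le _ _).trans (Nat.add_le_add_left ?_ _)
  simpa using cs.length_wordProd_le (alternatingWord i j k)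

/-- `alternatingWord i j k` ends in `j`, so the letter `i` can be appended. A word already ending in
`i` would lose that letter instead, and `w` would be too short to be longer than `w * s_i`. -/
theorem mul_alternatingWord_of_isRightDescent {w v : W} {i j : B} {k : ℕ}
    (hw : cs.IsRightDescent w i)
    (h : w * cs.simple i = v * cs.wordProd (alternatingWord i j k) ∨
      w * cs.simple i = v * cs.wordProd (alternatingWord j i k))
    (hl : cs.length (w * cs.simple i) = cs.length v + k) :
    w = v * cs.wordProd (alternatingWord j i (k + 1)) ∧ cs.length w = cs.length v + (k + 1) := by
  have hl' := (cs.isRightDescent_iff).1 hw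
  refine ⟨?_, by omega⟩
  rcases h with h | h
  · rw [wordProd_alternatingWord_succ, ← mul_assoc, ← h, simple_mul_simple_cancel_right]
  · cases k with
    | zero =>
      rw [wordProd_alternatingWord_succ, ← mul_assoc]
      simp only [alternatingWord, wordProd_nil, mul_one] at h ⊢
      rw [← h, simple_mul_simple_cancel_right]
    | succ k =>
      rw [wordProd_alternatingWord_succ, ← mul_assoc] at h
      have h' := mul_right_cancel h
      have := cs.length_mul_alternatingWord_le v i j k
      rw [← h'] at this
      omega

/-- Every element factors, with lengths adding up, as an element without right descents among
`i` and `j` times an alternating word in `i` and `j`. -/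
theorem exists_eq_mul_alternatingWord (i j : B) (w : W) :
    ∃ v k, (w = v * cs.wordProd (alternatingWord i j k) ∨
        w = v * cs.wordProd (alternatingWord j i k)) ∧
      cs.length w = cs.length v + k ∧ ¬ cs.IsRightDescent v i ∧ ¬ cs.IsRightDescent v j := by
  induction hn : cs.length w using Nat.strong_induction_on generalizing w with
  | _ n ih =>
    by_cases hi : cs.IsRightDescent w i
    · obtain ⟨v, k, h, hl, h1, h2⟩ := ih _ (hn ▸ hi) (w * cs.simple i) rfl
      obtain ⟨e, el⟩ := cs.mul_alternatingWord_of_isRightDescent hi h hl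
      exact ⟨v, k + 1, Or.inr e, hn ▸ el, h1, h2⟩
    · by_cases hj : cs.IsRightDescent w j
      · obtain ⟨v, k, h, hl, h1, h2⟩ := ih _ (hn ▸ hj) (w * cs.simple j) rfl
        obtain ⟨e, el⟩ := cs.mul_alternatingWord_of_isRightDescent hj h.symm hl
        exact ⟨v, k + 1, Or.inl e, hn ▸ el, h1, h2⟩
      · exact ⟨w, 0, Or.inl (by simp [alternatingWord]), by simp [hn], hi, hj⟩

/-- Additivity of lengths forces the alternating word to be reduced, which fails beyond a finite `M
i j`. -/
theorem length_alternatingWord_le_of_eq_mul {w v : W} {i j : B} {k : ℕ}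
    (h : w = v * cs.wordProd (alternatingWord i j k))
    (hl : cs.length w = cs.length v + k) : M i j = 0 ∨ k ≤ M i j := by
  by_contra! hk
  have h1 := cs.not_isReduced_alternatingWord i j hk.1 hk.2
  have h2 := cs.length_wordProd_le (alternatingWord i j k)
  have h3 := cs.length_mul_le v (cs.wordProd (alternatingWord i j k))
  rw [IsReduced, length_alternatingWord] at h1
  rw [length_alternatingWord] at h2
  rw [← h] at h3
  omega

/-- A nonempty alternating part ending in `i` would make `i` a right descent. This decides which of
the two words occurs, and it excludes `k = M i j` in the finite case, where both words represent the
same element. -/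
theorem eq_mul_alternatingWord_of_not_isRightDescent {w v : W} {i j : B} {k : ℕ}
    (hw : ¬ cs.IsRightDescent w i)
    (h : w = v * cs.wordProd (alternatingWord i j k) ∨
      w = v * cs.wordProd (alternatingWord j i k))
    (hl : cs.length w = cs.length v + k) :
    w = v * cs.wordProd (alternatingWord i j k) ∧ (M i j = 0 ∨ k < M i j) := by
  have key : ∀ k, cs.length w = cs.length v + k → 0 < k →
      w ≠ v * cs.wordProd (alternatingWord j i k) := by
    rintro (_ | k) hl hk e
    · exact absurd hk (lt_irrefl _)
    · rw [wordProd_alternatingWord_succ, ← mul_assoc] at e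
      have h1 := cs.length_mul_alternatingWord_le v i j k
      have h2 := (cs.not_isRightDescent_iff).1 hw
      rw [e, simple_mul_simple_cancel_right, ← e] at h2
      omega
  have h' : w = v * cs.wordProd (alternatingWord i j k) := by
    rcases h with h | h
    · exact h
    · cases k with
      | zero => simpa [alternatingWord] using h
      | succ k => exact absurd h (key _ hl (Nat.succ_pos k))
  refine ⟨h', ?_⟩
  rcases cs.length_alternatingWord_le_of_eq_mul h' hl with h0 | h0
  · exact Or.inl h0
  · rcases Nat.eq_zero_or_pos (M i j) with hm | hm
    · exact Or.inl hm
    · refine Or.inr (lt_of_le_of_ne h0 ?_)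
      rintro rfl
      refine key _ hl hm (h'.trans ?_)
      have := cs.wordProd_braidWord_eq i j
      rw [braidWord, braidWord, M.symmetric j i] at this
      rw [this]

/-- An action of a Coxeter group on an additive group with vectors `root i` that span a salient
cone, for which positivity holds in every rank two parabolic subgroup. -/
structure PositiveRootData (V : Type*) [AddCommGroup V] where
  action : W →* AddMonoid.End V
  root : B → V
  root_ne_zero : ∀ i, root i ≠ 0
  salient : ∀ v ∈ AddSubmonoid.closure (Set.range root),
    -v ∈ AddSubmonoid.closure (Set.range root) → v = 0
  simple_root : ∀ i, action (cs.simple i) (root i) = -root i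
  alternating_root : ∀ i j k, i ≠ j → (M i j = 0 ∨ k < M i j) →
    action (cs.wordProd (alternatingWord i j k)) (root i) ∈
      AddSubmonoid.closure {root i, root j}

namespace PositiveRootData

variable {cs} {V : Type*} [AddCommGroup V] (P : cs.PositiveRootData V)

theorem action_mem_of_mem_closure_pair {v : W} {i j : B} {a : V}
    (hi : P.action v (P.root i) ∈ AddSubmonoid.closure (Set.range P.root))
    (hj : P.action v (P.root j) ∈ AddSubmonoid.closure (Set.range P.root))
    (ha : a ∈ AddSubmonoid.closure {P.root i, P.root j}) :
    P.action v a ∈ AddSubmonoid.closure (Set.range P.root) := by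
  induction ha using AddSubmonoid.closure_induction with
  | mem x hx =>
    rcases hx with rfl | rfl
    · exact hi
    · exact hj
  | zero => rw [map_zero]; exact zero_mem _
  | add x y _ _ hx hy => rw [map_add]; exact add_mem hx hy

/-- If `w ≠ 1`, choose a right descent `j` and split off the alternating part in `i` and `j`. That
part sends `root i` into the cone of `root i` and `root j` by the rank two hypothesis. The remaining
factor is shorter and has neither descent, so it maps both roots into the cone by induction. -/
theorem action_root_mem {w : W} {i : B} (h : ¬ cs.IsRightDescent w i) :
    P.action w (P.root i) ∈ AddSubmonoid.closure (Set.range P.root) := by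
  induction hn : cs.length w using Nat.strong_induction_on generalizing w i with
  | _ n ih =>
    by_cases hw : w = 1
    · subst hw
      rw [map_one]
      exact AddSubmonoid.subset_closure ⟨i, rfl⟩
    · obtain ⟨j, hj⟩ := cs.exists_rightDescent_of_ne_one hw
      have hij : i ≠ j := by
        rintro rfl
        exact h hj
      obtain ⟨v, k, hv, hl, h1, h2⟩ := cs.exists_eq_mul_alternatingWord i j w
      obtain ⟨e, hk⟩ := cs.eq_mul_alternatingWord_of_not_isRightDescent h hv hl
      have hk0 : k ≠ 0 := by
        rintro rfl
        simp only [alternatingWord, wordProd_nil, mul_one] at e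
        exact h2 (e ▸ hj)
      rw [e, map_mul]
      exact P.action_mem_of_mem_closure_pair (ih _ (by omega) h1 rfl) (ih _ (by omega) h2 rfl)
        (P.alternating_root i j k hij hk)

theorem action_injective (w : W) : Function.Injective (P.action w) := by
  intro a b h
  have key : ∀ a, P.action w⁻¹ (P.action w a) = a := fun a => by
    rw [← Function.comp_apply (f := P.action w⁻¹), ← AddMonoid.End.coe_mul, ← map_mul,
      inv_mul_cancel, map_one, AddMonoid.End.coe_one, id]
  rw [← key a, h, key]

theorem neg_action_root_mem {w : W} {i : B} (h : cs.IsRightDescent w i) :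
    -P.action w (P.root i) ∈ AddSubmonoid.closure (Set.range P.root) := by
  have := P.action_root_mem ((cs.isRightDescent_iff_not_isRightDescent_mul).1 h)
  rwa [map_mul, AddMonoid.End.coe_mul, Function.comp_apply, P.simple_root, map_neg] at this

/-- The opposite vector lies in the cone, so salience and injectivity of the action would make the
root zero. -/
theorem action_root_notMem {w : W} {i : B} (h : cs.IsRightDescent w i) :
    P.action w (P.root i) ∉ AddSubmonoid.closure (Set.range P.root) := by
  intro h'
  have := P.salient _ h' (P.neg_action_root_mem h)
  exact P.root_ne_zero i (P.action_injective w (this.trans (map_zero _).symm))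

-- A shorter alternating part would send `root i` into the positive cone, contradicting the descent
-- at `i`; a longer one is not reduced.
include P in
theorem eq_length_of_isRightDescent {w v : W} {i j : B} {k : ℕ} (hij : i ≠ j)
    (hi : cs.IsRightDescent w i) (e : w = v * cs.wordProd (alternatingWord i j k))
    (hl : cs.length w = cs.length v + k)
    (h1 : ¬ cs.IsRightDescent v i) (h2 : ¬ cs.IsRightDescent v j) :
    M i j ≠ 0 ∧ k = M i j := by
  have hk : ¬ (M i j = 0 ∨ k < M i j) := by
    intro hk
    refine P.action_root_notMem hi ?_
    rw [e, map_mul]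
    exact P.action_mem_of_mem_closure_pair (P.action_root_mem h1) (P.action_root_mem h2)
      (P.alternating_root i j k hij hk)
  have := cs.length_alternatingWord_le_of_eq_mul e hl
  omega

-- Two descents force the alternating part to be the longest element of the dihedral subgroup, which
-- is therefore finite. Reduced words of `w` with different last letters can be compared through
-- this factorization.
include P in
theorem exists_eq_mul_braidWord {w : W} {i j : B} (hij : i ≠ j)
    (hi : cs.IsRightDescent w i) (hj : cs.IsRightDescent w j) :
    M i j ≠ 0 ∧ ∃ v, w = v * cs.wordProd (alternatingWord i j (M i j)) ∧
      cs.length w = cs.length v + M i j := by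
  obtain ⟨v, k, hv, hl, h1, h2⟩ := cs.exists_eq_mul_alternatingWord i j w
  rcases hv with e | e
  · obtain ⟨hm, rfl⟩ := P.eq_length_of_isRightDescent hij hi e hl h1 h2
    exact ⟨hm, v, e, hl⟩
  · obtain ⟨hm, rfl⟩ := P.eq_length_of_isRightDescent hij.symm hj e hl h2 h1
    have := cs.wordProd_braidWord_eq j i
    rw [braidWord, braidWord] at this
    rw [this] at e
    rw [M.symmetric j i] at hl hm
    exact ⟨hm, v, e, hl⟩

include P in
/-- **Matsumoto's theorem**: a function on the generators which satisfies the braid relations has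
the same product along all reduced words of an element. -/
theorem prod_map_eq_of_isReduced {N : Type*} [Monoid N] (f : B → N)
    (hf : ∀ i j, i ≠ j → M i j ≠ 0 → ((alternatingWord i j (M i j)).map f).prod =
      ((alternatingWord j i (M i j)).map f).prod)
    {ω ω' : List B} (hω : cs.IsReduced ω) (hω' : cs.IsReduced ω')
    (h : cs.wordProd ω = cs.wordProd ω') : (ω.map f).prod = (ω'.map f).prod := by
  induction hn : ω.length generalizing ω ω' with
  | zero =>
    have hl : ω'.length = 0 := by rw [← hω'.eq, ← h, hω.eq, hn]
    rw [List.eq_nil_of_length_eq_zero hn, List.eq_nil_of_length_eq_zero hl]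
  | succ n ih =>
    have hl : ω'.length = n + 1 := by rw [← hω'.eq, ← h, hω.eq, hn]
    have split : ∀ ω : List B, cs.IsReduced ω → ω.length = n + 1 → ∃ u i, ω = u ++ [i] ∧
        cs.IsReduced u ∧ u.length = n ∧ cs.wordProd u = cs.wordProd ω * cs.simple i ∧
          cs.IsRightDescent (cs.wordProd ω) i := by
      intro ω hω hn
      rcases List.eq_nil_or_concat ω with rfl | ⟨u, i, rfl⟩
      · simp at hn
      · have hu : u.length = n := by simpa using hn
        have hp : cs.wordProd u = cs.wordProd (u ++ [i]) * cs.simple i := by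
          simp [wordProd_append]
        have hr : cs.IsReduced u := by simpa [hu] using hω.take n
        rw [List.concat_eq_append] at *
        refine ⟨u, i, rfl, hr, hu, hp, ?_⟩
        rw [IsRightDescent, ← hp, hr.eq, hω.eq]
        simp
    obtain ⟨u, i, rfl, hu, hun, hup, hui⟩ := split ω hω hn
    obtain ⟨u', j, rfl, hu', hun', hup', huj⟩ := split ω' hω' hl
    rw [← h] at hup' huj
    generalize cs.wordProd (u ++ [i]) = w at *
    by_cases hij : i = j
    · subst hij
      simp only [List.map_append, List.prod_append]
      rw [ih hu hu' (hup.trans hup'.symm) hun]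
    · obtain ⟨hm, v, hv, hvl⟩ := P.exists_eq_mul_braidWord hij hui huj
      obtain ⟨ν, hν, rfl⟩ := cs.exists_isReduced v
      obtain ⟨m, hm'⟩ := Nat.exists_eq_succ_of_ne_zero hm
      have hv' : w = cs.wordProd ν * cs.wordProd (alternatingWord j i (M i j)) := by
        have := cs.wordProd_braidWord_eq i j
        rw [braidWord, braidWord, M.symmetric j i] at this
        rw [hv, this]
      -- `u` and `ν ++ alternatingWord i j m` are reduced words of the same element `w * s_i` of
      -- length `n`, so the induction hypothesis applies to them. Used for `(i, j)` and `(j, i)`,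
      -- this reduces the claim to the braid relation for `f`.
      have step : ∀ (i j : B) (u : List B), cs.IsReduced u → u.length = n →
          cs.wordProd u = w * cs.simple i →
          w = cs.wordProd ν * cs.wordProd (alternatingWord j i (m + 1)) →
          cs.length w = cs.length (cs.wordProd ν) + (m + 1) →
          ((u ++ [i]).map f).prod =
            (ν.map f).prod * ((alternatingWord j i (m + 1)).map f).prod := by
        intro i j u hu hun hup hw hwl
        rw [wordProd_alternatingWord_succ, ← mul_assoc] at hw
        have hw' : cs.wordProd u = cs.wordProd (ν ++ alternatingWord i j m) := by
          rw [hup, hw, simple_mul_simple_cancel_right, wordProd_append]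
        have hlen : (ν ++ alternatingWord i j m).length = n := by
          have h1 : cs.length w ≤ n + 1 := by
            have : w = cs.wordProd (u ++ [i]) := by
              rw [wordProd_append, hup, wordProd_singleton, simple_mul_simple_cancel_right]
            rw [this]
            exact (cs.length_wordProd_le _).trans (by simp [hun])
          have h2 : n ≤ (ν ++ alternatingWord i j m).length := by
            rw [← hun, ← hu.eq, hw']
            exact cs.length_wordProd_le _
          rw [List.length_append, length_alternatingWord] at *
          rw [hν.eq] at hwl
          omega
        have hred : cs.IsReduced (ν ++ alternatingWord i j m) := by
          rw [IsReduced, ← hw', hu.eq, hun, hlen]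
        rw [List.map_append, List.prod_append, ih hu hred hw' hun, alternatingWord_succ]
        simp [mul_assoc]
      rw [hm'] at hv hv' hvl
      rw [step i j u hu hun hup hv' hvl, step j i u' hu' hun' hup' hv hvl]
      have := hf i j hij hm
      rw [hm'] at this
      rw [this]

end PositiveRootData

/-- The product of the values of `f` along a reduced word of `w`. -/
noncomputable def reducedProd {N : Type*} [Monoid N] (f : B → N) (w : W) : N :=
  ((cs.exists_isReduced w).choose.map f).prod

section reducedProd

variable {cs} {V : Type*} [AddCommGroup V] (P : cs.PositiveRootData V) {N : Type*} [Monoid N]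
  {f : B → N} (hf : ∀ i j, i ≠ j → M i j ≠ 0 → ((alternatingWord i j (M i j)).map f).prod =
      ((alternatingWord j i (M i j)).map f).prod)

include P hf

theorem PositiveRootData.reducedProd_wordProd {ω : List B} (hω : cs.IsReduced ω) :
    cs.reducedProd f (cs.wordProd ω) = (ω.map f).prod := by
  have h := (cs.exists_isReduced (cs.wordProd ω)).choose_spec
  exact P.prod_map_eq_of_isReduced f hf h.1 hω h.2.symm

theorem PositiveRootData.reducedProd_one : cs.reducedProd f 1 = 1 := by
  have := P.reducedProd_wordProd hf (ω := []) (by simp [IsReduced])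
  simpa using this

theorem PositiveRootData.reducedProd_mul_simple {w : W} {i : B} (h : ¬ cs.IsRightDescent w i) :
    cs.reducedProd f (w * cs.simple i) = cs.reducedProd f w * f i := by
  obtain ⟨ω, hω, rfl⟩ := cs.exists_isReduced w
  have hl := (cs.not_isRightDescent_iff).1 h
  have e : cs.wordProd ω * cs.simple i = cs.wordProd (ω ++ [i]) := by
    rw [wordProd_append, wordProd_singleton]
  have hω' : cs.IsReduced (ω ++ [i]) := by
    rw [IsReduced, ← e, hl, hω.eq]
    simp
  rw [e, P.reducedProd_wordProd hf hω', P.reducedProd_wordProd hf hω]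
  simp

end reducedProd

end CoxeterSystem

/-! ### The Weyl group as a Coxeter group -/

noncomputable section

namespace KacMoody

open Module CoxeterSystem

/-- The coordinates, with respect to the simple roots `α, β` of a rank two root system with
`s_α β = β + a α` and `s_β α = α + b β`, of the images of `α` under the alternating products
of `s_α` and `s_β` which end in `s_β`. -/
def altRoot (a b : ℤ) : ℕ → ℤ × ℤ
  | 0 => (1, 0)
  | 1 => (1, b)
  | n + 2 => (b * (altRoot b a (n + 1)).2 - (altRoot a b n).1,
      b * (altRoot b a (n + 1)).1 - (altRoot a b n).2)

/-- The last two inequalities say that each term of the recursion is at least the term two steps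
before, which preserves nonnegativity. The factor `2` reproduces itself exactly because `a * b ≥ 4`.
-/
theorem altRoot_growth {a b : ℤ} (ha : 0 < a) (hb : 0 < b) (hab : 4 ≤ a * b) (n : ℕ) :
    0 ≤ (altRoot a b n).1 ∧ 0 ≤ (altRoot a b n).2 ∧
      2 * (altRoot a b n).1 ≤ b * (altRoot b a (n + 1)).2 ∧
      2 * (altRoot a b n).2 ≤ b * (altRoot b a (n + 1)).1 := by
  induction n using Nat.strong_induction_on generalizing a b with
  | _ n ih =>
    match n, ih with
    | 0, _ =>
      simp only [altRoot]
      refine ⟨by norm_num, le_refl _, by nlinarith, by nlinarith⟩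
    | 1, _ =>
      simp only [altRoot]
      refine ⟨by norm_num, hb.le, by nlinarith, by nlinarith⟩
    | n + 2, ih =>
      obtain ⟨h1, h2, h3, h4⟩ := ih n (by omega) ha hb hab
      obtain ⟨-, -, h7, h8⟩ := ih (n + 1) (by omega) hb ha (by linarith)
      have e1 : (altRoot a b (n + 2)).1 =
          b * (altRoot b a (n + 1)).2 - (altRoot a b n).1 := by rw [altRoot]
      have e2 : (altRoot a b (n + 2)).2 =
          b * (altRoot b a (n + 1)).1 - (altRoot a b n).2 := by rw [altRoot]
      have e3 : (altRoot b a (n + 2 + 1)).1 =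
          a * (altRoot a b (n + 2)).2 - (altRoot b a (n + 1)).1 := by rw [altRoot]
      have e4 : (altRoot b a (n + 2 + 1)).2 =
          a * (altRoot a b (n + 2)).1 - (altRoot b a (n + 1)).2 := by rw [altRoot]
      have p1 : 0 ≤ (altRoot a b (n + 2)).1 := by linarith
      have p2 : 0 ≤ (altRoot a b (n + 2)).2 := by linarith
      refine ⟨p1, p2, ?_, ?_⟩
      · rw [e4]
        nlinarith [mul_le_mul_of_nonneg_right hab p1, mul_le_mul_of_nonneg_left h8 hb.le]
      · rw [e3]
        nlinarith [mul_le_mul_of_nonneg_right hab p2, mul_le_mul_of_nonneg_left h7 hb.le]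

/-- Even indices correspond to powers of `s_α s_β`. A positive second coordinate shows that no such
power fixes `α`, so the product has infinite order. -/
theorem altRoot_two_mul_succ_snd {a b : ℤ} (ha : 0 < a) (hb : 0 < b) (hab : 4 ≤ a * b) (n : ℕ) :
    0 < (altRoot a b (2 * (n + 1))).2 := by
  induction n with
  | zero => simpa [altRoot] using hb
  | succ n ih =>
    have e : (altRoot a b (2 * (n + 1 + 1))).2 = b * (altRoot b a (2 * (n + 1) + 1)).1 -
        (altRoot a b (2 * (n + 1))).2 := by
      rw [show 2 * (n + 1 + 1) = 2 * (n + 1) + 2 by ring, altRoot]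
    have := (altRoot_growth ha hb hab (2 * (n + 1))).2.2.2
    linarith

variable {k : Type*} [Field k] {ι : Type*} [Fintype ι] {A : Matrix ι ι ℤ}
  {𝔥 : Type*} [AddCommGroup 𝔥] [Module k 𝔥]

namespace Realization

variable (D : Realization k A 𝔥)

/-- The action of the Weyl group on the dual space by additive maps. -/
def weylAction : D.weylGroup →* AddMonoid.End (Dual k 𝔥) where
  toFun w := (w : Dual k 𝔥 ≃ₗ[k] Dual k 𝔥).toLinearMap.toAddMonoidHom
  map_one' := rfl
  map_mul' _ _ := rfl

theorem weylAction_mul_apply (v w : D.weylGroup) (φ : Dual k 𝔥) :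
    D.weylAction (v * w) φ = D.weylAction v (D.weylAction w φ) := rfl

theorem weylAction_apply (w : D.weylGroup) (φ : Dual k 𝔥) :
    D.weylAction w φ = (w : Dual k 𝔥 ≃ₗ[k] Dual k 𝔥) φ := rfl

theorem weylAction_injective : Function.Injective D.weylAction := by
  intro v w h
  refine Subtype.ext (LinearEquiv.ext fun φ => ?_)
  exact DFunLike.congr_fun h φ

theorem weylAction_s (i : ι) (φ : Dual k 𝔥) :
    D.weylAction (D.s i) φ = φ - φ (D.simpleCoroot i) • D.simpleRoot i :=
  D.reflection_apply i φ

theorem weylAction_s_simpleRoot (i j : ι) :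
    D.weylAction (D.s i) (D.simpleRoot j) = D.simpleRoot j + (-A i j) • D.simpleRoot i := by
  rw [weylAction_s, D.pairing, Int.cast_smul_eq_zsmul k (A i j) (D.simpleRoot i), neg_smul,
    sub_eq_add_neg]

theorem weylAction_s_self (i : ι) :
    D.weylAction (D.s i) (D.simpleRoot i) = -D.simpleRoot i := by
  rw [weylAction_s_simpleRoot, D.cartan.diag, neg_smul, two_smul]
  abel

theorem s_mul_s (i : ι) : D.s i * D.s i = 1 := by
  apply D.weylAction_injective
  ext1 φ
  rw [weylAction_mul_apply, D.weylAction_s i φ, map_sub, D.weylAction_s i φ]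
  have : D.weylAction (D.s i) (φ (D.simpleCoroot i) • D.simpleRoot i) =
      φ (D.simpleCoroot i) • D.weylAction (D.s i) (D.simpleRoot i) := by
    simp [weylAction_apply]
  rw [this, weylAction_s_self]
  simp

theorem s_inv (i : ι) : (D.s i)⁻¹ = D.s i := inv_eq_of_mul_eq_one_left (D.s_mul_s i)

/-- The last letter gives `s_j α_i = α_i + b α_j`. The letter before it changes the sign of `α_i`,
which produces the subtracted term of the recursion, while the image of `α_j` is an instance with
the roots exchanged. -/
theorem weylAction_alternatingWord (i j : ι) (n : ℕ) :
    D.weylAction ((alternatingWord i j n).map D.s).prod (D.simpleRoot i) =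
      (altRoot (-A i j) (-A j i) n).1 • D.simpleRoot i +
        (altRoot (-A i j) (-A j i) n).2 • D.simpleRoot j := by
  induction n using Nat.strong_induction_on generalizing i j with
  | _ n ih =>
    have step : ∀ (i j : ι) n φ, D.weylAction ((alternatingWord i j (n + 1)).map D.s).prod φ =
        D.weylAction ((alternatingWord j i n).map D.s).prod (D.weylAction (D.s j) φ) := by
      intro i j n φ
      rw [← weylAction_mul_apply, alternatingWord_succ]
      simp
    match n, ih with
    | 0, _ => simp [alternatingWord, altRoot]
    | 1, _ =>
      rw [step, weylAction_s_simpleRoot]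
      simp [alternatingWord, altRoot]
    | n + 2, ih =>
      rw [step, weylAction_s_simpleRoot, map_add, map_zsmul, ih (n + 1) (by omega), step,
        weylAction_s_self, map_neg, ih n (by omega), altRoot]
      simp only
      module

theorem linearIndependent_pair [CharZero k] {i j : ι} (hij : i ≠ j) {a b : ℤ}
    (h : a • D.simpleRoot i + b • D.simpleRoot j = 0) : a = 0 ∧ b = 0 := by
  have hl : LinearIndependent k ![D.simpleRoot i, D.simpleRoot j] := by
    convert D.linearIndependent_simpleRoot.comp ![i, j] ?_ using 1
    · ext1 x
      fin_cases x <;> rfl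
    · intro x y
      fin_cases x <;> fin_cases y <;> simp [hij, hij.symm]
  have h1 := (LinearIndependent.pair_iff.1 hl) (a : k) (b : k)
    (by rwa [Int.cast_smul_eq_zsmul, Int.cast_smul_eq_zsmul])
  exact ⟨by exact_mod_cast h1.1, by exact_mod_cast h1.2⟩

theorem prod_alternatingWord_two_mul (i j : ι) (n : ℕ) :
    ((alternatingWord i j (2 * n)).map D.s).prod = (D.s i * D.s j) ^ n := by
  induction n with
  | zero => simp [alternatingWord]
  | succ n ih =>
    rw [mul_add, mul_one, alternatingWord_succ, alternatingWord_succ, pow_succ, ← ih]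
    simp

theorem altRoot_two_mul_of_pow_eq_one [CharZero k] {i j : ι} (hij : i ≠ j) {n : ℕ}
    (h : (D.s i * D.s j) ^ n = 1) : altRoot (-A i j) (-A j i) (2 * n) = (1, 0) := by
  have h1 := D.weylAction_alternatingWord i j (2 * n)
  rw [prod_alternatingWord_two_mul, h, map_one, AddMonoid.End.coe_one, id] at h1
  have := D.linearIndependent_pair hij
    (a := (altRoot (-A i j) (-A j i) (2 * n)).1 - 1) (b := (altRoot (-A i j) (-A j i) (2 * n)).2)
    (by
      rw [sub_smul, one_smul, sub_add_eq_add_sub, ← h1, sub_self])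
  refine Prod.ext ?_ this.2
  have := this.1
  simp only
  omega

theorem weylAction_s_add (i j : ι) (φ : Dual k 𝔥) (p q : k) :
    D.weylAction (D.s i) (φ + p • D.simpleRoot i + q • D.simpleRoot j) =
      φ + (-p - φ (D.simpleCoroot i) - q * A i j) • D.simpleRoot i + q • D.simpleRoot j := by
  rw [weylAction_s]
  simp only [LinearMap.add_apply, LinearMap.smul_apply, D.pairing, D.cartan.diag, smul_eq_mul]
  push_cast
  module

theorem weylAction_s_add' (i j : ι) (φ : Dual k 𝔥) (p q : k) :
    D.weylAction (D.s j) (φ + p • D.simpleRoot i + q • D.simpleRoot j) =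
      φ + p • D.simpleRoot i + (-q - φ (D.simpleCoroot j) - p * A j i) • D.simpleRoot j := by
  rw [add_right_comm, weylAction_s_add, add_right_comm]

/-- The two reflections change `φ` only by multiples of `α_i` and `α_j`, so each finite type is an
identity between two coefficients that are linear in the values of `φ` on the two coroots. -/
theorem s_mul_s_pow_eq_one {i j : ι} {a b : ℤ} {n : ℕ} (ha : A i j = -a) (hb : A j i = -b)
    (h : (a = 0 ∧ b = 0 ∧ n = 2) ∨ (a = 1 ∧ b = 1 ∧ n = 3) ∨ (a = 1 ∧ b = 2 ∧ n = 4) ∨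
      (a = 2 ∧ b = 1 ∧ n = 4) ∨ (a = 1 ∧ b = 3 ∧ n = 6) ∨ (a = 3 ∧ b = 1 ∧ n = 6)) :
    (D.s i * D.s j) ^ n = 1 := by
  apply D.weylAction_injective
  ext1 φ
  -- The zero coefficients bring `φ` into the shape on which `weylAction_s_add` acts.
  have e : φ = φ + (0 : k) • D.simpleRoot i + (0 : k) • D.simpleRoot j := by simp
  rcases h with ⟨rfl, rfl, rfl⟩ | ⟨rfl, rfl, rfl⟩ | ⟨rfl, rfl, rfl⟩ | ⟨rfl, rfl, rfl⟩ |
    ⟨rfl, rfl, rfl⟩ | ⟨rfl, rfl, rfl⟩ <;>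
  · rw [map_one, AddMonoid.End.coe_one, id]
    conv_lhs => rw [e]
    simp only [pow_succ, pow_zero, one_mul, weylAction_mul_apply, weylAction_s_add,
      weylAction_s_add', ha, hb]
    conv_rhs => rw [e]
    push_cast
    module

/-- The possible entries of a generalized Cartan matrix, and the corresponding orders of the
products of two simple reflections. -/
theorem orderOf_s_mul_s [CharZero k] {i j : ι} (hij : i ≠ j) :
    ∃ a b : ℤ, A i j = -a ∧ A j i = -b ∧
      ((0 < a ∧ 0 < b ∧ 4 ≤ a * b ∧ orderOf (D.s i * D.s j) = 0) ∨
      ((a = 0 ∧ b = 0 ∧ orderOf (D.s i * D.s j) = 2) ∨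
      (a = 1 ∧ b = 1 ∧ orderOf (D.s i * D.s j) = 3) ∨
      (a = 1 ∧ b = 2 ∧ orderOf (D.s i * D.s j) = 4) ∨
      (a = 2 ∧ b = 1 ∧ orderOf (D.s i * D.s j) = 4) ∨
      (a = 1 ∧ b = 3 ∧ orderOf (D.s i * D.s j) = 6) ∨
      (a = 3 ∧ b = 1 ∧ orderOf (D.s i * D.s j) = 6))) := by
  obtain ⟨a, ha⟩ : ∃ a, A i j = -a := ⟨-A i j, by simp⟩
  obtain ⟨b, hb⟩ : ∃ b, A j i = -b := ⟨-A j i, by simp⟩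
  refine ⟨a, b, ha, hb, ?_⟩
  have ha0 : 0 ≤ a := by have := D.cartan.nonpos i j hij; omega
  have hb0 : 0 ≤ b := by have := D.cartan.nonpos j i hij.symm; omega
  have hab : a = 0 → b = 0 := by
    intro h; have := D.cartan.zero_symm i j (by omega); omega
  have hba : b = 0 → a = 0 := by
    intro h; have := D.cartan.zero_symm j i (by omega); omega
  have hr : ∀ n, (D.s i * D.s j) ^ n = 1 → altRoot a b (2 * n) = (1, 0) := by
    intro n hn
    have := D.altRoot_two_mul_of_pow_eq_one hij hn
    rwa [ha, hb, neg_neg, neg_neg] at this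
  by_cases h4 : 4 ≤ a * b
  · have ha1 : 0 < a := by
      rcases ha0.eq_or_lt with h | h
      · rw [← h] at h4; omega
      · exact h
    have hb1 : 0 < b := by
      rcases hb0.eq_or_lt with h | h
      · rw [← h] at h4; omega
      · exact h
    refine Or.inl ⟨ha1, hb1, h4, orderOf_eq_zero_iff'.2 fun n hn h => ?_⟩
    obtain ⟨n, rfl⟩ := Nat.exists_eq_succ_of_ne_zero hn.ne'
    have h1 := altRoot_two_mul_succ_snd ha1 hb1 h4 n
    rw [hr _ h] at h1
    exact lt_irrefl _ h1
  · right
    have key : (a = 0 ∧ b = 0) ∨ (a = 1 ∧ b = 1) ∨ (a = 1 ∧ b = 2) ∨ (a = 2 ∧ b = 1) ∨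
        (a = 1 ∧ b = 3) ∨ (a = 3 ∧ b = 1) := by
      by_cases h0 : a = 0
      · exact Or.inl ⟨h0, hab h0⟩
      · have hb1 : b ≠ 0 := fun h => h0 (hba h)
        have ha3 : a ≤ 3 := by nlinarith [show 1 ≤ a by omega, show 1 ≤ b by omega]
        have hb3 : b ≤ 3 := by nlinarith [show 1 ≤ a by omega, show 1 ≤ b by omega]
        interval_cases a <;> interval_cases b <;> simp_all
    -- A smaller exponent `m` is excluded because `altRoot` at `2 * m` is not `(1, 0)`, that is,
    -- `α_i` is moved.
    have order : ∀ n, 0 < n → (D.s i * D.s j) ^ n = 1 →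
        (∀ m < n, 0 < m → altRoot a b (2 * m) ≠ (1, 0)) → orderOf (D.s i * D.s j) = n := by
      intro n hn h1 h2
      rw [orderOf_eq_iff hn]
      exact ⟨h1, fun m hm hm0 h => h2 m hm hm0 (hr m h)⟩
    have hp := fun n => D.s_mul_s_pow_eq_one (n := n) ha hb
    rcases key with ⟨rfl, rfl⟩ | ⟨rfl, rfl⟩ | ⟨rfl, rfl⟩ | ⟨rfl, rfl⟩ | ⟨rfl, rfl⟩ | ⟨rfl, rfl⟩
    · rw [order 2 (by norm_num) (hp 2 (by norm_num)) (by decide)]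
      norm_num
    · rw [order 3 (by norm_num) (hp 3 (by norm_num)) (by decide)]
      norm_num
    · rw [order 4 (by norm_num) (hp 4 (by norm_num)) (by decide)]
      norm_num
    · rw [order 4 (by norm_num) (hp 4 (by norm_num)) (by decide)]
      norm_num
    · rw [order 6 (by norm_num) (hp 6 (by norm_num)) (by decide)]
      norm_num
    · rw [order 6 (by norm_num) (hp 6 (by norm_num)) (by decide)]
      norm_num

theorem altRoot_nonneg [CharZero k] {i j : ι} (hij : i ≠ j) {n : ℕ}
    (hn : orderOf (D.s i * D.s j) = 0 ∨ n < orderOf (D.s i * D.s j)) :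
    0 ≤ (altRoot (-A i j) (-A j i) n).1 ∧ 0 ≤ (altRoot (-A i j) (-A j i) n).2 := by
  obtain ⟨a, b, ha, hb, h⟩ := D.orderOf_s_mul_s hij
  rw [ha, hb, neg_neg, neg_neg]
  rcases h with ⟨h1, h2, h4, -⟩ | h
  · have := altRoot_growth h1 h2 h4 n
    exact ⟨this.1, this.2.1⟩
  · rcases h with ⟨rfl, rfl, h⟩ | ⟨rfl, rfl, h⟩ | ⟨rfl, rfl, h⟩ | ⟨rfl, rfl, h⟩ |
      ⟨rfl, rfl, h⟩ | ⟨rfl, rfl, h⟩ <;>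
    · rw [h] at hn
      have hn' := hn.resolve_left (by norm_num)
      clear hn h ha hb
      revert n
      decide

/-- The Coxeter matrix of the Weyl group. -/
def coxeterMatrix [CharZero k] : CoxeterMatrix ι where
  M := Matrix.of fun i j => orderOf (D.s i * D.s j)
  isSymm := by
    ext i j
    simp only [Matrix.transpose_apply, Matrix.of_apply]
    rw [← orderOf_inv, mul_inv_rev, s_inv, s_inv]
  diagonal i := by simp [s_mul_s]
  off_diagonal i j hij := by
    obtain ⟨a, b, -, -, h⟩ := D.orderOf_s_mul_s hij
    simp only [Matrix.of_apply]
    omega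

theorem coxeterMatrix_apply [CharZero k] (i j : ι) :
    D.coxeterMatrix i j = orderOf (D.s i * D.s j) := rfl

/-- Natural coefficients of `v` and `-v` add up to zero by linear independence, and in
characteristic zero this forces each of them to vanish. -/
theorem salient_simpleRoot [CharZero k] (v : Dual k 𝔥)
    (h1 : v ∈ AddSubmonoid.closure (Set.range D.simpleRoot))
    (h2 : -v ∈ AddSubmonoid.closure (Set.range D.simpleRoot)) : v = 0 := by
  have key : ∀ v ∈ AddSubmonoid.closure (Set.range D.simpleRoot),
      ∃ c : ι → ℕ, v = ∑ i, (c i : k) • D.simpleRoot i := by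
    intro v hv
    obtain ⟨c, hc⟩ := AddSubmonoid.mem_closure_range_iff.1 hv
    refine ⟨c, ?_⟩
    rw [hc, Finsupp.sum_fintype _ _ (by simp)]
    exact Finset.sum_congr rfl fun i _ => (Nat.cast_smul_eq_nsmul k _ _).symm
  obtain ⟨c, hc⟩ := key v h1
  obtain ⟨d, hd⟩ := key (-v) h2
  have h0 : ∑ i, ((c i : k) + d i) • D.simpleRoot i = 0 := by
    simp only [add_smul, Finset.sum_add_distrib]
    rw [← hc, ← hd, add_neg_cancel]
  have h3 := Fintype.linearIndependent_iff.1 D.linearIndependent_simpleRoot _ h0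
  rw [hc]
  refine Finset.sum_eq_zero fun i _ => ?_
  have : c i + d i = 0 := by exact_mod_cast h3 i
  rw [show c i = 0 by omega, Nat.cast_zero, zero_smul]

/-- The simple roots form positive root data for every Coxeter system which maps to the Weyl
group by sending simple reflections to simple reflections. -/
def positiveRootData [CharZero k] {W : Type*} [Group W] (cs : CoxeterSystem D.coxeterMatrix W)
    (f : W →* D.weylGroup) (hf : ∀ i, f (cs.simple i) = D.s i) :
    cs.PositiveRootData (Dual k 𝔥) where
  action := D.weylAction.comp f
  root := D.simpleRoot
  root_ne_zero i := D.linearIndependent_simpleRoot.ne_zero i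
  salient := D.salient_simpleRoot
  simple_root i := by
    rw [MonoidHom.comp_apply, hf, weylAction_s_self]
  alternating_root i j n hij hn := by
    have e : f (cs.wordProd (alternatingWord i j n)) =
        ((alternatingWord i j n).map D.s).prod := by
      rw [wordProd, map_list_prod, List.map_map]
      congr 2
      ext1 i
      exact hf i
    rw [MonoidHom.comp_apply, e, weylAction_alternatingWord]
    obtain ⟨h1, h2⟩ := D.altRoot_nonneg hij hn
    obtain ⟨p, hp⟩ := Int.eq_ofNat_of_zero_le h1
    obtain ⟨q, hq⟩ := Int.eq_ofNat_of_zero_le h2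
    rw [hp, hq, natCast_zsmul, natCast_zsmul]
    exact add_mem (nsmul_mem (AddSubmonoid.subset_closure (by simp)) _)
      (nsmul_mem (AddSubmonoid.subset_closure (by simp)) _)

/-- The map from the abstract Coxeter group to the Weyl group. -/
def coxeterToWeyl [CharZero k] : D.coxeterMatrix.Group →* D.weylGroup :=
  D.coxeterMatrix.toCoxeterSystem.lift ⟨D.s, fun i j => pow_orderOf_eq_one (D.s i * D.s j)⟩

theorem coxeterToWeyl_simple [CharZero k] (i : ι) :
    D.coxeterToWeyl (D.coxeterMatrix.toCoxeterSystem.simple i) = D.s i :=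
  D.coxeterMatrix.toCoxeterSystem.lift_apply_simple
    (fun i j => pow_orderOf_eq_one (D.s i * D.s j)) i

/-- A nontrivial element of the kernel has a right descent `i`, so it would move `α_i` out of the
positive cone although it acts trivially. -/
theorem coxeterToWeyl_bijective [CharZero k] : Function.Bijective D.coxeterToWeyl := by
  constructor
  · rw [injective_iff_map_eq_one]
    intro w hw
    by_contra h
    obtain ⟨i, hi⟩ := D.coxeterMatrix.toCoxeterSystem.exists_rightDescent_of_ne_one h
    refine (D.positiveRootData _ D.coxeterToWeyl D.coxeterToWeyl_simple).action_root_notMem hi ?_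
    have : (D.positiveRootData _ D.coxeterToWeyl D.coxeterToWeyl_simple).action w = 1 := by
      change D.weylAction (D.coxeterToWeyl w) = 1
      rw [hw, map_one]
    rw [this]
    exact AddSubmonoid.subset_closure ⟨i, rfl⟩
  · rintro ⟨w, hw⟩
    induction hw using Subgroup.closure_induction'' with
    | mem g hg =>
      obtain ⟨i, rfl⟩ := hg
      exact ⟨_, D.coxeterToWeyl_simple i⟩
    | inv_mem g hg =>
      obtain ⟨i, rfl⟩ := hg
      exact ⟨_, (map_inv _ _).trans (congrArg _ (D.coxeterToWeyl_simple i))⟩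
    | one => exact ⟨1, map_one _⟩
    | mul g h hg hh ihg ihh =>
      obtain ⟨a, ha⟩ := ihg
      obtain ⟨b, hb⟩ := ihh
      exact ⟨a * b, (map_mul _ _ _).trans (by rw [ha, hb]; rfl)⟩

/-- The Weyl group of a generalized Cartan matrix is a Coxeter group. -/
def coxeterSystem [CharZero k] : CoxeterSystem D.coxeterMatrix D.weylGroup :=
  D.coxeterMatrix.toCoxeterSystem.map
    (MulEquiv.ofBijective D.coxeterToWeyl D.coxeterToWeyl_bijective)

theorem coxeterSystem_simple [CharZero k] (i : ι) : D.coxeterSystem.simple i = D.s i :=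
  D.coxeterToWeyl_simple i

/-- The action of the Weyl group on the simple roots as positive root data. -/
def weylRootData [CharZero k] : D.coxeterSystem.PositiveRootData (Dual k 𝔥) :=
  D.positiveRootData D.coxeterSystem (MonoidHom.id _) D.coxeterSystem_simple

end Realization

end KacMoody

end

/-! ### The hyperbolic formal group law and its nilpotent points -/

noncomputable section

namespace FormalGroup

-- Clearing the denominator `1 - uv` gives a recursion for the coefficients, from which all later
-- information about the power series is derived.
open MvPowerSeries in
theorem hyperbolic_eq {R : Type*} [CommRing R] (μ : R) :
    hyperbolic μ (-1) = X 0 + X 1 - C μ * (X 0 * X 1) + X 0 * X 1 * hyperbolic μ (-1) := by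
  have h : (1 + C (-1 : R) * (X 0 * X 1) : MvPowerSeries (Fin 2) R) *
      invOfUnit (1 + C (-1) * (X 0 * X 1)) 1 = 1 :=
    mul_invOfUnit _ _ (by simp)
  have h' : hyperbolic μ (-1) * (1 + C (-1 : R) * (X 0 * X 1)) =
      X 0 + X 1 - C μ * (X 0 * X 1) := by
    rw [hyperbolic, mul_assoc, mul_comm (invOfUnit _ _), h, mul_one]
  rw [← h', map_neg, map_one]
  ring

section Coefficients

variable {R : Type*} [CommRing R] (μ : R)

theorem bidegree_eq_iff {i j i' j' : ℕ} :
    (Finsupp.single (0 : Fin 2) i + Finsupp.single 1 j = Finsupp.single 0 i' + Finsupp.single 1 j')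
      ↔ i = i' ∧ j = j' := by
  constructor
  · intro h
    have h0 := DFunLike.congr_fun h 0
    have h1 := DFunLike.congr_fun h 1
    simpa using And.intro h0 h1
  · rintro ⟨rfl, rfl⟩
    rfl

theorem X_zero_mul_X_one : (MvPowerSeries.X 0 * MvPowerSeries.X 1 : MvPowerSeries (Fin 2) R) =
    MvPowerSeries.monomial (Finsupp.single 0 1 + Finsupp.single 1 1) 1 := by
  rw [MvPowerSeries.X_def, MvPowerSeries.X_def, MvPowerSeries.monomial_mul_monomial, one_mul]

theorem coeff_hyperbolic_numerator (i j : ℕ) :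
    MvPowerSeries.coeff (Finsupp.single 0 i + Finsupp.single 1 j)
      (MvPowerSeries.X 0 + MvPowerSeries.X 1 -
        MvPowerSeries.C μ * (MvPowerSeries.X 0 * MvPowerSeries.X 1) :
          MvPowerSeries (Fin 2) R) =
      (if i = 1 ∧ j = 0 then 1 else 0) + (if i = 0 ∧ j = 1 then 1 else 0) -
        μ * (if i = 1 ∧ j = 1 then 1 else 0) := by
  have e0 : (Finsupp.single 0 1 : Fin 2 →₀ ℕ) = Finsupp.single 0 1 + Finsupp.single 1 0 := by simp
  have e1 : (Finsupp.single 1 1 : Fin 2 →₀ ℕ) = Finsupp.single 0 0 + Finsupp.single 1 1 := by simp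
  rw [map_sub, map_add, MvPowerSeries.coeff_C_mul, X_zero_mul_X_one, MvPowerSeries.coeff_monomial,
    MvPowerSeries.coeff_X, MvPowerSeries.coeff_X]
  have h0 : (Finsupp.single 0 i + Finsupp.single 1 j : Fin 2 →₀ ℕ) = Finsupp.single 0 1 ↔
      i = 1 ∧ j = 0 := by rw [e0, bidegree_eq_iff]
  have h1 : (Finsupp.single 0 i + Finsupp.single 1 j : Fin 2 →₀ ℕ) = Finsupp.single 1 1 ↔
      i = 0 ∧ j = 1 := by rw [e1, bidegree_eq_iff]
  simp only [h0, h1, bidegree_eq_iff]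

theorem coeff_hyperbolic_succ_succ (i j : ℕ) :
    MvPowerSeries.coeff (Finsupp.single 0 (i + 1) + Finsupp.single 1 (j + 1))
        (hyperbolic μ (-1)) =
      (if i = 0 ∧ j = 0 then -μ else 0) +
        MvPowerSeries.coeff (Finsupp.single 0 i + Finsupp.single 1 j) (hyperbolic μ (-1)) := by
  have e : (Finsupp.single 0 (i + 1) + Finsupp.single 1 (j + 1) : Fin 2 →₀ ℕ) =
      Finsupp.single 0 1 + Finsupp.single 1 1 + (Finsupp.single 0 i + Finsupp.single 1 j) := by
    rw [Finsupp.single_add, Finsupp.single_add]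
    abel
  conv_lhs => rw [hyperbolic_eq, map_add, coeff_hyperbolic_numerator, X_zero_mul_X_one, e,
    MvPowerSeries.coeff_add_monomial_mul, one_mul]
  congr 1
  split_ifs <;> simp_all

theorem coeff_hyperbolic_zero_left (j : ℕ) :
    MvPowerSeries.coeff (Finsupp.single 0 0 + Finsupp.single 1 j) (hyperbolic μ (-1)) =
      if j = 1 then 1 else 0 := by
  have h : ¬ (Finsupp.single 0 1 + Finsupp.single 1 1 : Fin 2 →₀ ℕ) ≤
      Finsupp.single 0 0 + Finsupp.single 1 j := by
    intro h
    simpa using h 0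
  rw [hyperbolic_eq, map_add, coeff_hyperbolic_numerator, X_zero_mul_X_one,
    MvPowerSeries.coeff_monomial_mul, if_neg h]
  simp

theorem coeff_hyperbolic_zero_right (i : ℕ) :
    MvPowerSeries.coeff (Finsupp.single 0 i + Finsupp.single 1 0) (hyperbolic μ (-1)) =
      if i = 1 then 1 else 0 := by
  have h : ¬ (Finsupp.single 0 1 + Finsupp.single 1 1 : Fin 2 →₀ ℕ) ≤
      Finsupp.single 0 i + Finsupp.single 1 0 := by
    intro h
    simpa using h 1
  rw [hyperbolic_eq, map_add, coeff_hyperbolic_numerator, X_zero_mul_X_one,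
    MvPowerSeries.coeff_monomial_mul, if_neg h]
  simp

/-- The truncations of the hyperbolic formal group law, evaluated at nilpotent elements. -/
theorem sum_coeff_hyperbolic_mul {S : Type*} [CommRing S] [Algebra R S] {u v : S} {n : ℕ}
    (hu : u ^ n = 0) (hv : v ^ n = 0) :
    (∑ i ∈ Finset.range n, ∑ j ∈ Finset.range n,
      algebraMap R S (MvPowerSeries.coeff (Finsupp.single 0 i + Finsupp.single 1 j)
        (hyperbolic μ (-1))) * (u ^ i * v ^ j)) * (1 - u * v) =
      u + v - algebraMap R S μ * (u * v) := by
  -- For `n = 0` the hypothesis reads `1 = 0`.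
  rcases n with _ | n
  · have h : (0 : S) = 1 := by simpa using hu.symm
    exact (subsingleton_of_zero_eq_one h).elim _ _
  set c : ℕ → ℕ → S := fun i j => algebraMap R S
    (MvPowerSeries.coeff (Finsupp.single 0 i + Finsupp.single 1 j) (hyperbolic μ (-1))) with hc
  change (∑ i ∈ Finset.range (n + 1), ∑ j ∈ Finset.range (n + 1), c i j * (u ^ i * v ^ j)) * _ = _
  have c1 : ∀ i j, c (i + 1) (j + 1) =
      (if i = 0 ∧ j = 0 then -algebraMap R S μ else 0) + c i j := by
    intro i j
    simp only [hc]
    rw [coeff_hyperbolic_succ_succ, map_add]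
    congr 1
    split_ifs <;> simp
  have c2 : ∀ j, c 0 j = if j = 1 then 1 else 0 := by
    intro j
    simp only [hc]
    rw [coeff_hyperbolic_zero_left]
    split_ifs <;> simp
  have c3 : ∀ i, c i 0 = if i = 1 then 1 else 0 := by
    intro i
    simp only [hc]
    rw [coeff_hyperbolic_zero_right]
    split_ifs <;> simp
  -- Multiplication by `u * v` shifts both indices by one, and the terms that leave the range vanish
  -- by nilpotency.
  have h1 : (∑ i ∈ Finset.range (n + 1), ∑ j ∈ Finset.range (n + 1), c i j * (u ^ i * v ^ j)) *
      (u * v) = ∑ i ∈ Finset.range n, ∑ j ∈ Finset.range n,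
        c i j * (u ^ (i + 1) * v ^ (j + 1)) := by
    have e : ∀ i j, c i j * (u ^ i * v ^ j) * (u * v) = c i j * (u ^ (i + 1) * v ^ (j + 1)) := by
      intros; ring
    simp only [Finset.sum_mul, e]
    rw [Finset.sum_range_succ, show (∑ j ∈ Finset.range (n + 1),
      c n j * (u ^ (n + 1) * v ^ (j + 1))) = 0 by simp [hu], _root_.add_zero]
    refine Finset.sum_congr rfl fun i _ => ?_
    rw [Finset.sum_range_succ, hv]
    simp
  have h2 : (∑ i ∈ Finset.range (n + 1), ∑ j ∈ Finset.range (n + 1), c i j * (u ^ i * v ^ j)) =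
      (∑ i ∈ Finset.range n, ∑ j ∈ Finset.range n, c (i + 1) (j + 1) * (u ^ (i + 1) * v ^ (j + 1)))
        + (if 0 < n then u else 0) + (if 0 < n then v else 0) := by
    rw [Finset.sum_range_succ']
    simp only [Finset.sum_range_succ' _ n, Finset.sum_add_distrib, c2, c3]
    simp [Finset.sum_ite_eq', add_assoc]
  have h3 : (∑ i ∈ Finset.range n, ∑ j ∈ Finset.range n,
      c (i + 1) (j + 1) * (u ^ (i + 1) * v ^ (j + 1))) =
      (if 0 < n then -algebraMap R S μ * (u * v) else 0) + ∑ i ∈ Finset.range n,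
        ∑ j ∈ Finset.range n, c i j * (u ^ (i + 1) * v ^ (j + 1)) := by
    simp only [c1, add_mul, Finset.sum_add_distrib]
    congr 1
    rcases n with _ | n
    · simp
    · rw [Finset.sum_range_succ', Finset.sum_range_succ']
      simp
  rw [mul_sub, mul_one, h1, h2, h3]
  rcases Nat.eq_zero_or_pos n with rfl | hn
  · simp only [_root_.zero_add, pow_one] at hu hv
    simp [hu, hv]
  · simp only [hn, if_true]
    ring

end Coefficients

/-! ### Points of the hyperbolic formal group in a nil ideal -/

/-- The points of the hyperbolic formal group law with values in a nil ideal. -/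
def HyperbolicPoint {S : Type*} [CommRing S] (_μ : S) {I : Ideal S} (_hI : I ≤ nilradical S) :
    Type _ := I

namespace HyperbolicPoint

variable {S : Type*} [CommRing S] {μ : S} {I : Ideal S} {hI : I ≤ nilradical S}

/-- The underlying element of the ring. -/
def val (u : HyperbolicPoint μ hI) : S := Subtype.val (p := (· ∈ I)) u

/-- The point with a given underlying element. -/
def of (a : S) (ha : a ∈ I) : HyperbolicPoint μ hI := Subtype.mk (p := (· ∈ I)) a ha

theorem val_mem (u : HyperbolicPoint μ hI) : u.val ∈ I := Subtype.prop (p := (· ∈ I)) u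

theorem val_injective : Function.Injective (val : HyperbolicPoint μ hI → S) :=
  Subtype.val_injective

theorem isUnit_one_sub {a : S} (ha : a ∈ I) (hI : I ≤ nilradical S) : IsUnit (1 - a) :=
  IsNilpotent.isUnit_one_sub (mem_nilradical.1 (hI ha))

instance : Add (HyperbolicPoint μ hI) where
  add u v := ⟨(u.val + v.val - μ * (u.val * v.val)) * Ring.inverse (1 - u.val * v.val),
    I.mul_mem_right _ (sub_mem (add_mem u.val_mem v.val_mem)
      (I.mul_mem_left _ (I.mul_mem_left _ v.val_mem)))⟩

instance : Zero (HyperbolicPoint μ hI) where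
  zero := ⟨0, I.zero_mem⟩

instance : Neg (HyperbolicPoint μ hI) where
  neg u := ⟨-u.val * Ring.inverse (1 - μ * u.val), I.mul_mem_right _ (neg_mem u.val_mem)⟩

theorem val_zero : (0 : HyperbolicPoint μ hI).val = 0 := rfl

theorem val_add (u v : HyperbolicPoint μ hI) :
    (u + v).val * (1 - u.val * v.val) = u.val + v.val - μ * (u.val * v.val) := by
  change _ * Ring.inverse _ * _ = _
  rw [mul_assoc, Ring.inverse_mul_cancel _ (isUnit_one_sub (I.mul_mem_left _ v.val_mem) hI),
    mul_one]

/-- Since `u v` is nilpotent, `1 - u v` is a unit, and the law cleared of denominators determines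
the sum. All group axioms except associativity are verified in this form. -/
theorem eq_add {u v w : HyperbolicPoint μ hI}
    (h : w.val * (1 - u.val * v.val) = u.val + v.val - μ * (u.val * v.val)) : w = u + v := by
  apply val_injective
  apply (isUnit_one_sub (I.mul_mem_left u.val v.val_mem) hI).mul_right_cancel
  rw [h, val_add]

theorem val_neg (u : HyperbolicPoint μ hI) : (-u).val * (1 - μ * u.val) = -u.val := by
  change _ * Ring.inverse _ * _ = _
  rw [mul_assoc, Ring.inverse_mul_cancel _ (isUnit_one_sub (I.mul_mem_left _ u.val_mem) hI),
    mul_one]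

/-- The cleared formula is symmetric in the three points, so associativity follows from it together
with commutativity. -/
theorem val_add_add (u v w : HyperbolicPoint μ hI) :
    (u + v + w).val * (1 - (u.val * v.val + u.val * w.val + v.val * w.val) +
        μ * (u.val * v.val * w.val)) =
      u.val + v.val + w.val - μ * (u.val * v.val + u.val * w.val + v.val * w.val) +
        (μ ^ 2 - 1) * (u.val * v.val * w.val) := by
  have h1 := val_add u v
  have h2 := val_add (u + v) w
  linear_combination (1 - u.val * v.val) * h2 + ((u + v + w).val * w.val + 1 - μ * w.val) * h1

instance : AddCommGroup (HyperbolicPoint μ hI) where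
  add_assoc u v w := by
    have e : ∀ u v : HyperbolicPoint μ hI, u + v = v + u := by
      intro u v
      apply eq_add
      linear_combination val_add u v
    have h1 := val_add_add u v w
    have h2 := val_add_add v w u
    rw [e (v + w) u] at h2
    have hu : IsUnit (1 - (u.val * v.val + u.val * w.val + v.val * w.val -
        μ * (u.val * v.val * w.val))) := by
      refine isUnit_one_sub (sub_mem (add_mem (add_mem ?_ ?_) ?_) ?_) hI
      · exact I.mul_mem_left _ v.val_mem
      · exact I.mul_mem_left _ w.val_mem
      · exact I.mul_mem_left _ w.val_mem
      · exact I.mul_mem_left _ (I.mul_mem_left _ w.val_mem)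
    apply val_injective
    apply hu.mul_right_cancel
    linear_combination h1 - h2
  zero_add u := by
    symm
    apply eq_add
    rw [val_zero]
    ring
  add_zero u := by
    symm
    apply eq_add
    rw [val_zero]
    ring
  neg_add_cancel u := by
    symm
    apply eq_add
    rw [val_zero]
    linear_combination -val_neg u
  add_comm u v := by
    apply eq_add
    linear_combination val_add u v
  nsmul := nsmulRec
  zsmul := zsmulRec

end HyperbolicPoint

end FormalGroup

end

/-! ### The filtration of the formal group algebra and its coordinates -/

noncomputable section

namespace FormalGroup

-- This makes powers of the augmentation ideal visible on coefficients: membership in the `n`-th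
-- power means that all coefficients of degree below `n` vanish.
open MvPolynomial in
theorem augIdeal_eq_idealOfVars (R : Type*) [CommRing R] (σ : Type*) :
    augIdeal R σ = idealOfVars σ R := by
  apply le_antisymm
  · intro p hp
    rw [← pow_one (idealOfVars σ R), mem_pow_idealOfVars_iff']
    intro m hm
    have hm0 : m = 0 := by
      have : m.degree = 0 := by omega
      exact (Finsupp.degree_eq_zero_iff m).1 this
    rw [augIdeal, RingHom.mem_ker] at hp
    subst hm0
    have h : (aeval (fun _ : σ => (0 : R)) : MvPolynomial σ R →ₐ[R] R) p = constantCoeff p := by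
      simp
    change constantCoeff p = 0
    rw [← h]
    exact hp
  · rw [Ideal.span_le]
    rintro _ ⟨i, rfl⟩
    exact X_mem_augIdeal i

/-- Multiplication by a variable is strictly compatible with the powers of the augmentation
ideal. -/
theorem mem_augIdeal_pow_of_X_mul {R : Type*} [CommRing R] {σ : Type*} {i : σ} {n : ℕ}
    {p : MvPolynomial σ R} (h : MvPolynomial.X i * p ∈ augIdeal R σ ^ (n + 1)) :
    p ∈ augIdeal R σ ^ n := by
  rw [augIdeal_eq_idealOfVars, MvPolynomial.mem_pow_idealOfVars_iff'] at h ⊢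
  intro m hm
  rw [← MvPolynomial.coeff_X_mul m i p]
  apply h
  rw [map_add, Finsupp.degree_single]
  omega

section Filtration

variable {R : Type*} [CommRing R] (F : MvPowerSeries (Fin 2) R) (M : Type*) [AddCommGroup M]

/-- The quotient map from the completed polynomial ring to the formal group algebra. -/
def ofCompleted : Completed R M →ₐ[R] FormalGroupAlgebra F M :=
  Ideal.Quotient.mkₐ R (closedRelIdeal F M)

theorem ofCompleted_surjective : Function.Surjective (ofCompleted F M) :=
  Ideal.Quotient.mk_surjective

theorem ofCompleted_eq_zero {f : Completed R M} :
    ofCompleted F M f = 0 ↔ f ∈ closedRelIdeal F M :=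
  Ideal.Quotient.eq_zero_iff_mem

theorem ofCompleted_xCompleted (m : M) : ofCompleted F M (xCompleted R m) = x F m := rfl

/-- The filtration of the formal group algebra induced by the topology of the completion. -/
def level (n : ℕ) : Ideal (FormalGroupAlgebra F M) :=
  (relIdeal F M ⊔ RingHom.ker (AdicCompletion.evalₐ (augIdeal R M) n)).map (ofCompleted F M)

variable {M}

/-- The kernel of the quotient map is the intersection of these ideals over all `n`, hence is
contained in each of them, and taking the image loses nothing. -/
theorem ofCompleted_mem_level {n : ℕ} {f : Completed R M} :
    ofCompleted F M f ∈ level F M n ↔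
      f ∈ relIdeal F M ⊔ RingHom.ker (AdicCompletion.evalₐ (augIdeal R M) n) := by
  constructor
  · intro h
    obtain ⟨g, hg, hfg⟩ := (Ideal.mem_map_iff_of_surjective _ (ofCompleted_surjective F M)).1 h
    have h1 : f - g ∈ closedRelIdeal F M := by
      rw [← ofCompleted_eq_zero, map_sub, hfg, sub_self]
    have h2 := (Ideal.mem_iInf.1 h1) n
    simpa using add_mem h2 hg
  · exact fun h => Ideal.mem_map_of_mem _ h

theorem ofCompleted_mem_level_of_eval {n : ℕ} {f : Completed R M}
    (h : AdicCompletion.evalₐ (augIdeal R M) n f = 0) : ofCompleted F M f ∈ level F M n :=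
  (ofCompleted_mem_level F).2 (Ideal.mem_sup_right h)

/-- Here the closure in the definition of the relation ideal matters: it makes the filtration
separated. -/
theorem eq_zero_of_forall_mem_level {s : FormalGroupAlgebra F M} (h : ∀ n, s ∈ level F M n) :
    s = 0 := by
  obtain ⟨f, rfl⟩ := ofCompleted_surjective F M s
  rw [ofCompleted_eq_zero]
  exact Ideal.mem_iInf.2 fun n => (ofCompleted_mem_level F).1 (h n)

omit [AddCommGroup M] in
theorem evalₐ_eq_zero_of_le {m n : ℕ} (hmn : m ≤ n) {f : Completed R M}
    (h : AdicCompletion.evalₐ (augIdeal R M) n f = 0) :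
    AdicCompletion.evalₐ (augIdeal R M) m f = 0 := by
  induction f using AdicCompletion.induction_on with
  | _ s =>
    have e := AdicCompletion.Ideal.mk_eq_mk (augIdeal R M) hmn s
    rw [AdicCompletion.evalₐ_mk] at h ⊢
    rw [← e, Ideal.Quotient.eq_zero_iff_mem]
    exact Ideal.pow_le_pow_right hmn (Ideal.Quotient.eq_zero_iff_mem.1 h)

theorem level_antitone : Antitone (level F M) := by
  intro m n hmn
  refine Ideal.map_mono (sup_le_sup_left ?_ _)
  intro f hf
  exact evalₐ_eq_zero_of_le hmn hf

theorem x_pow_mem_level (m : M) (n : ℕ) : x F m ^ n ∈ level F M n := by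
  rw [← ofCompleted_xCompleted, ← map_pow]
  apply ofCompleted_mem_level_of_eval
  rw [map_pow, xCompleted, AdicCompletion.evalₐ_of, ← map_pow, Ideal.Quotient.eq_zero_iff_mem]
  exact Ideal.pow_mem_pow (X_mem_augIdeal m) n

theorem x_zero : x F (0 : M) = 0 := by
  apply eq_zero_of_forall_mem_level F
  intro n
  rw [← ofCompleted_xCompleted, ofCompleted_mem_level]
  exact Ideal.mem_sup_left (Ideal.subset_span (Or.inl rfl))

/-- Polynomials in the `x_λ` as elements of the formal group algebra. -/
def ofPolynomial : MvPolynomial M R →ₐ[R] FormalGroupAlgebra F M :=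
  MvPolynomial.aeval (x F)

theorem ofPolynomial_apply (p : MvPolynomial M R) :
    ofPolynomial F p =
      ofCompleted F M (AdicCompletion.of (augIdeal R M) (MvPolynomial M R) p) := by
  have h : ofPolynomial F = (ofCompleted F M).comp
      ((Algebra.ofId (MvPolynomial M R) (Completed R M)).restrictScalars R) := by
    apply MvPolynomial.algHom_ext
    intro m
    rw [ofPolynomial, MvPolynomial.aeval_X]
    rfl
  rw [h]
  rfl

theorem exists_sub_ofPolynomial_mem_level (s : FormalGroupAlgebra F M) (n : ℕ) :
    ∃ p, s - ofPolynomial F p ∈ level F M n := by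
  obtain ⟨f, rfl⟩ := ofCompleted_surjective F M s
  obtain ⟨p, hp⟩ := Ideal.Quotient.mk_surjective (AdicCompletion.evalₐ (augIdeal R M) n f)
  refine ⟨p, ?_⟩
  rw [ofPolynomial_apply, ← map_sub]
  apply ofCompleted_mem_level_of_eval
  rw [map_sub, AdicCompletion.evalₐ_of, hp, sub_self]

omit [AddCommGroup M] in
theorem evalₐ_formalSum (a b : M) (n : ℕ) :
    AdicCompletion.evalₐ (augIdeal R M) n (formalSum F a b) =
      Ideal.Quotient.mk _ (truncSum F a b n) := by
  rw [formalSum, AdicCompletion.evalₐ_mk]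
  rfl

theorem algebraMapOfHom_ofCompleted {N : Type*} [AddCommGroup N] (φ : M →+ N)
    (f : Completed R M) :
    algebraMapOfHom F φ (ofCompleted F M f) = ofCompleted F N (completedMap φ f) := rfl

theorem algebraMapOfHom_mem_level {N : Type*} [AddCommGroup N] (φ : M →+ N) {n : ℕ}
    {s : FormalGroupAlgebra F M} (hs : s ∈ level F M n) :
    algebraMapOfHom F φ s ∈ level F N n := by
  suffices h : level F M n ≤ (level F N n).comap (algebraMapOfHom F φ) from h hs
  refine Ideal.map_le_iff_le_comap.2 (sup_le (Ideal.span_le.2 ?_) ?_)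
  · rintro _ (rfl | ⟨a, b, rfl⟩)
    · rw [SetLike.mem_coe, Ideal.mem_comap, Ideal.mem_comap, ofCompleted_xCompleted, x_zero,
        map_zero]
      exact zero_mem _
    · have : ofCompleted F M (xCompleted R (a + b) - formalSum F a b) = 0 := by
        rw [ofCompleted_eq_zero]
        exact Ideal.mem_iInf.2 fun n =>
          Ideal.mem_sup_left (Ideal.subset_span (Or.inr ⟨a, b, rfl⟩))
      rw [SetLike.mem_coe, Ideal.mem_comap, this]
      exact zero_mem _
  · intro f hf
    rw [RingHom.mem_ker] at hf
    rw [Ideal.mem_comap, Ideal.mem_comap, algebraMapOfHom_ofCompleted]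
    apply ofCompleted_mem_level_of_eval
    rw [evalₐ_completedMap, hf, map_zero]

end Filtration

section Hyperbolic

variable {R : Type*} [CommRing R] (μ : R) {M : Type*} [AddCommGroup M]

omit [AddCommGroup M] in
theorem aeval_truncSum {S : Type*} [CommRing S] [Algebra R S] (g : M → S) (a b : M) (n : ℕ)
    (ha : g a ^ n = 0) (hb : g b ^ n = 0) :
    MvPolynomial.aeval g (truncSum (hyperbolic μ (-1)) a b n) * (1 - g a * g b) =
      g a + g b - algebraMap R S μ * (g a * g b) := by
  rw [← sum_coeff_hyperbolic_mul μ ha hb]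
  simp [truncSum]

/-- The addition law for the generators of the formal group algebra. -/
theorem x_add (a b : M) :
    x (hyperbolic μ (-1)) (a + b) *
        (1 - x (hyperbolic μ (-1)) a * x (hyperbolic μ (-1)) b) =
      x (hyperbolic μ (-1)) a + x (hyperbolic μ (-1)) b -
        algebraMap R _ μ * (x (hyperbolic μ (-1)) a * x (hyperbolic μ (-1)) b) := by
  set F := hyperbolic μ (-1) with hF
  have h1 : x F (a + b) = ofCompleted F M (formalSum F a b) := by
    rw [← ofCompleted_xCompleted, ← sub_eq_zero, ← map_sub, ofCompleted_eq_zero]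
    exact Ideal.mem_iInf.2 fun n =>
      Ideal.mem_sup_left (Ideal.subset_span (Or.inr ⟨a, b, rfl⟩))
  -- The identity is tested in every truncation of the completed ring, where the variables are
  -- nilpotent and `aeval_truncSum` applies.
  have h2 : formalSum F a b * (1 - xCompleted R a * xCompleted R b) =
      xCompleted R a + xCompleted R b - algebraMap R _ μ * (xCompleted R a * xCompleted R b) := by
    refine AdicCompletion.ext_evalₐ fun n => ?_
    have key := aeval_truncSum μ
      (fun m => Ideal.Quotient.mk (augIdeal R M ^ n) (MvPolynomial.X m)) a b n
      (by rw [← map_pow, Ideal.Quotient.eq_zero_iff_mem]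
          exact Ideal.pow_mem_pow (X_mem_augIdeal a) n)
      (by rw [← map_pow, Ideal.Quotient.eq_zero_iff_mem]
          exact Ideal.pow_mem_pow (X_mem_augIdeal b) n)
    have e : MvPolynomial.aeval (fun m => Ideal.Quotient.mk (augIdeal R M ^ n)
        (MvPolynomial.X m)) (truncSum F a b n) =
          Ideal.Quotient.mk (augIdeal R M ^ n) (truncSum F a b n) := by
      have : (MvPolynomial.aeval (fun m => Ideal.Quotient.mk (augIdeal R M ^ n)
          (MvPolynomial.X m : MvPolynomial M R))) =
          Ideal.Quotient.mkₐ R (augIdeal R M ^ n) := by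
        apply MvPolynomial.algHom_ext
        intro m
        simp
      rw [this]
      rfl
    have hμ : AdicCompletion.evalₐ (augIdeal R M) n (algebraMap R (Completed R M) μ) =
        algebraMap R (MvPolynomial M R ⧸ augIdeal R M ^ n) μ :=
      ((AdicCompletion.evalₐ (augIdeal R M) n).restrictScalars R).commutes μ
    rw [← hF, e] at key
    rw [map_mul, map_sub, map_sub, map_mul, map_mul, map_mul, map_add, map_one, hμ,
      evalₐ_formalSum, xCompleted, xCompleted, AdicCompletion.evalₐ_of, AdicCompletion.evalₐ_of]
    exact key
  have h3 := congrArg (ofCompleted F M) h2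
  simp only [map_mul, map_sub, map_add, map_one, ofCompleted_xCompleted, AlgHom.commutes] at h3
  rw [h1]
  exact h3

/-- The explicit cofactor shows that translation by `b` is trivial modulo `x_b`. -/
theorem x_add_sub (a b : M) :
    x (hyperbolic μ (-1)) (a + b) - x (hyperbolic μ (-1)) a =
      x (hyperbolic μ (-1)) b * (1 - algebraMap R _ μ * x (hyperbolic μ (-1)) a +
        x (hyperbolic μ (-1)) (a + b) * x (hyperbolic μ (-1)) a) := by
  linear_combination x_add μ a b

theorem x_add_x_neg (a : M) :
    x (hyperbolic μ (-1)) a + x (hyperbolic μ (-1)) (-a) =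
      algebraMap R _ μ * (x (hyperbolic μ (-1)) a * x (hyperbolic μ (-1)) (-a)) := by
  have h := x_add μ a (-a)
  rw [add_neg_cancel, x_zero] at h
  linear_combination -h

variable {d : ℕ} (b : Module.Basis (Fin d) ℤ M)

/-- The truncated polynomial ring. -/
abbrev Truncated (R : Type*) [CommRing R] (d n : ℕ) : Type _ :=
  MvPolynomial (Fin d) R ⧸ augIdeal R (Fin d) ^ n

theorem map_augIdeal_pow (R : Type*) [CommRing R] (d n : ℕ) :
    ((augIdeal R (Fin d)).map (Ideal.Quotient.mk (augIdeal R (Fin d) ^ n))) ^ n = ⊥ := by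
  rw [← Ideal.map_pow, Ideal.map_quotient_self]

theorem map_augIdeal_le_nilradical (R : Type*) [CommRing R] (d n : ℕ) :
    (augIdeal R (Fin d)).map (Ideal.Quotient.mk (augIdeal R (Fin d) ^ n)) ≤
      nilradical (Truncated R d n) := by
  intro a ha
  refine mem_nilradical.2 ⟨n, ?_⟩
  have := Ideal.pow_mem_pow ha n
  rwa [map_augIdeal_pow, Ideal.mem_bot] at this

/-- The homomorphism from the free group `M` to the points of the hyperbolic formal group which
sends the basis to the variables. -/
def coordPoint (n : ℕ) :
    M →+ HyperbolicPoint (algebraMap R (Truncated R d n) μ) (map_augIdeal_le_nilradical R d n) :=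
  (b.constr (M' := HyperbolicPoint (algebraMap R (Truncated R d n) μ)
    (map_augIdeal_le_nilradical R d n)) ℤ fun i => HyperbolicPoint.of
      (Ideal.Quotient.mk _ (MvPolynomial.X i))
        (Ideal.mem_map_of_mem _ (X_mem_augIdeal i))).toAddMonoidHom

theorem coordPoint_basis (n : ℕ) (i : Fin d) :
    (coordPoint μ b n (b i)).val = Ideal.Quotient.mk _ (MvPolynomial.X i) := by
  change HyperbolicPoint.val (b.constr ℤ _ (b i)) = _
  rw [Module.Basis.constr_basis]
  rfl

theorem coordPoint_pow (n : ℕ) (m : M) : (coordPoint μ b n m).val ^ n = 0 := by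
  have := Ideal.pow_mem_pow (coordPoint μ b n m).val_mem n
  rwa [map_augIdeal_pow, Ideal.mem_bot] at this

theorem aeval_coordPoint_mem (n : ℕ) {p : MvPolynomial M R} (hp : p ∈ augIdeal R M) :
    MvPolynomial.aeval (fun m => (coordPoint μ b n m).val) p ∈
      (augIdeal R (Fin d)).map (Ideal.Quotient.mk (augIdeal R (Fin d) ^ n)) := by
  rw [augIdeal_eq_idealOfVars, MvPolynomial.idealOfVars] at hp
  suffices h : Ideal.span (Set.range MvPolynomial.X) ≤ Ideal.comap (MvPolynomial.aeval (R := R)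
      fun m => (coordPoint μ b n m).val)
        ((augIdeal R (Fin d)).map (Ideal.Quotient.mk (augIdeal R (Fin d) ^ n))) from h hp
  refine Ideal.span_le.2 ?_
  rintro _ ⟨m, rfl⟩
  rw [SetLike.mem_coe, Ideal.mem_comap, MvPolynomial.aeval_X]
  exact HyperbolicPoint.val_mem _

theorem aeval_coordPoint_pow (n : ℕ) {p : MvPolynomial M R} (hp : p ∈ augIdeal R M ^ n) :
    MvPolynomial.aeval (fun m => (coordPoint μ b n m).val) p = 0 := by
  have h1 : augIdeal R M ≤ Ideal.comap (MvPolynomial.aeval (R := R)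
      fun m => (coordPoint μ b n m).val)
        ((augIdeal R (Fin d)).map (Ideal.Quotient.mk (augIdeal R (Fin d) ^ n))) :=
    fun p hp => aeval_coordPoint_mem μ b n hp
  have h2 := (Ideal.pow_right_mono h1 n).trans (Ideal.le_comap_pow _ n) hp
  rwa [map_augIdeal_pow, Ideal.mem_comap, Ideal.mem_bot] at h2

/-- The map from the completed polynomial ring to the truncated polynomial ring determined by a
basis. -/
def completedCoord (n : ℕ) : Completed R M →ₐ[R] Truncated R d n :=
  (Ideal.Quotient.liftₐ (augIdeal R M ^ n)
    (MvPolynomial.aeval fun m => (coordPoint μ b n m).val)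
    fun _ => aeval_coordPoint_pow μ b n).comp
      ((AdicCompletion.evalₐ (augIdeal R M) n).restrictScalars R)

theorem completedCoord_of_evalₐ (n : ℕ) {f : Completed R M} {p : MvPolynomial M R}
    (h : AdicCompletion.evalₐ (augIdeal R M) n f = Ideal.Quotient.mk _ p) :
    completedCoord μ b n f = MvPolynomial.aeval (fun m => (coordPoint μ b n m).val) p := by
  rw [completedCoord, AlgHom.comp_apply, AlgHom.restrictScalars_apply, h]
  rfl

/-- The relations hold in the target because `coordPoint` is additive: `x_0` goes to the zero point,
and the truncated law computes sums of points. -/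
theorem completedCoord_eq_zero (n : ℕ) {f : Completed R M}
    (hf : f ∈ relIdeal (hyperbolic μ (-1)) M ⊔
      RingHom.ker (AdicCompletion.evalₐ (augIdeal R M) n)) :
    completedCoord μ b n f = 0 := by
  rw [← RingHom.mem_ker]
  refine (sup_le (Ideal.span_le.2 ?_) ?_ :
    _ ≤ RingHom.ker (completedCoord μ b n)) hf
  · have hx : ∀ m : M, completedCoord μ b n (xCompleted R m) = (coordPoint μ b n m).val := by
      intro m
      rw [xCompleted, completedCoord_of_evalₐ μ b n (AdicCompletion.evalₐ_of _ n _),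
        MvPolynomial.aeval_X]
    rintro _ (rfl | ⟨a, c, rfl⟩)
    · rw [SetLike.mem_coe, RingHom.mem_ker, hx, map_zero]
      rfl
    · rw [SetLike.mem_coe, RingHom.mem_ker, map_sub, hx,
        completedCoord_of_evalₐ μ b n (evalₐ_formalSum _ a c n), sub_eq_zero]
      apply (HyperbolicPoint.isUnit_one_sub (Ideal.mul_mem_left _ (coordPoint μ b n a).val
        (coordPoint μ b n c).val_mem) (map_augIdeal_le_nilradical R d n)).mul_right_cancel
      rw [aeval_truncSum μ (fun m => (coordPoint μ b n m).val) a c n (coordPoint_pow μ b n a)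
        (coordPoint_pow μ b n c), map_add, HyperbolicPoint.val_add]
  · intro f hf
    rw [RingHom.mem_ker] at hf ⊢
    rw [completedCoord_of_evalₐ μ b n (p := 0) (by rw [hf, map_zero]), map_zero]

/-- The map from the formal group algebra to the truncated polynomial ring determined by a
basis. -/
def coordEval (n : ℕ) : FormalGroupAlgebra (hyperbolic μ (-1)) M →ₐ[R] Truncated R d n :=
  Ideal.Quotient.liftₐ (closedRelIdeal (hyperbolic μ (-1)) M) (completedCoord μ b n)
    fun _ hf => completedCoord_eq_zero μ b n (Ideal.mem_iInf.1 hf n)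

theorem coordEval_ofCompleted (n : ℕ) (f : Completed R M) :
    coordEval μ b n (ofCompleted _ M f) = completedCoord μ b n f := rfl

theorem coordEval_eq_zero {n : ℕ} {s : FormalGroupAlgebra (hyperbolic μ (-1)) M}
    (hs : s ∈ level _ M n) : coordEval μ b n s = 0 := by
  obtain ⟨f, rfl⟩ := ofCompleted_surjective _ M s
  rw [coordEval_ofCompleted]
  exact completedCoord_eq_zero μ b n ((ofCompleted_mem_level _).1 hs)

theorem coordEval_x_basis (n : ℕ) (i : Fin d) :
    coordEval μ b n (x _ (b i)) = Ideal.Quotient.mk _ (MvPolynomial.X i) := by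
  rw [← ofCompleted_xCompleted, coordEval_ofCompleted, xCompleted,
    completedCoord_of_evalₐ μ b n (AdicCompletion.evalₐ_of _ n _), MvPolynomial.aeval_X,
    coordPoint_basis]

/-- Polynomials in the generators which correspond to a basis. -/
def ofCoord : MvPolynomial (Fin d) R →ₐ[R] FormalGroupAlgebra (hyperbolic μ (-1)) M :=
  MvPolynomial.aeval fun i => x _ (b i)

/-- Together with `ofCoord_mem_level` and `exists_sub_ofCoord_mem_level` this identifies the
quotient by `level n` with the truncated polynomial ring in the basis coordinates. -/
theorem coordEval_ofCoord (n : ℕ) (p : MvPolynomial (Fin d) R) :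
    coordEval μ b n (ofCoord μ b p) = Ideal.Quotient.mk _ p := by
  have : (coordEval μ b n).comp (ofCoord μ b) = Ideal.Quotient.mkₐ R _ := by
    apply MvPolynomial.algHom_ext
    intro i
    rw [AlgHom.comp_apply, ofCoord, MvPolynomial.aeval_X, coordEval_x_basis]
    rfl
  exact DFunLike.congr_fun this p

theorem ofCoord_eq_ofPolynomial (p : MvPolynomial (Fin d) R) :
    ofCoord μ b p = ofPolynomial _ (MvPolynomial.rename b p) := by
  rw [ofPolynomial, MvPolynomial.aeval_rename, ofCoord]
  rfl

theorem ofCoord_mem_level {n : ℕ} {p : MvPolynomial (Fin d) R}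
    (hp : p ∈ augIdeal R (Fin d) ^ n) : ofCoord μ b p ∈ level _ M n := by
  rw [ofCoord_eq_ofPolynomial, ofPolynomial_apply]
  apply ofCompleted_mem_level_of_eval
  rw [AdicCompletion.evalₐ_of, Ideal.Quotient.eq_zero_iff_mem]
  exact augIdeal_pow_le_comap b n hp

/-- Modulo `level n`, the subalgebra generated by the `x` of the basis contains every `x_m`: the set
of such `m` is a subgroup, because formal sums and inverses only require dividing by `1 -`
nilpotent. -/
theorem exists_sub_ofCoord_mem_level (s : FormalGroupAlgebra (hyperbolic μ (-1)) M) (n : ℕ) :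
    ∃ p, s - ofCoord μ b p ∈ level _ M n := by
  set q := Ideal.Quotient.mkₐ R (level (hyperbolic μ (-1)) M n) with hq
  have hq0 : ∀ s, q s = 0 ↔ s ∈ level (hyperbolic μ (-1)) M n :=
    fun s => Ideal.Quotient.eq_zero_iff_mem
  set T := (q.comp (ofCoord μ b)).range with hT
  -- The inverse of `1 - a` is a polynomial in the nilpotent `a`, so it stays in the subalgebra.
  have hunit : ∀ a ∈ T, ∀ c, IsNilpotent a → c * (1 - a) ∈ T → c ∈ T := by
    intro a ha c hnil hc
    have hnil' : IsNilpotent (⟨a, ha⟩ : T) := by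
      obtain ⟨k, hk⟩ := hnil
      exact ⟨k, Subtype.ext hk⟩
    obtain ⟨u, hu⟩ := (IsNilpotent.isUnit_one_sub hnil').exists_right_inv
    have hu' : (1 - a) * (u : _) = 1 := congrArg Subtype.val hu
    have : c = c * (1 - a) * u := by rw [mul_assoc, hu', mul_one]
    rw [this]
    exact T.mul_mem hc u.2
  have hnil : ∀ m : M, IsNilpotent (q (x _ m)) := by
    intro m
    refine ⟨n, ?_⟩
    rw [← map_pow, hq0]
    exact x_pow_mem_level _ m n
  have hμ : q (algebraMap R _ μ) ∈ T := by
    rw [AlgHom.commutes]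
    exact T.algebraMap_mem μ
  have hx : ∀ m : M, q (x _ m) ∈ T := by
    intro m
    have hm : m ∈ AddSubgroup.closure (Set.range b) := by
      rw [← Submodule.span_int_eq_addSubgroupClosure, b.span_eq]
      trivial
    induction hm using AddSubgroup.closure_induction with
    | mem m hm =>
      obtain ⟨i, rfl⟩ := hm
      refine ⟨MvPolynomial.X i, ?_⟩
      rw [AlgHom.toRingHom_eq_coe, RingHom.coe_coe, AlgHom.comp_apply, ofCoord,
        MvPolynomial.aeval_X]
    | zero =>
      rw [x_zero, map_zero]
      exact T.zero_mem
    | add a c _ _ ha hc =>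
      refine hunit _ (T.mul_mem ha hc) _ ((Commute.all _ _).isNilpotent_mul_right (hnil a)) ?_
      have h := congrArg q (x_add μ a c)
      simp only [map_mul, map_sub, map_one, map_add] at h
      rw [h]
      exact T.sub_mem (T.add_mem ha hc) (T.mul_mem hμ (T.mul_mem ha hc))
    | neg a _ ha =>
      refine hunit _ (T.mul_mem hμ ha) _ ((Commute.all _ _).isNilpotent_mul_left (hnil a)) ?_
      have h := congrArg q (x_add_x_neg μ a)
      simp only [map_mul, map_add] at h
      have h' : q (x _ (-a)) * (1 - q (algebraMap R _ μ) * q (x _ a)) = -q (x _ a) := by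
        linear_combination h
      rw [h']
      exact T.neg_mem ha
  obtain ⟨p, hp⟩ := exists_sub_ofPolynomial_mem_level _ s n
  have hpT : q (ofPolynomial _ p) ∈ T := by
    have : q.comp (ofPolynomial _) = MvPolynomial.aeval fun m : M => q (x _ m) := by
      apply MvPolynomial.algHom_ext
      intro m
      simp [ofPolynomial]
    rw [← AlgHom.comp_apply, this]
    clear hp
    induction p using MvPolynomial.induction_on with
    | C r =>
      rw [MvPolynomial.aeval_C]
      exact T.algebraMap_mem r
    | add f g hf hg =>
      rw [map_add]
      exact T.add_mem hf hg
    | mul_X f m hf =>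
      rw [map_mul, MvPolynomial.aeval_X]
      exact T.mul_mem hf (hx m)
  obtain ⟨r, hr⟩ := hpT
  refine ⟨r, ?_⟩
  rw [← hq0, map_sub]
  have h1 := (hq0 _).2 hp
  rw [map_sub] at h1
  have h2 : q (ofCoord μ b r) = q (ofPolynomial _ p) := hr
  rw [h2, h1]

end Hyperbolic

end FormalGroup

end

/-! ### Regularity, completeness and divisibility; the Demazure operators -/

noncomputable section

namespace FormalGroup

section Divisibility

variable {R : Type*} [CommRing R] (μ : R) {M : Type*} [AddCommGroup M]
  {d : ℕ} (b : Module.Basis (Fin d) ℤ M)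

-- Approximating `f` by a polynomial in the coordinates reduces this to `mem_augIdeal_pow_of_X_mul`:
-- multiplication by a variable raises the filtration by exactly one.
include b in
theorem mem_level_of_x_basis_mul_mem (j : Fin d) {n : ℕ}
    {f : FormalGroupAlgebra (hyperbolic μ (-1)) M}
    (h : x _ (b j) * f ∈ level (hyperbolic μ (-1)) M (n + 1)) :
    f ∈ level (hyperbolic μ (-1)) M n := by
  obtain ⟨p, hp⟩ := exists_sub_ofCoord_mem_level μ b f (n + 1)
  have h1 : ofCoord μ b (MvPolynomial.X j * p) ∈ level (hyperbolic μ (-1)) M (n + 1) := by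
    have e : ofCoord μ b (MvPolynomial.X j * p) = x _ (b j) * f -
        x _ (b j) * (f - ofCoord μ b p) := by
      rw [map_mul, show ofCoord μ b (MvPolynomial.X j) = x _ (b j) from MvPolynomial.aeval_X _ _]
      ring
    rw [e]
    exact sub_mem h (Ideal.mul_mem_left _ _ hp)
  have h2 := coordEval_eq_zero μ b h1
  rw [coordEval_ofCoord, Ideal.Quotient.eq_zero_iff_mem] at h2
  have h3 := ofCoord_mem_level μ b (mem_augIdeal_pow_of_X_mul h2)
  simpa using add_mem (level_antitone _ (Nat.le_succ n) hp) h3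

include b in
theorem x_basis_mul_eq_zero (j : Fin d) {f : FormalGroupAlgebra (hyperbolic μ (-1)) M}
    (h : x _ (b j) * f = 0) : f = 0 :=
  eq_zero_of_forall_mem_level _ fun n =>
    mem_level_of_x_basis_mul_mem μ b j (h ▸ zero_mem (level _ M (n + 1)))

include b in
/-- The formal group algebra is complete. -/
theorem exists_limit (s : ℕ → FormalGroupAlgebra (hyperbolic μ (-1)) M)
    (hs : ∀ n, s (n + 1) - s n ∈ level _ M n) : ∃ l, ∀ n, l - s n ∈ level _ M n := by
  choose p hp using fun n => exists_sub_ofCoord_mem_level μ b (s n) n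
  -- The approximants are Cauchy as polynomials because `coordEval` recovers a polynomial modulo the
  -- `n`-th power of the augmentation ideal. Their limit can therefore be taken in the completed
  -- ring.
  have h1 : ∀ n, p n - p (n + 1) ∈ augIdeal R (Fin d) ^ n := by
    intro n
    have e : ofCoord μ b (p n - p (n + 1)) ∈ level (hyperbolic μ (-1)) M n := by
      have := sub_mem (sub_mem (level_antitone _ (Nat.le_succ n) (hp (n + 1))) (hs n)) (hp n)
      rw [map_sub]
      convert this using 1
      ring
    have h2 := coordEval_eq_zero μ b e
    rwa [coordEval_ofCoord, Ideal.Quotient.eq_zero_iff_mem] at h2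
  have h2 : ∀ n, MvPolynomial.rename b (p n) ≡ MvPolynomial.rename b (p (n + 1))
      [SMOD (augIdeal R M ^ n • ⊤ : Submodule (MvPolynomial M R) (MvPolynomial M R))] := by
    intro n
    rw [SModEq.sub_mem, ← map_sub]
    simpa using augIdeal_pow_le_comap b n (h1 n)
  refine ⟨ofCompleted _ M (AdicCompletion.mk _ _ (AdicCompletion.AdicCauchySequence.mk
    (augIdeal R M) (MvPolynomial M R) (fun n => MvPolynomial.rename b (p n)) h2)), fun n => ?_⟩
  have h3 : ofCompleted (hyperbolic μ (-1)) M (AdicCompletion.mk _ _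
      (AdicCompletion.AdicCauchySequence.mk (augIdeal R M) (MvPolynomial M R)
        (fun n => MvPolynomial.rename b (p n)) h2)) - ofCoord μ b (p n) ∈ level _ M n := by
    rw [ofCoord_eq_ofPolynomial, ofPolynomial_apply, ← map_sub]
    apply ofCompleted_mem_level_of_eval
    rw [map_sub, AdicCompletion.evalₐ_mk, AdicCompletion.evalₐ_of, sub_eq_zero]
    rfl
  simpa using sub_mem h3 (hp n)

theorem x_dvd_x_add_zsmul_sub (a m : M) (z : ℤ) :
    x (hyperbolic μ (-1)) a ∣ x (hyperbolic μ (-1)) (m + z • a) - x (hyperbolic μ (-1)) m := by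
  have h1 : ∀ m, x (hyperbolic μ (-1)) a ∣
      x (hyperbolic μ (-1)) (m + a) - x (hyperbolic μ (-1)) m := fun m => ⟨_, x_add_sub μ m a⟩
  induction z with
  | zero => simp
  | succ n ih =>
    have := dvd_add (h1 (m + (n : ℤ) • a)) ih
    rw [add_zsmul, one_zsmul, ← add_assoc]
    simpa using this
  | pred n ih =>
    have := dvd_sub ih (h1 (m + (-(n : ℤ) - 1) • a))
    rw [sub_zsmul, one_zsmul] at this ⊢
    have e : m + (-(n : ℤ) • a + -a) + a = m + -(n : ℤ) • a := by abel
    rw [e] at this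
    convert this using 1
    ring

/-- Modulo `x_a` the two algebra homomorphisms agree on every variable, hence on all polynomials. -/
theorem x_dvd_ofPolynomial_sub (a : M) {σ : M →+ M} (hσ : ∀ m, ∃ z : ℤ, σ m = m + z • a)
    (p : MvPolynomial M R) :
    x (hyperbolic μ (-1)) a ∣ ofPolynomial (hyperbolic μ (-1)) p -
      algebraMapOfHom (hyperbolic μ (-1)) σ (ofPolynomial (hyperbolic μ (-1)) p) := by
  have h : (Ideal.Quotient.mkₐ R (Ideal.span {x (hyperbolic μ (-1)) a})).comp
        (ofPolynomial (hyperbolic μ (-1))) =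
      (Ideal.Quotient.mkₐ R (Ideal.span {x (hyperbolic μ (-1)) a})).comp
        ((algebraMapOfHom (hyperbolic μ (-1)) σ).comp (ofPolynomial (hyperbolic μ (-1)))) := by
    apply MvPolynomial.algHom_ext
    intro m
    obtain ⟨z, hz⟩ := hσ m
    simp only [AlgHom.comp_apply, ofPolynomial, MvPolynomial.aeval_X, algebraMapOfHom_x]
    rw [← sub_eq_zero, ← map_sub]
    refine Ideal.Quotient.eq_zero_iff_mem.2 (Ideal.mem_span_singleton.2 ?_)
    rw [hz, ← neg_sub, dvd_neg]
    exact x_dvd_x_add_zsmul_sub μ a m z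
  have h2 := DFunLike.congr_fun h p
  simp only [AlgHom.comp_apply] at h2
  rw [← sub_eq_zero, ← map_sub] at h2
  exact Ideal.mem_span_singleton.1 (Ideal.Quotient.eq_zero_iff_mem.1 h2)

include b in
/-- If `σ` is congruent to the identity modulo the element `b j` of a basis, then `x_{b j}`
divides `γ - σ(γ)`. -/
theorem x_basis_dvd_sub (j : Fin d) {σ : M →+ M} (hσ : ∀ m, ∃ z : ℤ, σ m = m + z • b j)
    (γ : FormalGroupAlgebra (hyperbolic μ (-1)) M) :
    x (hyperbolic μ (-1)) (b j) ∣ γ - algebraMapOfHom (hyperbolic μ (-1)) σ γ := by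
  choose p hp using exists_sub_ofPolynomial_mem_level (hyperbolic μ (-1)) γ
  choose η hη using fun n => x_dvd_ofPolynomial_sub μ (b j) hσ (p n)
  have h2 : ∀ n, x (hyperbolic μ (-1)) (b j) * η n -
      (γ - algebraMapOfHom (hyperbolic μ (-1)) σ γ) ∈ level (hyperbolic μ (-1)) M n := by
    intro n
    have := sub_mem (algebraMapOfHom_mem_level _ σ (hp n)) (hp n)
    rw [map_sub] at this
    rw [← hη]
    convert this using 1
    ring
  generalize hδ : γ - algebraMapOfHom (hyperbolic μ (-1)) σ γ = δ at h2 ⊢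
  -- Cancelling `x_{b j}` costs one level, so the approximate quotients are Cauchy only after a
  -- shift of the index.
  have h3 : ∀ n, η (n + 1 + 1) - η (n + 1) ∈ level (hyperbolic μ (-1)) M n := by
    intro n
    apply mem_level_of_x_basis_mul_mem μ b j
    have := sub_mem (level_antitone _ (Nat.le_succ (n + 1)) (h2 (n + 1 + 1))) (h2 (n + 1))
    rw [mul_sub]
    rwa [sub_sub_sub_cancel_right] at this
  obtain ⟨l, hl⟩ := exists_limit μ b (fun n => η (n + 1)) h3
  refine ⟨l, ?_⟩
  rw [← sub_eq_zero]
  apply eq_zero_of_forall_mem_level (hyperbolic μ (-1))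
  intro n
  have := sub_mem (Ideal.mul_mem_left _ (-x (hyperbolic μ (-1)) (b j)) (hl n))
    (level_antitone _ (Nat.le_succ n) (h2 (n + 1)))
  have e : δ - x (hyperbolic μ (-1)) (b j) * l =
      -x (hyperbolic μ (-1)) (b j) * (l - η (n + 1)) -
        (x (hyperbolic μ (-1)) (b j) * η (n + 1) - δ) := by ring
  rw [e]
  exact this

end Divisibility

end FormalGroup

namespace KacMoody.FormalDemazureLattice

open FormalGroup Module

variable {k : Type*} [Field k] {ι : Type*} [Fintype ι] {A : Matrix ι ι ℤ}
  {𝔥 : Type*} [AddCommGroup 𝔥] [Module k 𝔥] {D : Realization k A 𝔥}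
  (Λ : FormalDemazureLattice D) {R : Type*} [CommRing R] {F : MvPowerSeries (Fin 2) R} {μ : R}

theorem latticeAction_realRoot (v w : D.weylGroup) (i : ι) :
    Λ.latticeAction v (Λ.realRoot w i) = Λ.realRoot (v * w) i := by
  simp [realRoot]

theorem fgaAction_x (w : D.weylGroup) (m : Λ.Carrier) :
    Λ.fgaAction F w (x F m) = x F (Λ.latticeAction w m) :=
  algebraMapOfHom_x F (Λ.latticeAction w) m

theorem fgaAction_mul_apply (v w : D.weylGroup) (γ : Λ.FGA F) :
    Λ.fgaAction F (v * w) γ = Λ.fgaAction F v (Λ.fgaAction F w γ) := by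
  rw [map_mul]
  rfl

theorem fgaAction_one_apply (γ : Λ.FGA F) : Λ.fgaAction F 1 γ = γ := by
  rw [map_one]
  rfl

theorem exists_basis_simpleRoot (i : ι) : ∃ (n : ℕ) (b : Basis (Fin n) ℤ Λ.Carrier) (j : Fin n),
    b j = Λ.simpleRoot i := by
  obtain ⟨n, b, j, h⟩ := Λ.exists_basis i
  exact ⟨n, b, j, Subtype.ext h⟩

theorem x_simpleRoot_mul_eq_zero (hF : F = hyperbolic μ (-1)) (i : ι) {γ : Λ.FGA F}
    (h : x F (Λ.simpleRoot i) * γ = 0) : γ = 0 := by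
  subst hF
  obtain ⟨n, b, j, hj⟩ := Λ.exists_basis_simpleRoot i
  rw [← hj] at h
  exact x_basis_mul_eq_zero μ b j h

/-- Applying `w⁻¹` reduces to a simple root, which is part of a basis of the lattice. -/
theorem x_realRoot_mul_eq_zero (hF : F = hyperbolic μ (-1)) (w : D.weylGroup) (i : ι)
    {γ : Λ.FGA F} (h : x F (Λ.realRoot w i) * γ = 0) : γ = 0 := by
  have h1 := congrArg (Λ.fgaAction F w⁻¹) h
  rw [map_mul, map_zero, fgaAction_x, latticeAction_realRoot, inv_mul_cancel] at h1
  have h2 := congrArg (Λ.fgaAction F w) (Λ.x_simpleRoot_mul_eq_zero hF i h1)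
  rwa [map_zero, ← fgaAction_mul_apply, mul_inv_cancel, fgaAction_one_apply] at h2

theorem denominators_le_nonZeroDivisors (hF : F = hyperbolic μ (-1)) :
    Λ.denominators F ≤ nonZeroDivisors (Λ.FGA F) := by
  refine Submonoid.closure_le.2 ?_
  rintro _ ⟨_, ⟨w, i, rfl⟩, rfl⟩
  rw [SetLike.mem_coe, mem_nonZeroDivisors_iff_right]
  intro γ hγ
  rw [mul_comm] at hγ
  exact Λ.x_realRoot_mul_eq_zero hF w i hγ

theorem algebraMap_injective (hF : F = hyperbolic μ (-1)) :
    Function.Injective (algebraMap (Λ.FGA F) (Λ.Q F)) :=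
  IsLocalization.injective (Λ.Q F) (Λ.denominators_le_nonZeroDivisors hF)

theorem exists_latticeAction_s (i : ι) (m : Λ.Carrier) :
    ∃ z : ℤ, Λ.latticeAction (D.s i) m = m + z • Λ.simpleRoot i := by
  obtain ⟨z, hz⟩ := Λ.integral m m.2 i
  refine ⟨-z, Subtype.ext ?_⟩
  change D.reflection i (m : Dual k 𝔥) = (m : Dual k 𝔥) + (-z) • D.simpleRoot i
  rw [D.reflection_apply, hz, Int.cast_smul_eq_zsmul k z (D.simpleRoot i), neg_zsmul,
    sub_eq_add_neg]

/-- The defining property of the Demazure operators. -/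
theorem x_mul_demazureOperator (hF : F = hyperbolic μ (-1)) (i : ι) (γ : Λ.FGA F) :
    x F (Λ.simpleRoot i) * Λ.demazureOperator F i γ = γ - Λ.fgaAction F (D.s i) γ := by
  -- The reflection moves each lattice element by an integral multiple of `α_i`, and `α_i` belongs
  -- to a basis.
  have h : ∃ η, x F (Λ.simpleRoot i) * η = γ - Λ.fgaAction F (D.s i) γ := by
    subst hF
    obtain ⟨n, b, j, hj⟩ := Λ.exists_basis_simpleRoot i
    have hσ : ∀ m, ∃ z : ℤ, Λ.latticeAction (D.s i) m = m + z • b j := by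
      intro m
      rw [hj]
      exact Λ.exists_latticeAction_s i m
    obtain ⟨η, hη⟩ := x_basis_dvd_sub μ b j hσ γ
    rw [hj] at hη
    exact ⟨η, hη.symm⟩
  exact Classical.epsilon_spec h

end KacMoody.FormalDemazureLattice

end

/-! ### Alternating products -/

noncomputable section

/-- The alternating product `⋯ a b` with `n` factors. -/
def alternatingProd {S : Type*} [Monoid S] (a b : S) : ℕ → S
  | 0 => 1
  | n + 1 => alternatingProd b a n * b

namespace alternatingProd

variable {S : Type*} [Monoid S] (a b : S)

theorem prod_alternatingWord {ι : Type*} (f : ι → S) (i j : ι) (n : ℕ) :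
    ((CoxeterSystem.alternatingWord i j n).map f).prod = alternatingProd (f i) (f j) n := by
  induction n generalizing i j with
  | zero => simp [CoxeterSystem.alternatingWord, alternatingProd]
  | succ n ih => simp [CoxeterSystem.alternatingWord_succ, alternatingProd, ih]

theorem mul_alternatingProd (n : ℕ) :
    (Even n → a * alternatingProd b a n = alternatingProd b a (n + 1)) ∧
      (Odd n → a * alternatingProd a b n = alternatingProd a b (n + 1)) := by
  induction n generalizing a b with
  | zero => simp [alternatingProd]
  | succ n ih =>
    refine ⟨fun h => ?_, fun h => ?_⟩
    · have h' : Odd n := by simpa [Nat.even_add_one] using h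
      rw [alternatingProd, ← mul_assoc, (ih a b).2 h']
      rfl
    · have h' : Even n := by simpa [Nat.odd_add_one] using h
      rw [alternatingProd, ← mul_assoc, (ih a b).1 h']
      rfl

/-- A product with prescribed first letter has its last letter determined by the parity of its
length. -/
theorem altProd_eq (n : ℕ) :
    KacMoody.FormalDemazureLattice.altProd a b n =
      if Even n then alternatingProd a b n else alternatingProd b a n := by
  induction n generalizing a b with
  | zero => rfl
  | succ n ih =>
    rw [KacMoody.FormalDemazureLattice.altProd, ih]
    by_cases h : Even n
    · rw [if_pos h, (mul_alternatingProd a b n).1 h, if_neg (by simpa [Nat.even_add_one] using h)]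
    · rw [if_neg h, (mul_alternatingProd a b n).2 (by simpa using h),
        if_pos (by simpa [Nat.even_add_one] using h)]

theorem altProd_comm_iff (n : ℕ) :
    KacMoody.FormalDemazureLattice.altProd a b n = KacMoody.FormalDemazureLattice.altProd b a n ↔
      alternatingProd a b n = alternatingProd b a n := by
  rw [altProd_eq, altProd_eq]
  split_ifs
  · exact Iff.rfl
  · exact eq_comm

end alternatingProd

namespace BraidRelation

open KacMoody

/-! ### Alternating products of elements with `x² = μ x` -/

section Chain

variable {B : Type*} [Ring B]

/-- The elements `x, y x - 1, x y x - 2 x, …` defined by `p_{k + 2}(y, x) = p_{k + 1}(x, y) x -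
p_k(y, x)`. -/
def chain (y x : B) : ℕ → B
  | 0 => 0
  | 1 => x
  | k + 2 => chain x y (k + 1) * x - chain y x k

/-- The difference between `chain` and the alternating product. -/
def chainDefect (t a b : B) : ℕ → B
  | 0 => -1
  | k + 1 => t * (chainDefect t a b k + alternatingProd a b k + alternatingProd b a k)

/-- This symmetry transfers the braid relation between `chain` and the alternating products. -/
theorem chainDefect_comm (t a b : B) (k : ℕ) : chainDefect t a b k = chainDefect t b a k := by
  induction k with
  | zero => rfl
  | succ k ih => rw [chainDefect, chainDefect, ih, add_right_comm]

theorem chainDefect_mul {t a b : B} {t' : B} (ht : ∀ z, t * z = z * t) (htt : t * t' = 1)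
    (hb : b * b = (t' - t) * b + 1) (k : ℕ) :
    chainDefect t a b (k + 1) * b =
      t * alternatingProd a b (k + 1) + alternatingProd a b k + chainDefect t a b k := by
  induction k with
  | zero => simp [chainDefect, alternatingProd]
  | succ k ih =>
    have h1 : alternatingProd a b (k + 1) * b =
        (t' - t) * alternatingProd a b (k + 1) + alternatingProd b a k := by
      -- The inverse of a central element is central.
      have ht' : ∀ z, t' * z = z * t' := by
        intro z
        calc t' * z = t' * z * (t * t') := by rw [htt, mul_one]
          _ = t' * (t * z) * t' := by rw [ht z]; simp only [mul_assoc]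
          _ = t * t' * (z * t') := by rw [ht t']; simp only [mul_assoc]
          _ = z * t' := by rw [htt, one_mul]
      rw [alternatingProd, mul_assoc, hb, mul_add, mul_one, ← mul_assoc, ← mul_assoc, mul_sub,
        sub_mul, sub_mul, ht, ht']
      simp only [sub_mul, mul_assoc]
    have h2 : alternatingProd b a (k + 1) * b = alternatingProd a b (k + 1 + 1) := rfl
    rw [chainDefect, mul_assoc, add_mul, add_mul, ih, h1, h2]
    have h3 : t * ((t' - t) * alternatingProd a b (k + 1)) =
        alternatingProd a b (k + 1) - t * (t * alternatingProd a b (k + 1)) := by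
      rw [sub_mul, mul_sub, ← mul_assoc, htt, one_mul]
    simp only [mul_add, h3]
    rw [show chainDefect t a b (k + 1) =
      t * (chainDefect t a b k + alternatingProd a b k + alternatingProd b a k) from rfl]
    simp only [mul_add]
    abel

/-- As for Kazhdan–Lusztig elements of dihedral groups, `chain` is the alternating product of length
`k` plus shorter alternating products weighted by powers of `t`. The latter are collected in
`chainDefect`, and the recursion for `chain` follows from `chainDefect_mul`. -/
theorem chain_add_eq {t a b : B} {t' : B} (ht : ∀ z, t * z = z * t) (htt : t * t' = 1)
    (ha : a * a = (t' - t) * a + 1) (hb : b * b = (t' - t) * b + 1) (k : ℕ) :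
    chain (a + t) (b + t) k = alternatingProd a b k + chainDefect t a b k := by
  induction k using Nat.strong_induction_on generalizing a b with
  | _ k ih =>
    match k, ih with
    | 0, _ => simp [chain, alternatingProd, chainDefect]
    | 1, _ => simp [chain, alternatingProd, chainDefect]
    | k + 2, ih =>
      rw [chain, ih (k + 1) (by omega) hb ha, ih k (by omega) ha hb, chainDefect_comm t b a,
        add_mul, mul_add, mul_add, chainDefect_mul ht htt hb,
        show alternatingProd b a (k + 1) * b = alternatingProd a b (k + 2) from rfl,
        show chainDefect t a b (k + 2) = t * (chainDefect t a b (k + 1) +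
          alternatingProd a b (k + 1) + alternatingProd b a (k + 1)) from rfl,
        ← ht, ← ht]
      simp only [mul_add]
      abel

theorem alternatingProd_comm_of_chain {t a b : B} {t' : B} (ht : ∀ z, t * z = z * t)
    (htt : t * t' = 1) (ha : a * a = (t' - t) * a + 1) (hb : b * b = (t' - t) * b + 1) {k : ℕ}
    (h : chain (a + t) (b + t) k = chain (b + t) (a + t) k) :
    alternatingProd a b k = alternatingProd b a k := by
  rw [chain_add_eq ht htt ha hb, chain_add_eq ht htt hb ha, chainDefect_comm t b a] at h
  exact add_right_cancel h

end Chain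

/-! ### The coefficients of `chain` in the finite rank two types -/

section Coefficients

variable {Q : Type*} [CommRing Q] (μ : Q)

/-- The coefficients of the elements `chain` in a twisted algebra. -/
def chainCoeff (Y Z : ℕ → Q) : ℕ → ℕ → Q
  | 0, _ => 0
  | 1, n => if n = 0 then Y 0 else 0
  | k + 2, n => Y n * chainCoeff Z Y (k + 1) (n - 1) + (μ - Y n) * chainCoeff Z Y (k + 1) (n + 1) -
      chainCoeff Y Z k n

theorem chainCoeff_zero (Y Z : ℕ → Q) (n : ℕ) : chainCoeff μ Y Z 0 n = 0 := by rw [chainCoeff]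

theorem chainCoeff_one (Y Z : ℕ → Q) (n : ℕ) :
    chainCoeff μ Y Z 1 n = if n = 0 then Y 0 else 0 := by rw [chainCoeff]

theorem chainCoeff_succ_succ (Y Z : ℕ → Q) (k n : ℕ) : chainCoeff μ Y Z (k + 2) n =
    Y n * chainCoeff μ Z Y (k + 1) (n - 1) + (μ - Y n) * chainCoeff μ Z Y (k + 1) (n + 1) -
      chainCoeff μ Y Z k n := by rw [chainCoeff]

theorem chainCoeff_eq_zero (Y Z : ℕ → Q) {k n : ℕ} (h : k ≤ n) : chainCoeff μ Y Z k n = 0 := by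
  induction k using Nat.strong_induction_on generalizing Y Z n with
  | _ k ih =>
    match k, ih with
    | 0, _ => rw [chainCoeff]
    | 1, _ => rw [chainCoeff, if_neg (by omega)]
    | k + 2, ih =>
      rw [chainCoeff, ih (k + 1) (by omega) Z Y (by omega), ih (k + 1) (by omega) Z Y (by omega),
        ih k (by omega) Y Z (by omega)]
      ring

variable {μ}

theorem chainCoeff_two (Y Z : ℕ → Q) (n : ℕ) :
    chainCoeff μ Y Z 2 n = if n - 1 = 0 then Y n * Z 0 else 0 := by
  rw [chainCoeff_succ_succ, chainCoeff_one, chainCoeff_one, chainCoeff_zero,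
    if_neg n.succ_ne_zero]
  split_ifs <;> ring

theorem chainCoeff_three (Y Z : ℕ → Q) (n : ℕ) : chainCoeff μ Y Z 3 n =
    Y n * chainCoeff μ Z Y 2 (n - 1) + (μ - Y n) * chainCoeff μ Z Y 2 (n + 1) -
      chainCoeff μ Y Z 1 n := chainCoeff_succ_succ μ Y Z 1 n

theorem chainCoeff_four (Y Z : ℕ → Q) (n : ℕ) : chainCoeff μ Y Z 4 n =
    Y n * chainCoeff μ Z Y 3 (n - 1) + (μ - Y n) * chainCoeff μ Z Y 3 (n + 1) -
      chainCoeff μ Y Z 2 n := chainCoeff_succ_succ μ Y Z 2 n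

theorem chainCoeff_five (Y Z : ℕ → Q) (n : ℕ) : chainCoeff μ Y Z 5 n =
    Y n * chainCoeff μ Z Y 4 (n - 1) + (μ - Y n) * chainCoeff μ Z Y 4 (n + 1) -
      chainCoeff μ Y Z 3 n := chainCoeff_succ_succ μ Y Z 3 n

theorem chainCoeff_six (Y Z : ℕ → Q) (n : ℕ) : chainCoeff μ Y Z 6 n =
    Y n * chainCoeff μ Z Y 5 (n - 1) + (μ - Y n) * chainCoeff μ Z Y 5 (n + 1) -
      chainCoeff μ Y Z 4 n := chainCoeff_succ_succ μ Y Z 4 n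

theorem chainCoeff_A1A1 {Y Z : ℕ → Q} (e1 : Y 1 = Y 0) (e2 : Z 1 = Z 0) :
    ∀ n < 2, chainCoeff μ Y Z 2 n = Y 0 * Z 0 ∧ chainCoeff μ Z Y 2 n = Y 0 * Z 0 := by
  intro n hn
  interval_cases n <;> simp [chainCoeff_two, e1, e2, mul_comm]

/-- `Y n` and `Z n` stand for `1/x` at the roots reached by alternating words. The hypotheses `e`
record which of these roots coincide, `h1` is the addition law for `α + β`, and the common value is
the product over the positive roots. Types B2 and G2 follow the same pattern. -/
theorem chainCoeff_A2 {Y Z : ℕ → Q} (e1 : Y 1 = Z 1) (e2 : Y 2 = Z 0) (e3 : Z 2 = Y 0)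
    (h1 : Z 1 * (Y 0 + Z 0 - μ) = Y 0 * Z 0 - 1) :
    ∀ n < 3, chainCoeff μ Y Z 3 n = Y 0 * Z 1 * Z 0 ∧
      chainCoeff μ Z Y 3 n = Y 0 * Z 1 * Z 0 := by
  intro n hn
  interval_cases n <;> refine ⟨?_, ?_⟩ <;>
    simp only [chainCoeff_three,
      chainCoeff_two, chainCoeff_one, Nat.reduceAdd, Nat.reduceSub,
      reduceIte, one_ne_zero, OfNat.ofNat_ne_zero, mul_zero, add_zero, sub_zero, zero_add, e1, e2,
      e3]
  · linear_combination Y 0 * ((-1) * h1)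
  · linear_combination Z 0 * ((-1) * h1)
  · ring
  · ring
  · ring
  · ring

theorem chainCoeff_B2 {Y Z : ℕ → Q} (e1 : Y 2 = Y 1) (e2 : Y 3 = Y 0) (e3 : Z 2 = Z 1)
    (e4 : Z 3 = Z 0)
    (h1 : Z 1 * (Y 0 + Z 0 - μ) = Y 0 * Z 0 - 1)
    (h2 : Y 1 * (Z 1 + Z 0 - μ) = Z 1 * Z 0 - 1) :
    ∀ n < 4, chainCoeff μ Y Z 4 n = Y 0 * Y 1 * (Z 0 * Z 1) ∧
      chainCoeff μ Z Y 4 n = Y 0 * Y 1 * (Z 0 * Z 1) := by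
  intro n hn
  interval_cases n <;> refine ⟨?_, ?_⟩ <;>
    simp only [chainCoeff_four, chainCoeff_three,
      chainCoeff_two, chainCoeff_one, Nat.reduceAdd, Nat.reduceSub,
      reduceIte, one_ne_zero, OfNat.ofNat_ne_zero, mul_zero, add_zero, sub_zero, zero_add, e1, e2,
      e3, e4]
  · linear_combination Z 0 * Y 0 * ((-1) * h1 + (-1) * h2)
  · linear_combination Z 0 * Y 0 * ((-1) * h1 + (-1) * h2)
  · linear_combination Z 0 * Y 1 * ((-1) * h1 + (-1) * h2)
  · linear_combination Z 1 * Y 0 * ((-1) * h1 + (-1) * h2)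
  · ring
  · ring
  · ring
  · ring

/-- For `α = Y 0` and `β = Z 0`, the five relations come from `α + β`, `(α + β) + β`, `(α + 2β) +
β`, `(α + 2β) + (α + β)` and `(α + 3β) + α`. The long cofactors certify that the required
differences lie in the ideal they generate. -/
theorem chainCoeff_G2 {Y Z : ℕ → Q} (e1 : Y 3 = Y 2) (e2 : Y 4 = Y 1) (e3 : Y 5 = Y 0)
    (e4 : Z 3 = Z 2) (e5 : Z 4 = Z 1) (e6 : Z 5 = Z 0)
    (h1 : Z 1 * (Y 0 + Z 0 - μ) = Y 0 * Z 0 - 1)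
    (h2 : Z 2 * (Z 1 + Z 0 - μ) = Z 1 * Z 0 - 1)
    (h3 : Y 1 * (Z 2 + Z 0 - μ) = Z 2 * Z 0 - 1)
    (h4 : Y 2 * (Z 2 + Z 1 - μ) = Z 2 * Z 1 - 1)
    (h5 : Y 2 * (Y 1 + Y 0 - μ) = Y 1 * Y 0 - 1) :
    ∀ n < 6, chainCoeff μ Y Z 6 n = Y 0 * Y 1 * Y 2 * (Z 0 * Z 1 * Z 2) ∧
      chainCoeff μ Z Y 6 n = Y 0 * Y 1 * Y 2 * (Z 0 * Z 1 * Z 2) := by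
  intro n hn
  interval_cases n <;> refine ⟨?_, ?_⟩ <;>
    simp only [chainCoeff_six, chainCoeff_five, chainCoeff_four, chainCoeff_three,
      chainCoeff_two, chainCoeff_one, Nat.reduceAdd, Nat.reduceSub,
      reduceIte, one_ne_zero, OfNat.ofNat_ne_zero, mul_zero, add_zero, sub_zero, zero_add, e1, e2,
      e3, e4, e5, e6]
  · linear_combination Z 0 * Y 0 * ((3 + Y 1 * Y 2 - Z 2 * Y 1 + Z 1 * Y 2 + Z 1 * Y 0 + Z 0 * Y 1
      - Z 0 * Y 0 + Z 0 * Z 2 - Z 0 * Z 1 - μ * Y 2 - μ * Y 1 - μ * Z 1) * h1 + (Z 0 * Y 1 - Z 0 *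
      Z 1 - μ * Y 1) * h2 + (1 + Y 0 * Y 2 - Z 1 * Y 2 + Z 0 * Y 1 - Z 0 * Y 0 - μ * Y 1) * h3 +
      (-Y 0 * Y 1 + Z 0 * Y 0 - Z 0 * Z 1) * h4 + (-1) * h5)
  · linear_combination Z 0 * Y 0 * ((3 + Y 1 * Y 2 - Z 2 * Y 1 + Z 1 * Y 2 + Z 1 * Y 0 + Z 0 * Y 1
      - Z 0 * Y 0 + Z 0 * Z 2 - Z 0 * Z 1 - μ * Y 2 - μ * Y 1 - μ * Z 1) * h1 + (Z 0 * Y 1 - Z 0 *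
      Z 1 - μ * Y 1) * h2 + (1 + Y 0 * Y 2 - Z 1 * Y 2 + Z 0 * Y 1 - Z 0 * Y 0 - μ * Y 1) * h3 +
      (-Y 0 * Y 1 + Z 0 * Y 0 - Z 0 * Z 1) * h4 + (-1) * h5)
  · linear_combination Z 0 * Y 1 * ((Y 1 * Y 2 - Z 2 * Y 2 - Z 2 * Y 1 - Z 0 * Y 0 + Z 0 * Z 2) *
      h1 + (-Z 0 * Y 0 + Z 0 * Z 2 - μ * Z 2) * h2 + (4 + Y 0 * Y 2 + Z 2 * Y 2 + Z 2 * Y 1 + Z 0 *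
      Y 1 - 2 * Z 0 * Y 0 + Z 0 * Z 2 - μ * Y 2 - μ * Y 1 - 2 * μ * Z 2) * h3 + (-Y 0 * Y 1 - Z 0 *
      Y 1 + Z 0 * Z 2 + μ * Y 1 - μ * Z 2) * h4 + (-1) * h5)
  · linear_combination Z 1 * Y 0 * ((3 + Y 1 * Y 2 - Z 2 * Y 1 + 2 * Z 1 * Y 2 + Z 1 * Y 0 - Z 0 *
      Y 0 + Z 0 * Z 2 - Z 0 * Z 1 - 2 * μ * Y 2 - μ * Z 1) * h1 + (Z 1 * Y 2 - Z 0 * Z 1 - μ * Y 2)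
      * h2 + (1 + Y 0 * Y 2 - Z 0 * Y 0 - μ * Y 2) * h3 + (-Y 0 * Y 1 + Z 1 * Y 2 - Z 0 * Y 1 + Z 0
      * Y 0 - Z 0 * Z 1 - μ * Y 2 + μ * Y 1) * h4 + (-1) * h5)
  · linear_combination Z 0 * Z 1 * Y 0 * Y 2 * ((-1) * h1 + (-1) * h2 + (-1) * h3 + (-1) * h4)
  · linear_combination Z 0 * Z 2 * Y 0 * Y 1 * ((-1) * h1 + (-1) * h2 + (-1) * h3 + (-1) * h4)
  · linear_combination Z 0 * Z 2 * Y 1 * Y 2 * ((-1) * h1 + (-1) * h2 + (-1) * h3 + (-1) * h4)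
  · linear_combination Z 1 * Z 2 * Y 0 * Y 2 * ((-1) * h1 + (-1) * h2 + (-1) * h3 + (-1) * h4)
  · ring
  · ring
  · ring
  · ring

end Coefficients

/-! ### Expansion of `chain` in a twisted algebra -/

section Twisted

variable {Q B : Type*} [CommRing Q] [Ring B] {μ : Q} {q : Q →+* B} {Y Z : ℕ → Q} {x y : B}
  {ε ε' : ℕ → B}

/-- Right multiplication by `x` sends the `ε'` with index `n + 1` to a combination of the `ε` with
indices `n` and `n + 2`, so the recursion for `chain` becomes the recursion defining `chainCoeff`.
-/
theorem chain_eq_sum (hx : x = q (Y 0) * ε 0) (hy : y = q (Z 0) * ε' 0)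
    (hx0 : ε' 0 * x = q (Y 0) * ε 0 + q (Y 1) * ε 1)
    (hy0 : ε 0 * y = q (Z 0) * ε' 0 + q (Z 1) * ε' 1)
    (hxs : ∀ n, ε' (n + 1) * x = q (μ - Y n) * ε n + q (Y (n + 2)) * ε (n + 2))
    (hys : ∀ n, ε (n + 1) * y = q (μ - Z n) * ε' n + q (Z (n + 2)) * ε' (n + 2)) (k : ℕ) :
    chain y x k = ∑ n ∈ Finset.range k, q (chainCoeff μ Y Z k n) * ε n := by
  induction k using Nat.strong_induction_on generalizing Y Z x y ε ε' with
  | _ k ih =>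
    match k, ih with
    | 0, _ => simp [chain]
    | 1, _ => simp [chain, chainCoeff, hx]
    | k + 2, ih =>
      rw [chain, ih (k + 1) (by omega) hy hx hy0 hx0 hys hxs,
        ih k (by omega) hx hy hx0 hy0 hxs hys]
      have c0 : ∀ n, k + 1 ≤ n → chainCoeff μ Z Y (k + 1) n = 0 :=
        fun n => chainCoeff_eq_zero μ Z Y
      have c1 : ∀ n, k ≤ n → chainCoeff μ Y Z k n = 0 := fun n => chainCoeff_eq_zero μ Y Z
      have e1 : ∑ n ∈ Finset.range (k + 2), q (chainCoeff μ Y Z k n) * ε n =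
          ∑ n ∈ Finset.range k, q (chainCoeff μ Y Z k n) * ε n := by
        rw [Finset.sum_range_succ, Finset.sum_range_succ, c1 k le_rfl, c1 (k + 1) (by omega)]
        simp
      have e2 : ∑ n ∈ Finset.range (k + 2),
          q ((μ - Y n) * chainCoeff μ Z Y (k + 1) (n + 1)) * ε n =
          ∑ n ∈ Finset.range k, q (chainCoeff μ Z Y (k + 1) (n + 1)) * (q (μ - Y n) * ε n) := by
        rw [Finset.sum_range_succ, Finset.sum_range_succ, c0 (k + 1) le_rfl,
          c0 (k + 1 + 1) (by omega)]
        simp only [mul_zero, map_zero, zero_mul, add_zero]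
        refine Finset.sum_congr rfl fun n _ => ?_
        rw [mul_comm (μ - Y n), map_mul, mul_assoc]
      -- The natural subtraction `n - 1` is `0` for both `n = 0` and `n = 1`. This is intended: `ε'
      -- 0 * x` contributes to both `ε 0` and `ε 1`.
      have e3 : ∑ n ∈ Finset.range (k + 2), q (Y n * chainCoeff μ Z Y (k + 1) (n - 1)) * ε n =
          (∑ n ∈ Finset.range k, q (chainCoeff μ Z Y (k + 1) (n + 1)) *
            (q (Y (n + 2)) * ε (n + 2))) +
          q (chainCoeff μ Z Y (k + 1) 0) * (q (Y 0) * ε 0 + q (Y 1) * ε 1) := by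
        rw [Finset.sum_range_succ', Finset.sum_range_succ', add_assoc]
        congr 1
        · refine Finset.sum_congr rfl fun n _ => ?_
          rw [mul_comm (Y _), map_mul, mul_assoc]
          rfl
        · simp only [mul_comm (Y _), map_mul, mul_assoc, mul_add]
          exact add_comm _ _
      have e4 : ∑ n ∈ Finset.range (k + 2), q (chainCoeff μ Y Z (k + 2) n) * ε n =
          (∑ n ∈ Finset.range (k + 2), q (Y n * chainCoeff μ Z Y (k + 1) (n - 1)) * ε n) +
          (∑ n ∈ Finset.range (k + 2),
            q ((μ - Y n) * chainCoeff μ Z Y (k + 1) (n + 1)) * ε n) -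
          ∑ n ∈ Finset.range (k + 2), q (chainCoeff μ Y Z k n) * ε n := by
        rw [← Finset.sum_add_distrib, ← Finset.sum_sub_distrib]
        refine Finset.sum_congr rfl fun n _ => ?_
        rw [chainCoeff, map_sub, map_add, sub_mul, add_mul]
      rw [e4, e1, e2, e3, Finset.sum_range_succ', add_mul, Finset.sum_mul]
      simp only [mul_assoc, hxs, hx0, mul_add, Finset.sum_add_distrib]
      abel

/-- With constant coefficients both chains are the same multiple of one symmetric sum. -/
theorem chain_comm_of_chainCoeff (hx : x = q (Y 0) * ε 0) (hy : y = q (Z 0) * ε' 0)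
    (hx0 : ε' 0 * x = q (Y 0) * ε 0 + q (Y 1) * ε 1)
    (hy0 : ε 0 * y = q (Z 0) * ε' 0 + q (Z 1) * ε' 1)
    (hxs : ∀ n, ε' (n + 1) * x = q (μ - Y n) * ε n + q (Y (n + 2)) * ε (n + 2))
    (hys : ∀ n, ε (n + 1) * y = q (μ - Z n) * ε' n + q (Z (n + 2)) * ε' (n + 2)) {k : ℕ} {c : Q}
    (hc : ∀ n < k, chainCoeff μ Y Z k n = c ∧ chainCoeff μ Z Y k n = c)
    (hε : ∑ n ∈ Finset.range k, ε n = ∑ n ∈ Finset.range k, ε' n) :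
    chain y x k = chain x y k := by
  rw [chain_eq_sum hx hy hx0 hy0 hxs hys, chain_eq_sum hy hx hy0 hx0 hys hxs,
    Finset.sum_congr rfl fun n hn => by rw [(hc n (Finset.mem_range.1 hn)).1],
    ← Finset.mul_sum, hε, Finset.mul_sum]
  exact Finset.sum_congr rfl fun n hn => by rw [(hc n (Finset.mem_range.1 hn)).2]

/-- Alternating sums over the two alternating words. -/
theorem sum_range_alternating {u v : ℕ → B} {k : ℕ} (h0 : u 0 = v 0) (hk : u k = v k) :
    ∑ n ∈ Finset.range k, (-1) ^ n * (u n - v (n + 1)) =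
      ∑ n ∈ Finset.range k, (-1) ^ n * (v n - u (n + 1)) := by
  have h : ∀ w : ℕ → B, ∑ n ∈ Finset.range k, (-1) ^ n * (w n + w (n + 1)) =
      w 0 - (-1) ^ k * w k := by
    intro w
    clear hk
    induction k with
    | zero => simp
    | succ k ih =>
      rw [Finset.sum_range_succ, ih, pow_succ]
      noncomm_ring
  rw [← sub_eq_zero, ← Finset.sum_sub_distrib]
  have e : ∀ n, (-1 : B) ^ n * (u n - v (n + 1)) - (-1) ^ n * (v n - u (n + 1)) =
      (-1) ^ n * (u n + u (n + 1)) - (-1) ^ n * (v n + v (n + 1)) := by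
    intro n
    noncomm_ring
  simp only [e]
  rw [Finset.sum_sub_distrib, h, h, h0, hk, sub_self]

end Twisted

end BraidRelation

end

/-! ### Reciprocals of the `x_α` at real roots in rank two -/

noncomputable section

namespace KacMoody

/-- The coefficients for the rank two root systems with `a = 0, b = 0` or `a = 1`, `b = 1, 2, 3`. -/
theorem chainCoeff_altRoot_of_le {Q : Type*} [CommRing Q] {μ : Q} {f : ℤ × ℤ → Q}
    {U : ℤ × ℤ → Prop}
    (hf : ∀ c d e, c + d = e → U c → U d → U e → f e * (f c + f d - μ) = f c * f d - 1)
    {a b : ℤ} {m : ℕ} (h : (a = 0 ∧ b = 0 ∧ m = 2) ∨ (a = 1 ∧ b = 1 ∧ m = 3) ∨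
      (a = 1 ∧ b = 2 ∧ m = 4) ∨ (a = 1 ∧ b = 3 ∧ m = 6)) {Y Z : ℕ → Q}
    (hY : ∀ n, Y n = f (altRoot a b n)) (hZ : ∀ n, Z n = f (altRoot b a n).swap)
    (UY : ∀ n, U (altRoot a b n)) (UZ : ∀ n, U (altRoot b a n).swap) :
    ∃ c, ∀ n < m, BraidRelation.chainCoeff μ Y Z m n = c ∧
      BraidRelation.chainCoeff μ Z Y m n = c := by
  have eqY : ∀ n n', altRoot a b n = altRoot a b n' → Y n = Y n' := by
    intro n n' e
    rw [hY, hY, e]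
  have eqZ : ∀ n n', altRoot b a n = altRoot b a n' → Z n = Z n' := by
    intro n n' e
    rw [hZ, hZ, e]
  have eqYZ : ∀ n n', altRoot a b n = (altRoot b a n').swap → Y n = Z n' := by
    intro n n' e
    rw [hY, hZ, e]
  rcases h with ⟨rfl, rfl, rfl⟩ | ⟨rfl, rfl, rfl⟩ | ⟨rfl, rfl, rfl⟩ | ⟨rfl, rfl, rfl⟩
  · exact ⟨_, BraidRelation.chainCoeff_A1A1 (eqY 1 0 (by decide)) (eqZ 1 0 (by decide))⟩
  · refine ⟨_, BraidRelation.chainCoeff_A2 (eqYZ 1 1 (by decide)) (eqYZ 2 0 (by decide))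
      (eqYZ 0 2 (by decide)).symm ?_⟩
    rw [hY, hZ, hZ]
    exact hf _ _ _ (by decide) (UY 0) (UZ 0) (UZ 1)
  · refine ⟨_, BraidRelation.chainCoeff_B2 (eqY 2 1 (by decide)) (eqY 3 0 (by decide))
      (eqZ 2 1 (by decide)) (eqZ 3 0 (by decide)) ?_ ?_⟩ <;> simp only [hY, hZ]
    · exact hf _ _ _ (by decide) (UY 0) (UZ 0) (UZ 1)
    · exact hf _ _ _ (by decide) (UZ 1) (UZ 0) (UY 1)
  · refine ⟨_, BraidRelation.chainCoeff_G2 (eqY 3 2 (by decide)) (eqY 4 1 (by decide))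
      (eqY 5 0 (by decide)) (eqZ 3 2 (by decide)) (eqZ 4 1 (by decide)) (eqZ 5 0 (by decide))
      ?_ ?_ ?_ ?_ ?_⟩ <;> simp only [hY, hZ]
    · exact hf _ _ _ (by decide) (UY 0) (UZ 0) (UZ 1)
    · exact hf _ _ _ (by decide) (UZ 1) (UZ 0) (UZ 2)
    · exact hf _ _ _ (by decide) (UZ 2) (UZ 0) (UY 1)
    · exact hf _ _ _ (by decide) (UZ 2) (UZ 1) (UY 2)
    · exact hf _ _ _ (by decide) (UY 1) (UY 0) (UY 2)

/-- The coefficients for the rank two root systems of finite type. -/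
theorem chainCoeff_altRoot {Q : Type*} [CommRing Q] {μ : Q} {f : ℤ × ℤ → Q} {U : ℤ × ℤ → Prop}
    (hf : ∀ c d e, c + d = e → U c → U d → U e → f e * (f c + f d - μ) = f c * f d - 1)
    {a b : ℤ} {m : ℕ} (h : (a = 0 ∧ b = 0 ∧ m = 2) ∨ (a = 1 ∧ b = 1 ∧ m = 3) ∨
      (a = 1 ∧ b = 2 ∧ m = 4) ∨ (a = 2 ∧ b = 1 ∧ m = 4) ∨ (a = 1 ∧ b = 3 ∧ m = 6) ∨
      (a = 3 ∧ b = 1 ∧ m = 6)) {Y Z : ℕ → Q}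
    (hY : ∀ n, Y n = f (altRoot a b n)) (hZ : ∀ n, Z n = f (altRoot b a n).swap)
    (UY : ∀ n, U (altRoot a b n)) (UZ : ∀ n, U (altRoot b a n).swap) :
    ∃ c, ∀ n < m, BraidRelation.chainCoeff μ Y Z m n = c ∧
      BraidRelation.chainCoeff μ Z Y m n = c := by
  have key : ∀ (a b : ℤ) (Y Z : ℕ → Q) (f : ℤ × ℤ → Q) (U : ℤ × ℤ → Prop),
      (∀ c d e, c + d = e → U c → U d → U e → f e * (f c + f d - μ) = f c * f d - 1) →
      (∀ n, Y n = f (altRoot a b n)) → (∀ n, Z n = f (altRoot b a n).swap) →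
      (∀ n, U (altRoot a b n)) → (∀ n, U (altRoot b a n).swap) →
      ((a = 0 ∧ b = 0 ∧ m = 2) ∨ (a = 1 ∧ b = 1 ∧ m = 3) ∨
        (a = 1 ∧ b = 2 ∧ m = 4) ∨ (a = 1 ∧ b = 3 ∧ m = 6)) →
      ∃ c, ∀ n < m, BraidRelation.chainCoeff μ Y Z m n = c ∧
        BraidRelation.chainCoeff μ Z Y m n = c :=
    fun a b Y Z f U hf hY hZ UY UZ h => chainCoeff_altRoot_of_le hf h hY hZ UY UZ
  -- Exchanging the two simple roots reduces the cases `a > b` to those with `a < b`.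
  have key' : ((b = 0 ∧ a = 0 ∧ m = 2) ∨ (b = 1 ∧ a = 1 ∧ m = 3) ∨
        (b = 1 ∧ a = 2 ∧ m = 4) ∨ (b = 1 ∧ a = 3 ∧ m = 6)) →
      ∃ c, ∀ n < m, BraidRelation.chainCoeff μ Y Z m n = c ∧
        BraidRelation.chainCoeff μ Z Y m n = c := by
    intro h'
    obtain ⟨c, hc⟩ := key b a Z Y (fun c => f c.swap) (fun c => U c.swap)
      (fun c d e h => hf _ _ _ (by rw [← Prod.swap_add, h])) hZ hY UZ UY h'
    exact ⟨c, fun n hn => (hc n hn).symm⟩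
  rcases h with h | h | h | h | h | h
  · exact key a b Y Z f U hf hY hZ UY UZ (Or.inl h)
  · exact key a b Y Z f U hf hY hZ UY UZ (Or.inr (Or.inl h))
  · exact key a b Y Z f U hf hY hZ UY UZ (Or.inr (Or.inr (Or.inl h)))
  · exact key' (Or.inr (Or.inr (Or.inl ⟨h.2.1, h.1, h.2.2⟩)))
  · exact key a b Y Z f U hf hY hZ UY UZ (Or.inr (Or.inr (Or.inr h)))
  · exact key' (Or.inr (Or.inr (Or.inr ⟨h.2.1, h.1, h.2.2⟩)))

namespace FormalDemazureLattice

open FormalGroup Module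

variable {k : Type*} [Field k] {ι : Type*} [Fintype ι] {A : Matrix ι ι ℤ}
  {𝔥 : Type*} [AddCommGroup 𝔥] [Module k 𝔥] {D : Realization k A 𝔥}
  (Λ : FormalDemazureLattice D) {R : Type*} [CommRing R] (F : MvPowerSeries (Fin 2) R) {μ : R}

/-- The inverse of `x_λ` in `Q^F`, for `λ` a real root. -/
def recipX (m : Λ.Carrier) : Λ.Q F := Ring.inverse (algebraMap (Λ.FGA F) (Λ.Q F) (x F m))

theorem realRoot_mem_realRoots (w : D.weylGroup) (i : ι) : Λ.realRoot w i ∈ Λ.realRoots :=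
  ⟨w, i, rfl⟩

theorem latticeAction_mem_realRoots (w : D.weylGroup) {m : Λ.Carrier} (hm : m ∈ Λ.realRoots) :
    Λ.latticeAction w m ∈ Λ.realRoots := by
  obtain ⟨v, i, rfl⟩ := hm
  rw [latticeAction_realRoot]
  exact Λ.realRoot_mem_realRoots _ _

theorem realRoot_mul_s (w : D.weylGroup) (i : ι) :
    Λ.realRoot (w * D.s i) i = -Λ.realRoot w i := by
  apply Subtype.ext
  change D.weylAction (w * D.s i) (D.simpleRoot i) = -(D.weylAction w (D.simpleRoot i))
  rw [Realization.weylAction_mul_apply, Realization.weylAction_s_self, map_neg]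

theorem neg_mem_realRoots {m : Λ.Carrier} (hm : m ∈ Λ.realRoots) : -m ∈ Λ.realRoots := by
  obtain ⟨v, i, rfl⟩ := hm
  rw [← realRoot_mul_s]
  exact Λ.realRoot_mem_realRoots _ _

variable {Λ}

theorem isUnit_algebraMap_x {m : Λ.Carrier} (hm : m ∈ Λ.realRoots) :
    IsUnit (algebraMap (Λ.FGA F) (Λ.Q F) (x F m)) :=
  IsLocalization.map_units (Λ.Q F)
    (⟨x F m, Submonoid.subset_closure ⟨m, hm, rfl⟩⟩ : Λ.denominators F)

theorem recipX_mul {m : Λ.Carrier} (hm : m ∈ Λ.realRoots) :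
    Λ.recipX F m * algebraMap (Λ.FGA F) (Λ.Q F) (x F m) = 1 :=
  Ring.inverse_mul_cancel _ (isUnit_algebraMap_x F hm)

theorem invX_eq (w : D.weylGroup) (i : ι) : Λ.invX F w i = Λ.recipX F (Λ.realRoot w i) := by
  apply (isUnit_algebraMap_x F (Λ.realRoot_mem_realRoots w i)).mul_right_cancel
  rw [recipX_mul F (Λ.realRoot_mem_realRoots w i)]
  exact (IsLocalization.mk'_spec (Λ.Q F) (1 : Λ.FGA F) _).trans (map_one _)

theorem smul_recipX (w : D.weylGroup) {m : Λ.Carrier} (hm : m ∈ Λ.realRoots) :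
    w • Λ.recipX F m = Λ.recipX F (Λ.latticeAction w m) := by
  have hm' := Λ.latticeAction_mem_realRoots w hm
  apply (isUnit_algebraMap_x F hm').mul_right_cancel
  rw [recipX_mul F hm', ← fgaAction_x, ← weyl_smul_algebraMap, ← smul_mul', recipX_mul F hm,
    smul_one]

variable {F}

theorem algebraMap_scalar (r : R) :
    algebraMap (Λ.FGA F) (Λ.Q F) (algebraMap R (Λ.FGA F) r) = algebraMap R (Λ.Q F) r := rfl

/-- Divide `x_m + x_{-m} = μ x_m x_{-m}` by the product `x_m x_{-m}`. -/
theorem recipX_neg (hF : F = hyperbolic μ (-1)) {m : Λ.Carrier} (hm : m ∈ Λ.realRoots) :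
    Λ.recipX F (-m) = algebraMap R (Λ.Q F) μ - Λ.recipX F m := by
  have h : x F m + x F (-m) = algebraMap R _ μ * (x F m * x F (-m)) := by
    subst hF
    exact x_add_x_neg μ m
  have h1 := congrArg (algebraMap (Λ.FGA F) (Λ.Q F)) h
  simp only [map_add, map_mul, algebraMap_scalar] at h1
  have h2 := recipX_mul F hm
  have h3 := recipX_mul F (Λ.neg_mem_realRoots hm)
  linear_combination Λ.recipX F m * Λ.recipX F (-m) * h1 + (-Λ.recipX F (-m) +
    algebraMap R (Λ.Q F) μ * (algebraMap (Λ.FGA F) (Λ.Q F) (x F (-m)) * Λ.recipX F (-m))) * h2 +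
    (algebraMap R (Λ.Q F) μ - Λ.recipX F m) * h3

/-- Divide the cleared addition law by `x_a x_b x_c`. All three must be real roots, since only these
become invertible. -/
theorem recipX_add (hF : F = hyperbolic μ (-1)) {a b c : Λ.Carrier} (habc : a + b = c)
    (ha : a ∈ Λ.realRoots) (hb : b ∈ Λ.realRoots) (hc : c ∈ Λ.realRoots) :
    Λ.recipX F c * (Λ.recipX F a + Λ.recipX F b - algebraMap R (Λ.Q F) μ) =
      Λ.recipX F a * Λ.recipX F b - 1 := by
  have h : x F c * (1 - x F a * x F b) = x F a + x F b - algebraMap R _ μ * (x F a * x F b) := by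
    subst hF habc
    exact x_add μ a b
  have h1 := congrArg (algebraMap (Λ.FGA F) (Λ.Q F)) h
  simp only [map_add, map_sub, map_one, map_mul, algebraMap_scalar] at h1
  have h2 := recipX_mul F ha
  have h3 := recipX_mul F hb
  have h4 := recipX_mul F hc
  generalize Λ.recipX F a = ya at *
  generalize Λ.recipX F b = yb at *
  generalize Λ.recipX F c = yc at *
  generalize algebraMap (Λ.FGA F) (Λ.Q F) (x F a) = xa at *
  generalize algebraMap (Λ.FGA F) (Λ.Q F) (x F b) = xb at *
  generalize algebraMap (Λ.FGA F) (Λ.Q F) (x F c) = xc at *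
  generalize algebraMap R (Λ.Q F) μ = ν at *
  have e : ya * xa * (yb * xb) = 1 := by rw [h2, h3, one_mul]
  linear_combination (-ya * yb * yc) * h1 + (ya * yb - ya * xa * (yb * xb)) * h4 - yc * yb * h2 -
    yc * ya * h3 + (yc * ν - 1) * e

end FormalDemazureLattice

end KacMoody

end

/-! ### Demazure elements and their braid relation -/

noncomputable section

namespace BraidRelation

variable {B : Type*} [Ring B]

theorem sign_mul_one_sub_mul (n : ℕ) {v d w q z x : B} (hw : v * d = w) (hx : w * x = q * z) :
    ((-1) ^ n * (v * (1 - d))) * x = (-1) ^ n * (v * x) + q * ((-1) ^ (n + 1) * z) := by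
  rw [mul_sub, mul_one, hw, mul_assoc, sub_mul, hx]
  rcases neg_one_pow_eq_or B n with h | h <;> rw [pow_succ, h] <;> noncomm_ring

theorem sign_succ_mul (n : ℕ) {v q z x : B} (hx : v * x = -(q * z)) :
    (-1) ^ (n + 1) * (v * x) = q * ((-1) ^ n * z) := by
  rw [hx]
  rcases neg_one_pow_eq_or B n with h | h <;> rw [pow_succ, h] <;> noncomm_ring

end BraidRelation

namespace KacMoody.FormalDemazureLattice

open FormalGroup Module BraidRelation

variable {k : Type*} [Field k] {ι : Type*} [Fintype ι] {A : Matrix ι ι ℤ}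
  {𝔥 : Type*} [AddCommGroup 𝔥] [Module k 𝔥] {D : Realization k A 𝔥}
  (Λ : FormalDemazureLattice D) {R : Type*} [CommRing R] (F : MvPowerSeries (Fin 2) R) {μ : R}

/-- The elements `δ_w` of the twisted algebra. -/
def delta : D.weylGroup →* Λ.TwistedAlgebra F where
  toFun w := SkewMonoidAlgebra.single w 1
  map_one' := rfl
  map_mul' v w := by rw [SkewMonoidAlgebra.single_mul_single, smul_one, one_mul]

variable {Λ F}

theorem delta_mul_qToTwisted (w : D.weylGroup) (q : Λ.Q F) :
    Λ.delta F w * Λ.qToTwisted F q = Λ.qToTwisted F (w • q) * Λ.delta F w := by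
  change SkewMonoidAlgebra.single w 1 * SkewMonoidAlgebra.single 1 q =
    SkewMonoidAlgebra.single 1 (w • q) * SkewMonoidAlgebra.single w 1
  rw [SkewMonoidAlgebra.single_mul_single, SkewMonoidAlgebra.single_mul_single, one_mul, mul_one,
    one_mul, smul_one, mul_one]

theorem qToTwisted_mul_delta (q : Λ.Q F) (w : D.weylGroup) :
    Λ.qToTwisted F q * Λ.delta F w = SkewMonoidAlgebra.single w q := by
  change SkewMonoidAlgebra.single 1 q * SkewMonoidAlgebra.single w 1 = _
  rw [SkewMonoidAlgebra.single_mul_single, one_mul, smul_one, mul_one]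

theorem algebraMap_twisted (r : R) : algebraMap R (Λ.TwistedAlgebra F) r =
    Λ.qToTwisted F (algebraMap R (Λ.Q F) r) := rfl

theorem delta_s_mul_delta_s (i : ι) : Λ.delta F (D.s i) * Λ.delta F (D.s i) = 1 := by
  rw [← map_mul, D.s_mul_s, map_one]

theorem demazureElement_eq (w : D.weylGroup) (i : ι) : Λ.demazureElement F w i =
    Λ.qToTwisted F (Λ.recipX F (Λ.realRoot w i)) * (1 - Λ.delta F (w * D.s i * w⁻¹)) := by
  rw [demazureElement, invX_eq]
  rfl

theorem demazureElement_one (i : ι) : Λ.demazureElement F 1 i =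
    Λ.qToTwisted F (Λ.recipX F (Λ.simpleRoot i)) * (1 - Λ.delta F (D.s i)) := by
  rw [demazureElement_eq, one_mul, inv_one, mul_one]

/-- Arbitrary real roots are thereby reduced to simple ones, at the cost of the elements `δ_w`. -/
theorem demazureElement_conj (w : D.weylGroup) (i : ι) : Λ.demazureElement F w i =
    Λ.delta F w * Λ.demazureElement F 1 i * Λ.delta F w⁻¹ := by
  have h : 1 - Λ.delta F (w * D.s i * w⁻¹) =
      Λ.delta F w * (1 - Λ.delta F (D.s i)) * Λ.delta F w⁻¹ := by
    rw [mul_sub, sub_mul, mul_one, ← map_mul, ← map_mul, ← map_mul, mul_inv_cancel, map_one]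
  rw [demazureElement_eq, demazureElement_one, ← mul_assoc, delta_mul_qToTwisted,
    smul_recipX F w (Λ.realRoot_mem_realRoots 1 i), latticeAction_realRoot, mul_one, h]
  simp only [mul_assoc]

theorem delta_mul_demazureElement (w : D.weylGroup) (i : ι) :
    Λ.delta F w * Λ.demazureElement F 1 i = Λ.qToTwisted F (Λ.recipX F (Λ.realRoot w i)) *
      (Λ.delta F w * (1 - Λ.delta F (D.s i))) := by
  rw [demazureElement_one, ← mul_assoc, delta_mul_qToTwisted,
    smul_recipX F w (Λ.realRoot_mem_realRoots 1 i), latticeAction_realRoot, mul_one, mul_assoc]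

theorem delta_s_mul_one_sub (w : D.weylGroup) (i : ι) :
    Λ.delta F (w * D.s i) * (1 - Λ.delta F (D.s i)) =
      -(Λ.delta F w * (1 - Λ.delta F (D.s i))) := by
  rw [map_mul, mul_sub, mul_one, mul_assoc, delta_s_mul_delta_s]
  noncomm_ring

/-- The trailing `s_i` changes the sign of the root and of `1 - δ_{s_i}`; the first sign turns the
reciprocal into `μ` minus itself. -/
theorem delta_mul_s_mul_demazureElement (hF : F = hyperbolic μ (-1)) (w : D.weylGroup) (i : ι) :
    Λ.delta F (w * D.s i) * Λ.demazureElement F 1 i =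
      -(Λ.qToTwisted F (algebraMap R (Λ.Q F) μ - Λ.recipX F (Λ.realRoot w i)) *
        (Λ.delta F w * (1 - Λ.delta F (D.s i)))) := by
  rw [delta_mul_demazureElement, delta_s_mul_one_sub, realRoot_mul_s,
    recipX_neg hF (Λ.realRoot_mem_realRoots w i), mul_neg]

/-- In `(1 - δ_{s_i}) X_i` the reciprocals at `α_i` and `-α_i` add up to `μ`. -/
theorem demazureElement_mul_self (hF : F = hyperbolic μ (-1)) (i : ι) :
    Λ.demazureElement F 1 i * Λ.demazureElement F 1 i =
      algebraMap R _ μ * Λ.demazureElement F 1 i := by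
  have h1 := Λ.delta_mul_demazureElement (F := F) 1 i
  have h2 := Λ.delta_mul_s_mul_demazureElement hF 1 i
  rw [map_one, one_mul] at h1
  rw [one_mul, map_one, one_mul] at h2
  have h3 : (1 - Λ.delta F (D.s i)) * Λ.demazureElement F 1 i =
      algebraMap R _ μ * (1 - Λ.delta F (D.s i)) := by
    rw [sub_mul, one_mul, h2, h1, one_mul, sub_neg_eq_add, ← add_mul, ← map_add,
      add_sub_cancel, algebraMap_twisted]
  conv_lhs => enter [1]; rw [demazureElement_one]
  rw [mul_assoc, h3, ← mul_assoc, ← Algebra.commutes, mul_assoc, ← demazureElement_one]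

theorem realRoot_alternatingProd (i j : ι) (n : ℕ) :
    Λ.realRoot (alternatingProd (D.s i) (D.s j) n) i =
      (altRoot (-A i j) (-A j i) n).1 • Λ.simpleRoot i +
        (altRoot (-A i j) (-A j i) n).2 • Λ.simpleRoot j := by
  apply Subtype.ext
  have h := D.weylAction_alternatingWord i j n
  rw [alternatingProd.prod_alternatingWord] at h
  exact h

/-- Both sides rearrange to `∑ (-1)^ℓ(w) δ_w` over the dihedral group. The two alternating words of
length `m` agree in the Weyl group, so the top term is shared. -/
theorem sum_delta_alternating [CharZero k] (i j : ι) {m : ℕ} (hm : m = orderOf (D.s i * D.s j)) :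
    ∑ n ∈ Finset.range m, (-1) ^ n *
        (Λ.delta F (alternatingProd (D.s i) (D.s j) n) * (1 - Λ.delta F (D.s i))) =
      ∑ n ∈ Finset.range m, (-1) ^ n *
        (Λ.delta F (alternatingProd (D.s j) (D.s i) n) * (1 - Λ.delta F (D.s j))) := by
  have e : ∀ (a b : D.weylGroup) (n : ℕ),
      Λ.delta F (alternatingProd a b n) * (1 - Λ.delta F a) =
        Λ.delta F (alternatingProd a b n) - Λ.delta F (alternatingProd b a (n + 1)) := by
    intro a b n
    rw [mul_sub, mul_one, ← map_mul]
    rfl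
  simp only [e]
  refine sum_range_alternating (u := fun n => Λ.delta F (alternatingProd (D.s i) (D.s j) n))
    (v := fun n => Λ.delta F (alternatingProd (D.s j) (D.s i) n)) rfl ?_
  have h := D.coxeterSystem.wordProd_braidWord_eq i j
  have e1 : ∀ i j : ι, D.coxeterSystem.wordProd (CoxeterSystem.braidWord D.coxeterMatrix i j) =
      alternatingProd (D.s i) (D.s j) (orderOf (D.s i * D.s j)) := by
    intro i j
    rw [CoxeterSystem.wordProd, CoxeterSystem.braidWord]
    simp only [Realization.coxeterMatrix_apply]
    rw [← alternatingProd.prod_alternatingWord]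
    congr 2
  have e2 : orderOf (D.s j * D.s i) = orderOf (D.s i * D.s j) :=
    D.coxeterMatrix.symmetric j i
  rw [e1, e1, e2, ← hm] at h
  exact congrArg (Λ.delta F) h

/-- The elements `(-1)^n δ_w (1 - δ_{s_i})`, where `w` is the alternating word of length `n` in
`s_i` and `s_j` which ends in `s_j`. -/
def signedDelta (i j : ι) (n : ℕ) : Λ.TwistedAlgebra F :=
  (-1) ^ n * (Λ.delta F (alternatingProd (D.s i) (D.s j) n) * (1 - Λ.delta F (D.s i)))

/-- The elements `1 / x_{w(α_i)}`, where `w` is the alternating word of length `n` in `s_i` and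
`s_j` which ends in `s_j`. -/
def alternatingRecip (Λ : FormalDemazureLattice D) (F : MvPowerSeries (Fin 2) R) (i j : ι) (n : ℕ) :
    Λ.Q F :=
  Λ.recipX F (Λ.realRoot (alternatingProd (D.s i) (D.s j) n) i)

theorem demazureElement_eq_signedDelta (i j : ι) : Λ.demazureElement F 1 i =
    Λ.qToTwisted F (Λ.alternatingRecip F i j 0) * signedDelta i j 0 := by
  rw [demazureElement_one, signedDelta, pow_zero, one_mul, alternatingProd, map_one, one_mul,
    alternatingRecip, alternatingProd]

/-- The factor `1 - δ_{s_j}` splits into the word itself and the word lengthened by `s_j`; the sign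
`(-1)^n` absorbs the minus. -/
theorem signedDelta_mul (i j : ι) (n : ℕ) :
    signedDelta j i n * Λ.demazureElement F 1 i =
      (-1) ^ n * (Λ.delta F (alternatingProd (D.s j) (D.s i) n) * Λ.demazureElement F 1 i) +
        Λ.qToTwisted F (Λ.alternatingRecip F i j (n + 1)) * signedDelta i j (n + 1) := by
  have e : Λ.delta F (alternatingProd (D.s j) (D.s i) n) * Λ.delta F (D.s j) =
      Λ.delta F (alternatingProd (D.s i) (D.s j) (n + 1)) := by
    rw [← map_mul, alternatingProd]
  exact sign_mul_one_sub_mul n e (delta_mul_demazureElement _ i)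

theorem signedDelta_zero_mul (i j : ι) :
    signedDelta j i 0 * Λ.demazureElement F 1 i =
      Λ.qToTwisted F (Λ.alternatingRecip F i j 0) * signedDelta i j 0 +
        Λ.qToTwisted F (Λ.alternatingRecip F i j 1) * signedDelta i j 1 := by
  rw [signedDelta_mul, ← demazureElement_eq_signedDelta, alternatingProd, map_one, pow_zero,
    one_mul, one_mul]

/-- In the first term the word ends in `s_i`, which is stripped off against `X_i`, so the index
falls by one. -/
theorem signedDelta_succ_mul (hF : F = hyperbolic μ (-1)) (i j : ι) (n : ℕ) :
    signedDelta j i (n + 1) * Λ.demazureElement F 1 i =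
      Λ.qToTwisted F (algebraMap R (Λ.Q F) μ - Λ.alternatingRecip F i j n) * signedDelta i j n +
        Λ.qToTwisted F (Λ.alternatingRecip F i j (n + 2)) * signedDelta i j (n + 2) := by
  rw [signedDelta_mul, alternatingProd, sign_succ_mul n (delta_mul_s_mul_demazureElement hF
      (alternatingProd (D.s i) (D.s j) n) i)]
  rfl

/-- The element `p α_i + q α_j` of the lattice. -/
def pairRoot (Λ : FormalDemazureLattice D) (i j : ι) (c : ℤ × ℤ) : Λ.Carrier :=
  c.1 • Λ.simpleRoot i + c.2 • Λ.simpleRoot j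

theorem pairRoot_add (i j : ι) (c d : ℤ × ℤ) :
    Λ.pairRoot i j c + Λ.pairRoot i j d = Λ.pairRoot i j (c + d) := by
  rw [pairRoot, pairRoot, pairRoot, Prod.fst_add, Prod.snd_add, add_zsmul, add_zsmul]
  abel

theorem pairRoot_swap (i j : ι) (c : ℤ × ℤ) : Λ.pairRoot i j c.swap = Λ.pairRoot j i c :=
  add_comm _ _

theorem realRoot_eq_pairRoot {i j : ι} {a b : ℤ} (ha : A i j = -a) (hb : A j i = -b) (n : ℕ) :
    Λ.realRoot (alternatingProd (D.s i) (D.s j) n) i = Λ.pairRoot i j (altRoot a b n) := by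
  rw [realRoot_alternatingProd, ha, hb, neg_neg, neg_neg, pairRoot]

/-- The roots reached by alternating words have coordinates given by `altRoot`, so the rank two
computation applies to `1/x` as a function of coordinates. The condition `m ≠ 0` excludes infinite
type. -/
theorem exists_chainCoeff_eq [CharZero k] (hF : F = hyperbolic μ (-1)) {i j : ι} (hij : i ≠ j)
    {m : ℕ} (hm : m = orderOf (D.s i * D.s j)) (hm0 : m ≠ 0) :
    ∃ c, ∀ n < m, chainCoeff (algebraMap R (Λ.Q F) μ) (Λ.alternatingRecip F i j)
        (Λ.alternatingRecip F j i) m n = c ∧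
      chainCoeff (algebraMap R (Λ.Q F) μ) (Λ.alternatingRecip F j i)
        (Λ.alternatingRecip F i j) m n = c := by
  obtain ⟨a, b, ha, hb, h⟩ := D.orderOf_s_mul_s hij
  rw [← hm] at h
  have hf : ∀ c d e : ℤ × ℤ, c + d = e → Λ.pairRoot i j c ∈ Λ.realRoots →
      Λ.pairRoot i j d ∈ Λ.realRoots → Λ.pairRoot i j e ∈ Λ.realRoots →
      Λ.recipX F (Λ.pairRoot i j e) * (Λ.recipX F (Λ.pairRoot i j c) +
        Λ.recipX F (Λ.pairRoot i j d) - algebraMap R (Λ.Q F) μ) =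
      Λ.recipX F (Λ.pairRoot i j c) * Λ.recipX F (Λ.pairRoot i j d) - 1 := by
    rintro c d e rfl hc hd he
    exact recipX_add hF (pairRoot_add i j c d) hc hd he
  have ej : ∀ n, Λ.realRoot (alternatingProd (D.s j) (D.s i) n) j =
      Λ.pairRoot i j (altRoot b a n).swap := by
    intro n
    rw [pairRoot_swap, realRoot_eq_pairRoot hb ha]
  refine chainCoeff_altRoot (f := fun c => Λ.recipX F (Λ.pairRoot i j c))
    (U := fun c => Λ.pairRoot i j c ∈ Λ.realRoots) hf (a := a) (b := b)
    (h.resolve_left fun h => hm0 h.2.2.2) ?_ ?_ ?_ ?_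
  · intro n
    rw [alternatingRecip, realRoot_eq_pairRoot ha hb]
  · intro n
    rw [alternatingRecip, ej]
  · intro n
    rw [← realRoot_eq_pairRoot ha hb]
    exact Λ.realRoot_mem_realRoots _ _
  · intro n
    rw [← ej]
    exact Λ.realRoot_mem_realRoots _ _

/-- The braid relation for the elements `chain`. -/
theorem chain_demazureElement_comm [CharZero k] (hF : F = hyperbolic μ (-1)) {i j : ι}
    (hij : i ≠ j) {m : ℕ} (hm : m = orderOf (D.s i * D.s j)) (hm0 : m ≠ 0) :
    chain (Λ.demazureElement F 1 j) (Λ.demazureElement F 1 i) m =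
      chain (Λ.demazureElement F 1 i) (Λ.demazureElement F 1 j) m := by
  obtain ⟨c, hc⟩ := exists_chainCoeff_eq (Λ := Λ) hF hij hm hm0
  exact chain_comm_of_chainCoeff (demazureElement_eq_signedDelta i j)
    (demazureElement_eq_signedDelta j i) (signedDelta_zero_mul i j) (signedDelta_zero_mul j i)
    (signedDelta_succ_mul hF i j) (signedDelta_succ_mul hF j i) hc (sum_delta_alternating i j hm)

end KacMoody.FormalDemazureLattice

end

/-! ### The comparison map `T_i ↦ X_i - t` and its image -/

noncomputable section

theorem CoxeterSystem.ascent_induction {B W : Type*} [Group W] {M : CoxeterMatrix B}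
    (cs : CoxeterSystem M W) {p : W → Prop} (one : p 1)
    (mul : ∀ w i, ¬ cs.IsRightDescent w i → p w → p (w * cs.simple i)) (w : W) : p w := by
  induction h : cs.length w using Nat.strong_induction_on generalizing w with
  | _ n ih =>
    by_cases hw : w = 1
    · rwa [hw]
    · obtain ⟨i, hi⟩ := cs.exists_rightDescent_of_ne_one hw
      have h1 := mul (w * cs.simple i) i ((cs.isRightDescent_iff_not_isRightDescent_mul).1 hi)
        (ih _ (h ▸ hi) _ rfl)
      rwa [cs.simple_mul_simple_cancel_right] at h1

theorem map_altProd {S T G : Type*} [Monoid S] [Monoid T] [FunLike G S T] [MonoidHomClass G S T]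
    (f : G) (a b : S) (n : ℕ) :
    f (KacMoody.FormalDemazureLattice.altProd a b n) =
      KacMoody.FormalDemazureLattice.altProd (f a) (f b) n := by
  induction n generalizing a b with
  | zero => exact map_one f
  | succ n ih =>
    rw [KacMoody.FormalDemazureLattice.altProd, map_mul, ih,
      KacMoody.FormalDemazureLattice.altProd]

namespace KacMoody.FormalDemazureLattice

open FormalGroup Module BraidRelation

variable {k : Type*} [Field k] {ι : Type*} [Fintype ι] {A : Matrix ι ι ℤ}
  {𝔥 : Type*} [AddCommGroup 𝔥] [Module k 𝔥] {D : Realization k A 𝔥}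
  (Λ : FormalDemazureLattice D) {R : Type*} [CommRing R] (F : MvPowerSeries (Fin 2) R) (t : Rˣ)

/-! ### The generators in the twisted algebra -/

/-- The element `X_i - t` of the twisted algebra. -/
def twistedT (i : ι) : Λ.TwistedAlgebra F := Λ.demazureElement F 1 i - algebraMap R _ (t : R)

variable {Λ F t}

theorem algebraMap_unit_mul_inv :
    algebraMap R (Λ.TwistedAlgebra F) (t : R) * algebraMap R _ ((t⁻¹ : Rˣ) : R) = 1 := by
  rw [← map_mul, Units.mul_inv, map_one]

/-- The factors are `X_i` and `X_i - μ`. -/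
theorem twistedT_quadratic (hF : F = hyperbolic ((t : R) + ((t⁻¹ : Rˣ) : R)) (-1)) (i : ι) :
    (Λ.twistedT F t i + algebraMap R _ (t : R)) *
      (Λ.twistedT F t i - algebraMap R _ ((t⁻¹ : Rˣ) : R)) = 0 := by
  rw [twistedT, sub_add_cancel, sub_sub, ← map_add, mul_sub, demazureElement_mul_self hF,
    Algebra.commutes, sub_self]

theorem twistedT_mul_self (hF : F = hyperbolic ((t : R) + ((t⁻¹ : Rˣ) : R)) (-1)) (i : ι) :
    Λ.twistedT F t i * Λ.twistedT F t i =
      (algebraMap R _ ((t⁻¹ : Rˣ) : R) - algebraMap R _ (t : R)) * Λ.twistedT F t i + 1 := by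
  have h := twistedT_quadratic (Λ := Λ) hF i
  rw [add_mul, mul_sub, mul_sub, algebraMap_unit_mul_inv,
    ← Algebra.commutes ((t⁻¹ : Rˣ) : R) (Λ.twistedT F t i)] at h
  rw [sub_mul]
  rw [← sub_eq_zero, ← h]
  abel

theorem twistedT_braid [CharZero k] (hF : F = hyperbolic ((t : R) + ((t⁻¹ : Rˣ) : R)) (-1))
    {i j : ι} (hij : i ≠ j) (hm : orderOf (D.s i * D.s j) ≠ 0) :
    altProd (Λ.twistedT F t i) (Λ.twistedT F t j) (orderOf (D.s i * D.s j)) =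
      altProd (Λ.twistedT F t j) (Λ.twistedT F t i) (orderOf (D.s i * D.s j)) := by
  rw [alternatingProd.altProd_comm_iff]
  refine alternatingProd_comm_of_chain (t := algebraMap R _ (t : R))
    (Algebra.commutes (t : R)) algebraMap_unit_mul_inv (twistedT_mul_self hF i)
    (twistedT_mul_self hF j) ?_
  rw [twistedT, twistedT, sub_add_cancel, sub_add_cancel]
  exact (chain_demazureElement_comm hF hij rfl hm).symm

/-- The same commutator with `X_i` in place of `X_i - t` equals `Δ_i(γ)`. The shift by `t`
contributes `-t (γ - s_i(γ)) = -t x_{α_i} Δ_i(γ)`, whence the factor `1 - t x_{α_i}`. -/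
theorem fgaToTwisted_commutation {μ : R} (hF : F = hyperbolic μ (-1)) (i : ι) (γ : Λ.FGA F) :
    Λ.fgaToTwisted F γ * Λ.twistedT F t i -
        Λ.twistedT F t i * Λ.fgaToTwisted F (Λ.fgaAction F (D.s i) γ) =
      Λ.fgaToTwisted F ((1 - algebraMap R _ (t : R) * x F (Λ.simpleRoot i)) *
        Λ.demazureOperator F i γ) := by
  have h1 : (1 - Λ.delta F (D.s i)) * Λ.fgaToTwisted F (Λ.fgaAction F (D.s i) γ) =
      Λ.fgaToTwisted F (Λ.fgaAction F (D.s i) γ) - Λ.fgaToTwisted F γ * Λ.delta F (D.s i) := by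
    rw [sub_mul, one_mul, fgaToTwisted, delta_mul_qToTwisted, weyl_smul_algebraMap,
      ← fgaAction_mul_apply, D.s_mul_s, fgaAction_one_apply]
    rfl
  have h2 : Λ.qToTwisted F (Λ.recipX F (Λ.simpleRoot i)) * Λ.fgaToTwisted F γ =
      Λ.fgaToTwisted F γ * Λ.qToTwisted F (Λ.recipX F (Λ.simpleRoot i)) := by
    rw [fgaToTwisted, ← map_mul, ← map_mul, mul_comm]
  have h3 : Λ.fgaToTwisted F γ - Λ.fgaToTwisted F (Λ.fgaAction F (D.s i) γ) =
      Λ.qToTwisted F (algebraMap _ _ (x F (Λ.simpleRoot i))) *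
        Λ.fgaToTwisted F (Λ.demazureOperator F i γ) := by
    rw [fgaToTwisted, fgaToTwisted, fgaToTwisted, ← map_sub, ← map_sub, ← map_mul, ← map_mul,
      Λ.x_mul_demazureOperator hF]
  have h4 : Λ.qToTwisted F (Λ.recipX F (Λ.simpleRoot i)) *
      (Λ.fgaToTwisted F γ - Λ.fgaToTwisted F (Λ.fgaAction F (D.s i) γ)) =
        Λ.fgaToTwisted F (Λ.demazureOperator F i γ) := by
    rw [h3, ← mul_assoc, ← map_mul, recipX_mul F (Λ.realRoot_mem_realRoots 1 i), map_one, one_mul]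
  have h5 : Λ.fgaToTwisted F γ * Λ.demazureElement F 1 i -
      Λ.demazureElement F 1 i * Λ.fgaToTwisted F (Λ.fgaAction F (D.s i) γ) =
        Λ.fgaToTwisted F (Λ.demazureOperator F i γ) := by
    rw [← h4, demazureElement_one, mul_assoc, h1, ← mul_assoc, ← h2]
    noncomm_ring
  have h6 : Λ.fgaToTwisted F ((1 - algebraMap R _ (t : R) * x F (Λ.simpleRoot i)) *
      Λ.demazureOperator F i γ) = Λ.fgaToTwisted F (Λ.demazureOperator F i γ) -
        algebraMap R _ (t : R) * (Λ.fgaToTwisted F γ -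
          Λ.fgaToTwisted F (Λ.fgaAction F (D.s i) γ)) := by
    rw [h3, algebraMap_twisted]
    simp only [fgaToTwisted, ← map_mul, ← map_sub, ← algebraMap_scalar]
    rw [sub_mul, one_mul, mul_assoc]
  rw [h6, ← h5, twistedT, mul_sub, sub_mul, Algebra.commutes (t : R) (_ - _)]
  rw [sub_mul, Algebra.commutes (t : R) (Λ.fgaToTwisted F (Λ.fgaAction F (D.s i) γ))]
  abel

/-! ### The homomorphism from the Hecke-type algebra to the twisted algebra -/

theorem fgaToTwisted_add (γ γ' : Λ.FGA F) :
    Λ.fgaToTwisted F (γ + γ') = Λ.fgaToTwisted F γ + Λ.fgaToTwisted F γ' := by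
  rw [fgaToTwisted, map_add, map_add]
  rfl

theorem fgaToTwisted_mul (γ γ' : Λ.FGA F) :
    Λ.fgaToTwisted F (γ * γ') = Λ.fgaToTwisted F γ * Λ.fgaToTwisted F γ' := by
  rw [fgaToTwisted, map_mul, map_mul]
  rfl

variable (Λ F t) in
/-- The map from the free algebra to the twisted algebra. -/
def freeToTwisted : FreeAlgebra R (Λ.FGA F ⊕ ι) →ₐ[R] Λ.TwistedAlgebra F :=
  FreeAlgebra.lift R (Sum.elim (Λ.fgaToTwisted F) (Λ.twistedT F t))

theorem freeToTwisted_freeγ (γ : Λ.FGA F) :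
    Λ.freeToTwisted F t (Λ.freeγ F γ) = Λ.fgaToTwisted F γ := by
  rw [freeToTwisted, freeγ, FreeAlgebra.lift_ι_apply]
  rfl

theorem freeToTwisted_freeT (i : ι) :
    Λ.freeToTwisted F t (Λ.freeT F i) = Λ.twistedT F t i := by
  rw [freeToTwisted, freeT, FreeAlgebra.lift_ι_apply]
  rfl

theorem freeToTwisted_rel [CharZero k] (hF : F = hyperbolic ((t : R) + ((t⁻¹ : Rˣ) : R)) (-1))
    ⦃f g : FreeAlgebra R (Λ.FGA F ⊕ ι)⦄ (h : Λ.HeckeRel F t f g) :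
    Λ.freeToTwisted F t f = Λ.freeToTwisted F t g := by
  cases h with
  | algebraMap r =>
    rw [freeToTwisted_freeγ, AlgHom.commutes]
    rfl
  | add γ γ' =>
    rw [map_add, freeToTwisted_freeγ, freeToTwisted_freeγ, freeToTwisted_freeγ, fgaToTwisted_add]
  | mul γ γ' =>
    rw [map_mul, freeToTwisted_freeγ, freeToTwisted_freeγ, freeToTwisted_freeγ, fgaToTwisted_mul]
  | quadratic i =>
    rw [map_mul, map_add, map_sub, AlgHom.commutes, AlgHom.commutes, freeToTwisted_freeT, map_zero,
      twistedT_quadratic hF]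
  | braid i j hij hm =>
    have e : ∀ a b n, Λ.freeToTwisted F t (altProd a b n) =
        altProd (Λ.freeToTwisted F t a) (Λ.freeToTwisted F t b) n :=
      map_altProd (Λ.freeToTwisted F t)
    rw [e, e, freeToTwisted_freeT, freeToTwisted_freeT, twistedT_braid hF hij hm]
  | commutation i γ =>
    rw [map_sub, map_mul, map_mul, freeToTwisted_freeT, freeToTwisted_freeγ, freeToTwisted_freeγ,
      freeToTwisted_freeγ, fgaToTwisted_commutation hF]

variable (Λ) in
/-- The map from the Hecke-type algebra to the twisted algebra, `T_i ↦ X_i - t`. -/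
def heckeToTwisted [CharZero k] (hF : F = hyperbolic ((t : R) + ((t⁻¹ : Rˣ) : R)) (-1)) :
    Λ.HeckeAlgebra F t →ₐ[R] Λ.TwistedAlgebra F :=
  RingQuot.liftAlgHom R ⟨Λ.freeToTwisted F t, freeToTwisted_rel hF⟩

variable (Λ F t) in
/-- The generator `T_i` of the Hecke-type algebra. -/
def heckeT (i : ι) : Λ.HeckeAlgebra F t := RingQuot.mkAlgHom R (Λ.HeckeRel F t) (Λ.freeT F i)

section

variable [CharZero k] (hF : F = hyperbolic ((t : R) + ((t⁻¹ : Rˣ) : R)) (-1))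

theorem heckeToTwisted_mk (f : FreeAlgebra R (Λ.FGA F ⊕ ι)) :
    Λ.heckeToTwisted hF (RingQuot.mkAlgHom R (Λ.HeckeRel F t) f) = Λ.freeToTwisted F t f :=
  RingQuot.liftAlgHom_mkAlgHom_apply _ _ _ _

theorem heckeToTwisted_heckeOfFGA (γ : Λ.FGA F) :
    Λ.heckeToTwisted hF (Λ.heckeOfFGA F t γ) = Λ.fgaToTwisted F γ := by
  rw [heckeOfFGA, heckeToTwisted_mk, freeToTwisted_freeγ]

theorem heckeToTwisted_heckeT (i : ι) :
    Λ.heckeToTwisted hF (Λ.heckeT F t i) = Λ.twistedT F t i := by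
  rw [heckeT, heckeToTwisted_mk, freeToTwisted_freeT]

theorem fgaToTwisted_mem_range (γ : Λ.FGA F) :
    Λ.fgaToTwisted F γ ∈ (Λ.heckeToTwisted hF).range :=
  ⟨_, heckeToTwisted_heckeOfFGA hF γ⟩

theorem demazureElement_one_mem_range (i : ι) :
    Λ.demazureElement F 1 i ∈ (Λ.heckeToTwisted hF).range := by
  have h : Λ.demazureElement F 1 i = Λ.twistedT F t i + algebraMap R _ (t : R) :=
    (sub_add_cancel _ _).symm
  rw [h]
  exact add_mem ⟨_, heckeToTwisted_heckeT hF i⟩ (Subalgebra.algebraMap_mem _ _)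

/-- Solving the definition of `X_i` gives `δ_{s_i} = 1 - x_{α_i} X_i`, and the simple reflections
generate the Weyl group. -/
theorem delta_mem_range (w : D.weylGroup) : Λ.delta F w ∈ (Λ.heckeToTwisted hF).range := by
  induction w using D.coxeterSystem.simple_induction_right with
  | one =>
    rw [map_one]
    exact one_mem _
  | mul_simple_right w i ih =>
    have h : Λ.delta F (D.s i) =
        1 - Λ.fgaToTwisted F (x F (Λ.simpleRoot i)) * Λ.demazureElement F 1 i := by
      rw [demazureElement_one, fgaToTwisted, ← mul_assoc, ← map_mul, mul_comm (algebraMap _ _ _),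
        recipX_mul F (Λ.realRoot_mem_realRoots 1 i), map_one, one_mul, sub_sub_cancel]
    rw [map_mul, D.coxeterSystem_simple, h]
    exact mul_mem ih (sub_mem (one_mem _) (mul_mem (fgaToTwisted_mem_range hF _)
      (demazureElement_one_mem_range hF i)))

theorem range_heckeToTwisted :
    (Λ.heckeToTwisted hF).range = Λ.formalAffineDemazureAlgebra F := by
  apply le_antisymm
  · rintro _ ⟨h, rfl⟩
    obtain ⟨f, rfl⟩ := RingQuot.mkAlgHom_surjective R _ h
    change Λ.heckeToTwisted hF (RingQuot.mkAlgHom R (Λ.HeckeRel F t) f) ∈ _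
    rw [heckeToTwisted_mk]
    induction f using FreeAlgebra.induction with
    | grade0 r =>
      rw [AlgHom.commutes]
      exact Subalgebra.algebraMap_mem _ _
    | grade1 a =>
      rw [freeToTwisted, FreeAlgebra.lift_ι_apply]
      rcases a with γ | i
      · exact Algebra.subset_adjoin (Or.inl ⟨γ, rfl⟩)
      · exact sub_mem (Algebra.subset_adjoin (Or.inr (Algebra.subset_adjoin ⟨1, i, rfl⟩)))
          (Subalgebra.algebraMap_mem _ _)
    | mul f g hf hg =>
      rw [map_mul]
      exact mul_mem hf hg
    | add f g hf hg =>
      rw [map_add]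
      exact add_mem hf hg
  · refine Algebra.adjoin_le (Set.union_subset ?_ (Algebra.adjoin_le ?_))
    · rintro _ ⟨γ, rfl⟩
      exact fgaToTwisted_mem_range hF γ
    · rintro _ ⟨w, i, rfl⟩
      rw [demazureElement_conj]
      exact mul_mem (mul_mem (delta_mem_range hF w) (demazureElement_one_mem_range hF i))
        (delta_mem_range hF _)

end

end KacMoody.FormalDemazureLattice

end

/-! ### The elements `T_w` and injectivity -/

noncomputable section

namespace KacMoody.FormalDemazureLattice

open FormalGroup Module BraidRelation

variable {k : Type*} [Field k] {ι : Type*} [Fintype ι] {A : Matrix ι ι ℤ}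
  {𝔥 : Type*} [AddCommGroup 𝔥] [Module k 𝔥] {D : Realization k A 𝔥}
  {Λ : FormalDemazureLattice D} {R : Type*} [CommRing R] {F : MvPowerSeries (Fin 2) R} {t : Rˣ}

/-! ### The standard spanning set of the Hecke-type algebra -/

theorem heckeOfFGA_algebraMap (r : R) :
    Λ.heckeOfFGA F t (algebraMap R _ r) = algebraMap R _ r := by
  rw [heckeOfFGA, RingQuot.mkAlgHom_rel R (HeckeRel.algebraMap r), AlgHom.commutes]

theorem heckeOfFGA_add (γ γ' : Λ.FGA F) :
    Λ.heckeOfFGA F t (γ + γ') = Λ.heckeOfFGA F t γ + Λ.heckeOfFGA F t γ' := by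
  rw [heckeOfFGA, RingQuot.mkAlgHom_rel R (HeckeRel.add γ γ'), map_add]
  rfl

theorem heckeOfFGA_mul (γ γ' : Λ.FGA F) :
    Λ.heckeOfFGA F t (γ * γ') = Λ.heckeOfFGA F t γ * Λ.heckeOfFGA F t γ' := by
  rw [heckeOfFGA, RingQuot.mkAlgHom_rel R (HeckeRel.mul γ γ'), map_mul]
  rfl

theorem heckeOfFGA_one : Λ.heckeOfFGA F t 1 = 1 := by
  rw [← map_one (algebraMap R (Λ.FGA F)), heckeOfFGA_algebraMap, map_one]

variable (Λ F t) in
/-- The map from the formal group algebra to the Hecke-type algebra. -/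
def heckeOfFGAHom : Λ.FGA F →+* Λ.HeckeAlgebra F t :=
  RingHom.mk' ⟨⟨Λ.heckeOfFGA F t, heckeOfFGA_one⟩, heckeOfFGA_mul⟩ heckeOfFGA_add

theorem heckeOfFGAHom_apply (γ : Λ.FGA F) :
    Λ.heckeOfFGAHom F t γ = Λ.heckeOfFGA F t γ := rfl

theorem heckeT_mul_self (i : ι) : Λ.heckeT F t i * Λ.heckeT F t i =
    Λ.heckeOfFGAHom F t (algebraMap R _ (((t⁻¹ : Rˣ) : R) - t)) * Λ.heckeT F t i + 1 := by
  have h := RingQuot.mkAlgHom_rel R (HeckeRel.quadratic (Λ := Λ) (F := F) (t := t) i)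
  rw [map_mul, map_add, map_sub, AlgHom.commutes, AlgHom.commutes, map_zero] at h
  change (Λ.heckeT F t i + _) * (Λ.heckeT F t i - _) = 0 at h
  rw [add_mul, mul_sub, mul_sub, ← map_mul, Units.mul_inv, map_one,
    ← Algebra.commutes ((t⁻¹ : Rˣ) : R) (Λ.heckeT F t i)] at h
  rw [heckeOfFGAHom_apply, heckeOfFGA_algebraMap, map_sub, sub_mul, ← sub_eq_zero, ← h]
  abel

/-- The commutation relation at `s_i(γ)`, solved for `T_i γ`, moves coefficients to the left. -/
theorem heckeT_mul_heckeOfFGAHom (i : ι) (γ : Λ.FGA F) :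
    Λ.heckeT F t i * Λ.heckeOfFGAHom F t γ =
      Λ.heckeOfFGAHom F t (Λ.fgaAction F (D.s i) γ) * Λ.heckeT F t i +
        Λ.heckeOfFGAHom F t (-((1 - algebraMap R _ (t : R) * x F (Λ.simpleRoot i)) *
          Λ.demazureOperator F i (Λ.fgaAction F (D.s i) γ))) := by
  have h := RingQuot.mkAlgHom_rel R (HeckeRel.commutation (Λ := Λ) (F := F) (t := t) i
    (Λ.fgaAction F (D.s i) γ))
  rw [map_sub, map_mul, map_mul, ← fgaAction_mul_apply, D.s_mul_s, fgaAction_one_apply] at h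
  change Λ.heckeOfFGAHom F t _ * Λ.heckeT F t i - Λ.heckeT F t i * Λ.heckeOfFGAHom F t γ =
    Λ.heckeOfFGAHom F t _ at h
  rw [map_neg, ← h]
  abel

theorem coeff_mul_twistedT (f : Λ.TwistedAlgebra F) (i : ι) (v : D.weylGroup) :
    (f * Λ.twistedT F t i).coeff v =
      f.coeff v * v • (Λ.recipX F (Λ.simpleRoot i) - algebraMap R (Λ.Q F) (t : R)) -
        f.coeff (v * D.s i) * (v * D.s i) • Λ.recipX F (Λ.simpleRoot i) := by
  have h : Λ.twistedT F t i = SkewMonoidAlgebra.single 1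
      (Λ.recipX F (Λ.simpleRoot i) - algebraMap R (Λ.Q F) (t : R)) -
        SkewMonoidAlgebra.single (D.s i) (Λ.recipX F (Λ.simpleRoot i)) := by
    rw [twistedT, demazureElement_one, mul_sub, mul_one, qToTwisted_mul_delta, algebraMap_twisted,
      sub_right_comm, ← map_sub]
    rfl
  rw [h, mul_sub, SkewMonoidAlgebra.coeff_sub, Finsupp.sub_apply,
    SkewMonoidAlgebra.coeff_mul_single_one, SkewMonoidAlgebra.coeff_mul_single, D.s_inv]

section

variable [CharZero k]

theorem heckeT_braid (i j : ι) (hij : i ≠ j) (hm : D.coxeterMatrix i j ≠ 0) :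
    ((CoxeterSystem.alternatingWord i j (D.coxeterMatrix i j)).map (Λ.heckeT F t)).prod =
      ((CoxeterSystem.alternatingWord j i (D.coxeterMatrix i j)).map (Λ.heckeT F t)).prod := by
  rw [Realization.coxeterMatrix_apply] at hm ⊢
  rw [alternatingProd.prod_alternatingWord, alternatingProd.prod_alternatingWord,
    ← alternatingProd.altProd_comm_iff]
  have h := RingQuot.mkAlgHom_rel R (HeckeRel.braid (Λ := Λ) (F := F) (t := t) i j hij hm)
  rwa [map_altProd, map_altProd] at h

variable (Λ F t) in
/-- The element `T_w` of the Hecke-type algebra. -/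
def heckeTw (w : D.weylGroup) : Λ.HeckeAlgebra F t :=
  D.coxeterSystem.reducedProd (Λ.heckeT F t) w

theorem heckeTw_one : Λ.heckeTw F t 1 = 1 := D.weylRootData.reducedProd_one heckeT_braid

theorem heckeTw_mul_s {w : D.weylGroup} {i : ι}
    (h : ¬ D.coxeterSystem.IsRightDescent w i) :
    Λ.heckeTw F t (w * D.s i) = Λ.heckeTw F t w * Λ.heckeT F t i := by
  rw [← D.coxeterSystem_simple]
  exact D.weylRootData.reducedProd_mul_simple heckeT_braid h

/-- At an ascent the product is again some `T_v`. At a descent `T_w = T_{w s_i} T_i`, and the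
quadratic relation leaves two terms. -/
theorem exists_heckeTw_mul_heckeT (w : D.weylGroup) (i : ι) :
    ∃ (γ γ' : Λ.FGA F) (v v' : D.weylGroup), Λ.heckeTw F t w * Λ.heckeT F t i =
      Λ.heckeOfFGAHom F t γ * Λ.heckeTw F t v + Λ.heckeOfFGAHom F t γ' * Λ.heckeTw F t v' := by
  by_cases h : D.coxeterSystem.IsRightDescent w i
  · have h1 := heckeTw_mul_s (Λ := Λ) (F := F) (t := t)
      ((D.coxeterSystem.isRightDescent_iff_not_isRightDescent_mul).1 h)
    rw [D.coxeterSystem_simple, mul_assoc, D.s_mul_s, mul_one] at h1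
    refine ⟨algebraMap R _ (((t⁻¹ : Rˣ) : R) - t), 1, w, w * D.s i, ?_⟩
    rw [h1, mul_assoc, heckeT_mul_self, mul_add, mul_one, map_one, one_mul, heckeOfFGAHom_apply,
      heckeOfFGA_algebraMap, ← mul_assoc, ← mul_assoc, Algebra.commutes]
  · exact ⟨1, 0, w * D.s i, 1, by rw [heckeTw_mul_s h, map_one, one_mul, map_zero, zero_mul,
      _root_.add_zero]⟩

variable (Λ F t) in
/-- The span of the elements `T_w` over the formal group algebra. -/
def spanHeckeTw : AddSubmonoid (Λ.HeckeAlgebra F t) :=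
  AddSubmonoid.closure {h | ∃ γ w, h = Λ.heckeOfFGAHom F t γ * Λ.heckeTw F t w}

theorem heckeOfFGAHom_mul_mem_span (γ : Λ.FGA F) {h : Λ.HeckeAlgebra F t}
    (hh : h ∈ Λ.spanHeckeTw F t) : Λ.heckeOfFGAHom F t γ * h ∈ Λ.spanHeckeTw F t := by
  induction hh using AddSubmonoid.closure_induction with
  | mem h hh =>
    obtain ⟨γ', w, rfl⟩ := hh
    rw [← mul_assoc, ← map_mul]
    exact AddSubmonoid.subset_closure ⟨_, w, rfl⟩
  | zero =>
    rw [mul_zero]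
    exact zero_mem _
  | add f g _ _ hf hg =>
    rw [mul_add]
    exact add_mem hf hg

theorem heckeTw_mem_span (w : D.weylGroup) : Λ.heckeTw F t w ∈ Λ.spanHeckeTw F t :=
  AddSubmonoid.subset_closure ⟨1, w, by rw [map_one, one_mul]⟩

theorem mul_mem_span_of_heckeTw {g : Λ.HeckeAlgebra F t}
    (hg : ∀ w, Λ.heckeTw F t w * g ∈ Λ.spanHeckeTw F t) {h : Λ.HeckeAlgebra F t}
    (hh : h ∈ Λ.spanHeckeTw F t) : h * g ∈ Λ.spanHeckeTw F t := by
  induction hh using AddSubmonoid.closure_induction with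
  | mem h hh =>
    obtain ⟨γ', w, rfl⟩ := hh
    rw [mul_assoc]
    exact heckeOfFGAHom_mul_mem_span _ (hg w)
  | zero =>
    rw [zero_mul]
    exact zero_mem _
  | add f g _ _ hf hg =>
    rw [add_mul]
    exact add_mem hf hg

theorem mul_heckeT_mem_span (i : ι) {h : Λ.HeckeAlgebra F t}
    (hh : h ∈ Λ.spanHeckeTw F t) : h * Λ.heckeT F t i ∈ Λ.spanHeckeTw F t := by
  refine mul_mem_span_of_heckeTw (fun w => ?_) hh
  obtain ⟨γ, γ', v, v', e⟩ := exists_heckeTw_mul_heckeT (Λ := Λ) (F := F) (t := t) w i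
  rw [e]
  exact add_mem (heckeOfFGAHom_mul_mem_span _ (heckeTw_mem_span v))
    (heckeOfFGAHom_mul_mem_span _ (heckeTw_mem_span v'))

/-- Moving `γ` past the last letter of `T_w` produces coefficients to the right of a shorter `T_v`,
which is why the induction runs over all `γ`. -/
theorem mul_heckeOfFGAHom_mem_span (γ : Λ.FGA F) {h : Λ.HeckeAlgebra F t}
    (hh : h ∈ Λ.spanHeckeTw F t) : h * Λ.heckeOfFGAHom F t γ ∈ Λ.spanHeckeTw F t := by
  refine mul_mem_span_of_heckeTw (fun w => ?_) hh
  induction w using D.coxeterSystem.ascent_induction generalizing γ with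
  | one =>
    rw [heckeTw_one, one_mul, ← mul_one (Λ.heckeOfFGAHom F t γ), ← heckeTw_one]
    exact heckeOfFGAHom_mul_mem_span _ (heckeTw_mem_span 1)
  | mul w i hwi ih =>
    rw [D.coxeterSystem_simple, heckeTw_mul_s hwi, mul_assoc, heckeT_mul_heckeOfFGAHom, mul_add,
      ← mul_assoc]
    exact add_mem (mul_heckeT_mem_span i (ih _)) (ih _)

/-- The elements `T_w` span the Hecke-type algebra over the formal group algebra. -/
theorem mem_spanHeckeTw (h : Λ.HeckeAlgebra F t) : h ∈ Λ.spanHeckeTw F t := by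
  obtain ⟨f, rfl⟩ := RingQuot.mkAlgHom_surjective R _ h
  suffices H : ∀ g ∈ Λ.spanHeckeTw F t,
      g * RingQuot.mkAlgHom R (Λ.HeckeRel F t) f ∈ Λ.spanHeckeTw F t by
    have := H 1 (heckeTw_one (Λ := Λ) (F := F) (t := t) ▸ heckeTw_mem_span 1)
    rwa [one_mul] at this
  induction f using FreeAlgebra.induction with
  | grade0 r =>
    intro g hg
    rw [AlgHom.commutes, ← heckeOfFGA_algebraMap]
    exact mul_heckeOfFGAHom_mem_span _ hg
  | grade1 a =>
    intro g hg
    rcases a with γ | i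
    · exact mul_heckeOfFGAHom_mem_span γ hg
    · exact mul_heckeT_mem_span i hg
  | mul f f' hf hf' =>
    intro g hg
    rw [map_mul, ← mul_assoc]
    exact hf' _ (hf g hg)
  | add f f' hf hf' =>
    intro g hg
    rw [map_add, mul_add]
    exact add_mem (hf g hg) (hf' g hg)

theorem exists_eq_sum_heckeTw (h : Λ.HeckeAlgebra F t) : ∃ c : D.weylGroup →₀ Λ.FGA F,
    h = c.sum fun w γ => Λ.heckeOfFGAHom F t γ * Λ.heckeTw F t w := by
  induction mem_spanHeckeTw h using AddSubmonoid.closure_induction with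
  | mem h hh =>
    obtain ⟨γ, w, rfl⟩ := hh
    exact ⟨Finsupp.single w γ, by rw [Finsupp.sum_single_index (by rw [map_zero, zero_mul])]⟩
  | zero => exact ⟨0, by rw [Finsupp.sum_zero_index]⟩
  | add f g _ _ hf hg =>
    classical
    obtain ⟨c, rfl⟩ := hf
    obtain ⟨d, rfl⟩ := hg
    refine ⟨c + d, ?_⟩
    rw [Finsupp.sum_add_index]
    · intro w _
      rw [map_zero, zero_mul]
    · intro w _ γ γ'
      rw [map_add, add_mul]

/-! ### Injectivity -/

/-- The map is triangular with respect to length: each further letter multiplies the leading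
coefficient by `-1/x_α` for a real root `α`, a unit of the localization. -/
theorem coeff_heckeToTwisted_heckeTw
    (hF : F = hyperbolic ((t : R) + ((t⁻¹ : Rˣ) : R)) (-1)) (w : D.weylGroup) :
    IsUnit ((Λ.heckeToTwisted hF (Λ.heckeTw F t w)).coeff w) ∧
      ∀ v, v ≠ w → D.coxeterSystem.length w ≤ D.coxeterSystem.length v →
        (Λ.heckeToTwisted hF (Λ.heckeTw F t w)).coeff v = 0 := by
  induction w using D.coxeterSystem.ascent_induction with
  | one =>
    rw [heckeTw_one, map_one (Λ.heckeToTwisted hF)]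
    refine ⟨by rw [SkewMonoidAlgebra.coeff_one, Finsupp.single_eq_same]; exact isUnit_one,
      fun v hv _ => ?_⟩
    rw [SkewMonoidAlgebra.coeff_one, Finsupp.single_eq_of_ne hv]
  | mul w i hwi ih =>
    obtain ⟨ih1, ih2⟩ := ih
    have hl := (D.coxeterSystem.not_isRightDescent_iff).1 hwi
    rw [D.coxeterSystem_simple] at hl ⊢
    rw [heckeTw_mul_s hwi, map_mul (Λ.heckeToTwisted hF), heckeToTwisted_heckeT]
    have hws : w * D.s i ≠ w := by
      intro h
      rw [h] at hl
      omega
    constructor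
    -- Only the `δ_{s_i}` part of `X_i` reaches `w s_i`, since the coefficient of the previous
    -- element at `w s_i` is zero.
    · rw [coeff_mul_twistedT, ih2 _ hws (by omega), zero_mul, zero_sub, mul_assoc, D.s_mul_s,
        mul_one]
      refine (ih1.mul ?_).neg
      rw [smul_recipX F w (Λ.realRoot_mem_realRoots 1 i)]
      exact IsUnit.of_mul_eq_one _ (recipX_mul F
        (Λ.latticeAction_mem_realRoots w (Λ.realRoot_mem_realRoots 1 i)))
    · intro v hv hlv
      have h1 : v ≠ w := by
        rintro rfl
        omega
      have h2 : v * D.s i ≠ w := by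
        rintro rfl
        exact hv (by rw [mul_assoc, D.s_mul_s, mul_one])
      have h3 := D.coxeterSystem.length_mul_simple v i
      rw [D.coxeterSystem_simple] at h3
      rw [coeff_mul_twistedT, ih2 v h1 (by omega), ih2 _ h2 (by omega), zero_mul, zero_mul,
        sub_zero]

theorem heckeToTwisted_injective (hF : F = hyperbolic ((t : R) + ((t⁻¹ : Rˣ) : R)) (-1)) :
    Function.Injective (Λ.heckeToTwisted hF) := by
  rw [injective_iff_map_eq_zero]
  intro h hh
  obtain ⟨c, rfl⟩ := exists_eq_sum_heckeTw h
  suffices hc : c = 0 by rw [hc, Finsupp.sum_zero_index]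
  by_contra hc
  -- For `w` of maximal length in the support, no other `T_v` contributes to the coefficient at `w`.
  obtain ⟨w, hw, hmax⟩ := Finset.exists_max_image c.support D.coxeterSystem.length
    (Finsupp.support_nonempty_iff.2 hc)
  have h1 := congrArg (fun f : Λ.TwistedAlgebra F => f.coeff w) hh
  simp only [Finsupp.sum, map_sum, map_mul] at h1
  have h2 : ∀ (s : Finset D.weylGroup) (g : D.weylGroup → Λ.TwistedAlgebra F),
      (∑ v ∈ s, g v).coeff w = ∑ v ∈ s, (g v).coeff w := by
    intro s g
    exact map_sum ((Finsupp.applyAddHom w).comp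
      (SkewMonoidAlgebra.coeffAddEquiv : Λ.TwistedAlgebra F ≃+ _).toAddMonoidHom) g s
  have h3 : ∀ v, (Λ.heckeToTwisted hF (Λ.heckeOfFGAHom F t (c v)) *
      Λ.heckeToTwisted hF (Λ.heckeTw F t v)).coeff w =
      algebraMap _ _ (c v) * (Λ.heckeToTwisted hF (Λ.heckeTw F t v)).coeff w := by
    intro v
    rw [heckeOfFGAHom_apply, heckeToTwisted_heckeOfFGA]
    exact SkewMonoidAlgebra.coeff_single_one_mul _ _ _
  rw [h2, Finset.sum_congr rfl fun v _ => h3 v, Finset.sum_eq_single_of_mem w hw] at h1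
  · have h4 : algebraMap (Λ.FGA F) (Λ.Q F) (c w) = 0 :=
      (coeff_heckeToTwisted_heckeTw hF w).1.mul_left_eq_zero.1 h1
    rw [map_eq_zero_iff _ (Λ.algebraMap_injective hF)] at h4
    exact (Finsupp.mem_support_iff.1 hw) h4
  · intro v hv hvw
    rw [(coeff_heckeToTwisted_heckeTw hF v).2 w hvw.symm (hmax v hv), mul_zero]

end

end KacMoody.FormalDemazureLattice

end

/-- `R` contains `ℤ[t, t⁻¹]` through `incl`, and `t` is regarded as a unit of `R`. -/
theorem corollary5p3
    {k : Type*} [Field k] [CharZero k]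
    {ι : Type*} [Fintype ι] {A : Matrix ι ι ℤ}
    {𝔥 : Type*} [AddCommGroup 𝔥] [Module k 𝔥]
    (D : KacMoody.Realization k A 𝔥) (Λ : KacMoody.FormalDemazureLattice D)
    {R : Type*} [CommRing R]
    (incl : LaurentPolynomial ℤ →+* R) (hincl : Function.Injective incl)
    (t : Rˣ) (ht : (t : R) = incl (LaurentPolynomial.T 1))
    (F : MvPowerSeries (Fin 2) R)
    (hF : F = FormalGroup.hyperbolic ((t : R) + ((t⁻¹ : Rˣ) : R)) (-1)) :
    ∃ e : Λ.formalAffineDemazureAlgebra F ≃ₐ[R] Λ.HeckeAlgebra F t,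
      ∀ γ : Λ.FGA F, e (Λ.ofFGA F γ) = Λ.heckeOfFGA F t γ := by
  -- The presentation makes maps out of the Hecke-type algebra easy to define, so the equivalence is
  -- built from that side and inverted.
  let e : Λ.HeckeAlgebra F t ≃ₐ[R] Λ.formalAffineDemazureAlgebra F :=
    (AlgEquiv.ofInjective (Λ.heckeToTwisted hF)
      (KacMoody.FormalDemazureLattice.heckeToTwisted_injective hF)).trans
        (Subalgebra.equivOfEq _ _ (KacMoody.FormalDemazureLattice.range_heckeToTwisted hF))
  refine ⟨e.symm, fun γ => ?_⟩
  rw [AlgEquiv.symm_apply_eq]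
  exact Subtype.ext (KacMoody.FormalDemazureLattice.heckeToTwisted_heckeOfFGA hF γ).symm
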